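/- **Notation.** $\mathbb N=\{0,1,2,\dots\}$, $\mathbb N^*=\{1,2,\dots\}$. Let $m\in\mathbb N^*$ and $I_m=\{(j,\alpha)\in\mathbb N\times\mathbb N: j+\alpha\le m,\ j<m\}$. Let $c_{j,\alpha}(x)$ ($(j,\alpha)\in I_m$) and $a(x)$ be holomorphic near $x=0\in\mathbb C$ and put $$C(x;\lambda,\rho)=\lambda^m-\sum_{(j,\alpha)\in I_m}c_{j,\alpha}(x)\,\lambda^j\rho(\rho-1)\cdots(\rho-\alpha+1),\qquad L(\lambda,\rho)=C(0;\lambda,\rho).$$ Let $\mathcal M$ be a finite subset of $\mathbb N\times\mathbb N$, $N=\#\mathcal M$, and let $G_2(t,x,\boldsymbol z)$, $\boldsymbol z=\{z_{j,\alpha}\}_{(j,\alpha)\in\mathcal M}$, be holomorphic near the origin of $\mathbb C_t\times\mathbb C_x\times\mathbb C^N_{\boldsymbol z}$ with a Taylor expansion in $(t,\boldsymbol z)$ of the form $$G_2(t,x,\boldsymbol z)=\sum_{i+|\boldsymbol\nu|\ge2}g_{i,\boldsymbol\nu}(x)\,t^i\boldsymbol z^{\boldsymbol\nu}.$$ Consider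 the equation $$C(x;t\partial_t,x\partial_x)u=a(x)t+G_2\bigl(t,x,\{(t\partial_t)^j\partial_x^\alpha u\}_{(j,\alpha)\in\mathcal M}\bigr),\tag{E}$$ where in $C(x;t\partial_t,x\partial_x)$ the coefficients $c_{j,\alpha}(x)$ act from the left. **Newton polygon.** Put $c_{m,0}(x)=-1$, $\Lambda_0=\{(m,0)\}\cup\{(j,\alpha)\in I_m: c_{j,\alpha}(0)\ne0\}$, and let $\mathcal N_0\subset\mathbb R^2$ be the convex hull of $\bigcup_{(j,\alpha)\in\Lambda_0}\{(x,y):x\le j,\ y\le\alpha\}$. Its vertices are $(m_1,n_1)=(m,0),(m_2,n_2),\dots,(m_p,n_p)$ with $m_1>m_2>\cdots>m_p$; its boundary consists of a vertical half line, the segments $\Gamma_i$ joining $(m_i,n_i)$ to $(m_{i+1},n_{i+1})$ ($1\le i\le p-1$), and a horizontal half line $\Gamma_p$ ending at $(m_p,n_p)$. Put $P_i(X)=\sum_{(j,\alpha)\in\Lambda_0\cap\Gamma_i}c_{j,\alpha}(0)X^{j-m_{i+1}}$ for $1\le i\le p-1$ and $P_p(X)=\sum_{(j,\alpha)\in\Lambda_0\cap\Gamma_p}c_{j,\alpha}(0)X^{j}$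 (a nonzero constant if $m_p=0$). **Conditions.** (N) $L(k,l)\ne0$ for all $(k,l)\in\mathbb N^*\times\mathbb N$. (GP) For $1\le i\le p-1$ all roots of $P_i$ lie in $\mathbb C\setminus[0,\infty)$, and all roots of $P_p$ lie in $\mathbb C\setminus\mathbb N^*$. **Indices.** Let $\Lambda_1=\{(j,\alpha)\in I_m: c_{j,\alpha}(0)=0,\ c_{j,\alpha}\not\equiv0\}$; for $(j,\alpha)\in\Lambda_1$ let $p_{j,\alpha}$ be the order of the zero of $c_{j,\alpha}$ at $0$ and $d_{j,\alpha}=\min\{y\in\mathbb R:(j,\alpha-y)\in\mathcal N_0\}$, and set $$\sigma_0=\max\Bigl[1,\ \max_{(j,\alpha)\in\Lambda_1}\frac{p_{j,\alpha}+d_{j,\alpha}}{p_{j,\alpha}}\Bigr].$$ For $\mu\in\mathbb N$ let $J_\mu=\{(i,\boldsymbol\nu)\in\mathbb N\times\mathbb N^N: i+|\boldsymbol\nu|\ge2,\ |\boldsymbol\nu|\ge1,\ (\partial_x^\mu g_{i,\boldsymbol\nu})(0)\ne0\}$; for $|\boldsymbol\nu|\ge1$ let $m_{\boldsymbol\nu,\mu}=\max\{\,j+\max\{\alpha,\mu+\sigma_0(\alpha-\mu)\}:(j,\alpha)\in\mathcal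 M,\ \nu_{j,\alpha}>0\}$, and set $$s_0=1+\max\Bigl[0,\ \sup_{\mu\ge0}\ \sup_{(i,\boldsymbol\nu)\in J_\mu}\frac{m_{\boldsymbol\nu,\mu}-m}{i+|\boldsymbol\nu|-1}\Bigr]$$ (maxima and suprema over empty sets are omitted). For $s,\sigma\ge1$, $G\{t,x\}_{(s,\sigma)}$ is the set of all $\sum_{k,l\ge0}a_{k,l}t^kx^l\in\mathbb C[[t,x]]$ such that $\sum_{k,l\ge0}\frac{a_{k,l}}{k!^{s-1}l!^{\sigma-1}}t^kx^l$ converges in a neighbourhood of $(0,0)$. **Theorem.** Suppose that (N) and (GP) hold. Then equation (E) has a unique formal solution $u(t,x)\in\mathbb C[[t,x]]$ satisfying $u(0,x)\equiv0$, and it belongs to $G\{t,x\}_{(s,\sigma)}$ for all $s\ge s_0$ and $\sigma\ge\sigma_0$. -/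

import Mathlib

open scoped Nat Topology

noncomputable section

namespace TotChar

/-! ### Power series, Taylor series, Gevrey classes -/

/-- The ring `ℂ[[t, x]]`; variable `0` is `t`, variable `1` is `x`. -/
abbrev FormalTX : Type := MvPowerSeries (Fin 2) ℂ

/-- A formal power series converges in a neighbourhood of the origin. -/
def ConvergesNearZero {ι : Type} [Fintype ι] (f : MvPowerSeries ι ℂ) : Prop :=
  ∀ᶠ z in 𝓝 (0 : ι → ℂ), Summable fun e : ι →₀ ℕ => MvPowerSeries.coeff e f * ∏ i, z i ^ e i

/-- The series `∑ a_{k,l} / (k!^(s-1) l!^(σ-1)) t^k x^l` attached to `∑ a_{k,l} t^k x^l`. -/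
def borel (s σ : ℝ) (f : FormalTX) : FormalTX := fun e =>
  MvPowerSeries.coeff e f /
    ((((e 0)! : ℝ) ^ (s - 1) * ((e 1)! : ℝ) ^ (σ - 1) : ℝ) : ℂ)

/-- The formal Gevrey class `G{t,x}_{(s,σ)}`, for `s ≥ 1`, `σ ≥ 1`. -/
def Gevrey (s σ : ℝ) : Set FormalTX :=
  {f | 1 ≤ s ∧ 1 ≤ σ ∧ ConvergesNearZero (borel s σ f)}

/-- The Taylor series at the origin of a function of finitely many complex variables. The
coefficient at the multi-index `e` is `(∂^e f)(0) / e!`, the mixed partial derivative `∂^e` being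
the iterated derivative in the coordinate directions, direction `i` occurring `e i` times. -/
def taylorSeries {ι : Type} [Fintype ι] [DecidableEq ι] (f : (ι → ℂ) → ℂ) : MvPowerSeries ι ℂ :=
  fun e =>
    let dirs : List ι := (Finsupp.toMultiset e).toList
    iteratedFDeriv ℂ dirs.length f 0 (fun k => Pi.single (dirs.get k) (1 : ℂ)) /
      ((∏ i, (e i)! : ℕ) : ℂ)

/-- The Taylor series at `x = 0` of a function `f(x)`, as an element of `ℂ[[t, x]]`. -/
def taylorX (f : ℂ → ℂ) : FormalTX := fun e =>
  if e 0 = 0 then iteratedDeriv (e 1) f 0 / ((e 1)! : ℂ) else 0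

/-! ### Differential operators on `ℂ[[t, x]]` -/

/-- `∂_x`. -/
def dX : Module.End ℂ FormalTX := (MvPowerSeries.pderiv ℂ (1 : Fin 2)).toLinearMap

/-- `t ∂_t`. -/
def eulerT : Module.End ℂ FormalTX :=
  LinearMap.mulLeft ℂ (MvPowerSeries.X 0) ∘ₗ (MvPowerSeries.pderiv ℂ (0 : Fin 2)).toLinearMap

/-- `x ∂_x`. -/
def eulerX : Module.End ℂ FormalTX := LinearMap.mulLeft ℂ (MvPowerSeries.X 1) ∘ₗ dX

/-! ### The linear part

The data are an integer `m ≥ 1` and functions `c (j, α)`, `(j, α) ∈ I m`, holomorphic near `0`. -/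

/-- `I_m = {(j, α) : j + α ≤ m, j < m}`. -/
def I (m : ℕ) : Finset (ℕ × ℕ) :=
  (Finset.range (m + 1) ×ˢ Finset.range (m + 1)).filter fun p => p.1 + p.2 ≤ m ∧ p.1 < m

/-- `C(x; λ, ρ) = λ^m - ∑ c_{j,α}(x) λ^j ρ(ρ-1)⋯(ρ-α+1)`. -/
def C (m : ℕ) (c : ℕ × ℕ → ℂ → ℂ) (x lam rho : ℂ) : ℂ :=
  lam ^ m - ∑ p ∈ I m, c p x * lam ^ p.1 * (descPochhammer ℂ p.2).eval rho

/-- `L(λ, ρ) = C(0; λ, ρ)`. -/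
def L (m : ℕ) (c : ℕ × ℕ → ℂ → ℂ) (lam rho : ℂ) : ℂ := C m c 0 lam rho

/-- The operator `C(x; t∂_t, x∂_x)`, with the coefficients acting from the left. -/
def opC (m : ℕ) (c : ℕ × ℕ → ℂ → ℂ) (u : FormalTX) : FormalTX :=
  (eulerT ^ m) u -
    ∑ p ∈ I m, taylorX (c p) *
      (eulerT ^ p.1) ((Polynomial.aeval eulerX (descPochhammer ℂ p.2)) u)

/-- The non-resonance condition (N). -/
def NonResonant (m : ℕ) (c : ℕ × ℕ → ℂ → ℂ) : Prop :=
  ∀ k l : ℕ, 1 ≤ k → L m c k l ≠ 0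

/-! ### Newton polygon and generalized Poincaré condition -/

/-- The numbers `c_{j,α}(0)`, with the convention `c_{m,0} = -1`. -/
def c0 (m : ℕ) (c : ℕ × ℕ → ℂ → ℂ) (p : ℕ × ℕ) : ℂ := if p = (m, 0) then -1 else c p 0

open Classical in
/-- `Λ_0 = {(m, 0)} ∪ {(j, α) ∈ I_m : c_{j,α}(0) ≠ 0}`. -/
def Lam0 (m : ℕ) (c : ℕ × ℕ → ℂ → ℂ) : Finset (ℕ × ℕ) :=
  insert (m, 0) ((I m).filter fun p => c p 0 ≠ 0)

/-- A lattice point seen in the plane. -/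
def pt (p : ℕ × ℕ) : ℝ × ℝ := ((p.1 : ℝ), (p.2 : ℝ))

/-- The Newton polygon `N_0` at `x = 0`: the convex hull of the union of the quadrants
`{(x, y) : x ≤ j, y ≤ α}`, `(j, α) ∈ Λ_0`. -/
def newton (m : ℕ) (c : ℕ × ℕ → ℂ → ℂ) : Set (ℝ × ℝ) :=
  convexHull ℝ (⋃ p ∈ Lam0 m c, {q : ℝ × ℝ | q.1 ≤ (p.1 : ℝ) ∧ q.2 ≤ (p.2 : ℝ)})

/-- The part of the boundary of the Newton polygon lying on its supporting line of slope `-r`,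
`r ≥ 0`. For `r = 0` this is the horizontal half line `Γ_p`. For `r > 0` it is one of the segments
`Γ_1, …, Γ_{p-1}` if it has more than one point, and a vertex otherwise. -/
def side (m : ℕ) (c : ℕ × ℕ → ℂ → ℂ) (r : ℝ) : Set (ℝ × ℝ) :=
  {q | q ∈ newton m c ∧ ∀ q' ∈ newton m c, r * q'.1 + q'.2 ≤ r * q.1 + q.2}

open Classical in
/-- `Λ_0 ∩ Γ`, for the side `Γ` of slope `-r`. -/
def sidePts (m : ℕ) (c : ℕ × ℕ → ℂ → ℂ) (r : ℝ) : Finset (ℕ × ℕ) :=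
  (Lam0 m c).filter fun p => pt p ∈ side m c r

/-- The abscissa of the left end point of a side of slope `-r`, `r > 0` (this end point is a
vertex of the Newton polygon, hence in `Λ_0`). -/
def leftEnd (m : ℕ) (c : ℕ × ℕ → ℂ → ℂ) (r : ℝ) : ℕ :=
  sInf {j : ℕ | ∃ p ∈ sidePts m c r, p.1 = j}

/-- The characteristic polynomial on the side of slope `-r`, `r > 0`: the sum of
`c_{j,α}(0) X^(j - m')` over `Λ_0 ∩ Γ`, where `m'` is the abscissa of the left end point. -/
def charPoly (m : ℕ) (c : ℕ × ℕ → ℂ → ℂ) (r : ℝ) : Polynomial ℂ :=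
  ∑ p ∈ sidePts m c r, Polynomial.C (c0 m c p) * Polynomial.X ^ (p.1 - leftEnd m c r)

/-- The characteristic polynomial on the horizontal half line: the sum of `c_{j,α}(0) X^j` over
`Λ_0 ∩ Γ_p`. (If the abscissa `m_p` of the end point is `0`, this is a nonzero constant, so that
there are no characteristic roots.) -/
def charPolyLast (m : ℕ) (c : ℕ × ℕ → ℂ → ℂ) : Polynomial ℂ :=
  ∑ p ∈ sidePts m c 0, Polynomial.C (c0 m c p) * Polynomial.X ^ p.1

/-- The generalized Poincaré condition (GP): the characteristic roots on the segments of the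
boundary of the Newton polygon are not in `[0, ∞)`, and those on the horizontal half line are
not positive integers. -/
def GenPoincare (m : ℕ) (c : ℕ × ℕ → ℂ → ℂ) : Prop :=
  (∀ r : ℝ, 0 < r → (side m c r).Nontrivial →
    ∀ lam : ℂ, (charPoly m c r).IsRoot lam → ∀ y : ℝ, 0 ≤ y → lam ≠ (y : ℂ)) ∧
  (∀ lam : ℂ, (charPolyLast m c).IsRoot lam → ∀ k : ℕ, 1 ≤ k → lam ≠ (k : ℂ))

/-! ### The irregularity at `x = 0` -/

/-- `Λ_1 = {(j, α) ∈ I_m : c_{j,α}(0) = 0, c_{j,α} ≢ 0}`. -/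
def Lam1 (m : ℕ) (c : ℕ × ℕ → ℂ → ℂ) : Set (ℕ × ℕ) :=
  {p | p ∈ I m ∧ c p 0 = 0 ∧ analyticOrderAt (c p) 0 ≠ ⊤}

/-- `d_{j,α} = min {y : (j, α - y) ∈ N_0}`. -/
def dist (m : ℕ) (c : ℕ × ℕ → ℂ → ℂ) (p : ℕ × ℕ) : ℝ :=
  sInf {y : ℝ | ((p.1 : ℝ), (p.2 : ℝ) - y) ∈ newton m c}

/-- The irregularity `σ_0 = max [1, max_{Λ_1} (p_{j,α} + d_{j,α}) / p_{j,α}]`, where `p_{j,α}` is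
the order of the zero of `c_{j,α}` at `0`. (The supremum is over a finite nonempty set.) -/
def sigma0 (m : ℕ) (c : ℕ × ℕ → ℂ → ℂ) : ℝ :=
  sSup (insert 1 ((fun p => ((analyticOrderNatAt (c p) 0 : ℝ) + dist m c p) /
    (analyticOrderNatAt (c p) 0 : ℝ)) '' Lam1 m c))

/-! ### The nonlinear part

`M` is a finite subset of `ℕ × ℕ` and `G` a function of `t`, `x` and `z = (z_{j,α})_{(j,α) ∈ M}`. -/

/-- The variables: `Sum.inl 0` is `t`, `Sum.inl 1` is `x`, `Sum.inr (j, α)` is `z_{j,α}`. -/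
abbrev Vars (M : Finset (ℕ × ℕ)) : Type := Fin 2 ⊕ M

/-- The exponent of the monomial `t^i x^μ z^ν`. -/
def expo {M : Finset (ℕ × ℕ)} (i μ : ℕ) (ν : M →₀ ℕ) : Vars M →₀ ℕ :=
  Finsupp.single (Sum.inl 0) i + Finsupp.single (Sum.inl 1) μ + Finsupp.mapDomain Sum.inr ν

/-- The coefficient of `t^i x^μ z^ν` in the Taylor series of `G`, that is, the coefficient
`(∂_x^μ g_{i,ν})(0) / μ!` of `x^μ` in `g_{i,ν}(x)`. -/
def gCoeff {M : Finset (ℕ × ℕ)} (G : (Vars M → ℂ) → ℂ) (i : ℕ) (ν : M →₀ ℕ) (μ : ℕ) : ℂ :=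
  MvPowerSeries.coeff (expo i μ ν) (taylorSeries G)

/-- The Taylor expansion of `G` in `(t, z)` has only terms `g_{i,ν}(x) t^i z^ν` with
`i + |ν| ≥ 2`. -/
def OrderAtLeastTwo {M : Finset (ℕ × ℕ)} (G : (Vars M → ℂ) → ℂ) : Prop :=
  ∀ (i : ℕ) (ν : M →₀ ℕ), i + ν.degree < 2 → ∀ μ : ℕ, gCoeff G i ν μ = 0

/-- The formal series `G(t, x, {(t∂_t)^j ∂_x^α u}_{(j,α) ∈ M})`, for `u` with `u(0, x) = 0`: the
substitution into the Taylor series of `G`. -/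
def compose {M : Finset (ℕ × ℕ)} (G : (Vars M → ℂ) → ℂ) (u : FormalTX) : FormalTX :=
  MvPowerSeries.subst
    (Sum.elim (fun k : Fin 2 => (MvPowerSeries.X k : FormalTX))
      (fun p : M => (eulerT ^ p.1.1) ((dX ^ p.1.2) u)))
    (taylorSeries G)

/-- `u ∈ ℂ[[t, x]]` satisfies `u(0, x) ≡ 0`. -/
def VanishesAtTZero (u : FormalTX) : Prop :=
  ∀ l : ℕ, MvPowerSeries.coeff (Finsupp.single 1 l) u = 0

/-- `u` is a formal solution, with `u(0, x) ≡ 0`, of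
`C(x; t∂_t, x∂_x) u = a(x) t + G(t, x, {(t∂_t)^j ∂_x^α u}_{(j,α) ∈ M})`. -/
def IsFormalSolution (m : ℕ) (c : ℕ × ℕ → ℂ → ℂ) (a : ℂ → ℂ) {M : Finset (ℕ × ℕ)}
    (G : (Vars M → ℂ) → ℂ) (u : FormalTX) : Prop :=
  VanishesAtTZero u ∧ opC m c u = taylorX a * MvPowerSeries.X 0 + compose G u

/-- `J_μ = {(i, ν) : i + |ν| ≥ 2, |ν| ≥ 1, (∂_x^μ g_{i,ν})(0) ≠ 0}`. -/
def J {M : Finset (ℕ × ℕ)} (G : (Vars M → ℂ) → ℂ) (μ : ℕ) : Set (ℕ × (M →₀ ℕ)) :=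
  {q | 2 ≤ q.1 + q.2.degree ∧ 1 ≤ q.2.degree ∧ gCoeff G q.1 q.2 μ ≠ 0}

/-- `m_{ν,μ}`, the maximum over the `(j, α)` with `ν_{j,α} > 0` of
`j + max {α, μ + σ_0 (α - μ)}`. (A supremum over a finite set, nonempty if `|ν| ≥ 1`.) -/
def mNu (σ₀ : ℝ) {M : Finset (ℕ × ℕ)} (ν : M →₀ ℕ) (μ : ℕ) : ℝ :=
  sSup ((fun p : M => (p.1.1 : ℝ) + max (p.1.2 : ℝ) (μ + σ₀ * ((p.1.2 : ℝ) - μ))) ''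
    {p : M | 0 < ν p})

/-- The numbers `(m_{ν,μ} - m) / (i + |ν| - 1)`, for `μ ≥ 0` and `(i, ν) ∈ J_μ`. -/
def slopes (m : ℕ) (σ₀ : ℝ) {M : Finset (ℕ × ℕ)} (G : (Vars M → ℂ) → ℂ) : Set ℝ :=
  {y | ∃ μ : ℕ, ∃ q ∈ J G μ, y = (mNu σ₀ q.2 μ - m) / ((q.1 : ℝ) + (q.2.degree : ℝ) - 1)}

/-- `s_0 = 1 + max [0, sup_{μ ≥ 0} sup_{(i,ν) ∈ J_μ} (m_{ν,μ} - m) / (i + |ν| - 1)]`. (The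
supremum is over a nonempty set; it is bounded above since `σ_0 ≥ 1` and `M` is finite.) -/
def s0 (m : ℕ) (c : ℕ × ℕ → ℂ → ℂ) {M : Finset (ℕ × ℕ)} (G : (Vars M → ℂ) → ℂ) : ℝ :=
  1 + sSup (insert 0 (slopes m (sigma0 m c) G))

end TotChar

end

/-!
Comparing the coefficients of `t^k x^l` in (E) gives `L(k, l) u_{k,l} = …`, where the right-hand
side depends only on `u_{k',l'}` with `k' < k` and on `u_{k,n}` with `n < l`; as `L(k, l) ≠ 0`, a
formal solution exists and is unique.

Condition (GP) makes `|L(k, l)|` comparable with `∑ k^j (l+1)^α`, the sum over `Λ_0`: if the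
quotient tended to `0` along a sequence, the limit of the normalized polynomial would have a zero,
which is a positive root of some `P_i` when two weights are of the same order, and a root `k ∈ ℕ^*`
of `P_p` when only `k` stays bounded; in the other cases a single weight dominates or (N) applies.
The coefficients of `x^n`, `n ≥ 1`, in the `c_{j,α}` may come with weights outside of the Newton
polygon; the loss of powers of `l` is made up for by the quotient `(l! / (l - n)!)^(σ₀ - 1)`.

With these two facts `u_{k,l}` is bounded inductively by a multiple of
`k^(-N) k!^(s₀ - 1) l!^(σ₀ - 1) binom(D (4k - 2) + l - 1, l)`. In the nonlinear part the binomial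
coefficients convolve exactly, each derivative `∂_x` is paid for by raising their upper index, and
the powers of `k` lost are regained, up to `k^m`, from `k!^(s₀ - 1)` by the choice of the slopes
defining `s₀`.
-/

open scoped Nat Topology
open Finset.HasAntidiagonal (antidiagonal)

namespace TotChar

/-! ### Binomial weights and factorials -/

theorem succ_mul_multichoose_succ (E l : ℕ) :
    (l + 1) * Nat.multichoose E (l + 1) = E * Nat.multichoose (E + 1) l := by
  rcases E with _ | E
  · simp
  have hsub : E + 1 + 1 + l - 1 = E + 1 + l := by omega
  rw [Nat.multichoose_eq, Nat.multichoose_eq, ← add_assoc, Nat.add_sub_cancel, hsub,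
    add_right_comm, mul_comm, Nat.choose_succ_right_eq, mul_comm, add_right_comm,
    Nat.add_sub_cancel]

theorem add_mul_multichoose (E l : ℕ) :
    (E + l) * Nat.multichoose E l = E * Nat.multichoose (E + 1) l := by
  rcases l with _ | l
  · simp
  rw [Nat.multichoose_succ_succ, mul_add, ← succ_mul_multichoose_succ]
  ring

theorem multichoose_mono_left {E F : ℕ} (h : E ≤ F) (l : ℕ) :
    Nat.multichoose E l ≤ Nat.multichoose F l := by
  refine monotone_nat_of_le_succ (f := (Nat.multichoose · l)) (fun E => ?_) h
  rcases l with _ | l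
  · simp
  · exact Nat.multichoose_succ_succ E l ▸ Nat.le_add_right _ _

theorem multichoose_mono_right {E : ℕ} (hE : 1 ≤ E) : Monotone (Nat.multichoose E) := by
  obtain ⟨E, rfl⟩ := Nat.exists_eq_add_of_le' hE
  exact monotone_nat_of_le_succ fun l => Nat.multichoose_succ_succ E l ▸ Nat.le_add_left _ _

theorem one_le_multichoose {E : ℕ} (hE : 1 ≤ E) (l : ℕ) : 1 ≤ Nat.multichoose E l := by
  simpa using multichoose_mono_right hE (Nat.zero_le l)

theorem multichoose_le_two_pow (E l : ℕ) : Nat.multichoose E l ≤ 2 ^ (E + l) := by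
  rw [Nat.multichoose_eq]
  exact (Nat.choose_le_two_pow _ _).trans (Nat.pow_le_pow_right two_pos (Nat.sub_le _ _))

theorem sum_antidiagonal_multichoose (E F l : ℕ) :
    ∑ x ∈ antidiagonal l, Nat.multichoose E x.1 * Nat.multichoose F x.2 =
      Nat.multichoose (E + F) l := by
  induction F generalizing l with
  | zero =>
    rcases l with _ | l
    · simp
    rw [Finset.Nat.sum_antidiagonal_succ']
    simp
  | succ F ih =>
    induction l with
    | zero => simp
    | succ l ihl =>
      rw [← add_assoc, Nat.multichoose_succ_succ, ← ih, add_assoc, ← ihl,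
        Finset.Nat.sum_antidiagonal_succ', Finset.Nat.sum_antidiagonal_succ']
      simp only [Nat.multichoose_succ_succ, mul_add, Finset.sum_add_distrib,
        Nat.multichoose_zero_right]
      ring

theorem sum_antidiagonal_multichoose_add_le (E F l μ : ℕ) :
    ∑ x ∈ antidiagonal l, Nat.multichoose E (x.1 + μ) * Nat.multichoose F x.2 ≤
      Nat.multichoose (E + F) (l + μ) := by
  have shift_injective : Function.Injective (fun x : ℕ × ℕ => (x.1 + μ, x.2)) := by
    rintro ⟨a, b⟩ ⟨c, d⟩ h
    simpa using h
  rw [← sum_antidiagonal_multichoose]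
  refine (Finset.sum_map (antidiagonal l) ⟨_, shift_injective⟩
    (fun x => Nat.multichoose E x.1 * Nat.multichoose F x.2)).symm.trans_le
    (Finset.sum_le_sum_of_subset fun x hx => ?_)
  obtain ⟨y, hy, rfl⟩ := Finset.mem_map.1 hx
  simp only [Finset.HasAntidiagonal.mem_antidiagonal, Function.Embedding.coeFn_mk] at hy ⊢
  omega

theorem descFactorial_mul_multichoose (E l γ : ℕ) :
    (l + γ).descFactorial γ * Nat.multichoose E (l + γ) =
      E.ascFactorial γ * Nat.multichoose (E + γ) l := by
  induction γ generalizing E with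
  | zero => simp
  | succ γ ih =>
    rw [← add_assoc l, Nat.succ_descFactorial_succ, mul_comm (l + γ + 1), mul_assoc,
      succ_mul_multichoose_succ, mul_left_comm, ih, ← mul_assoc, ← Nat.succ_eq_add_one E,
      Nat.succ_ascFactorial, Nat.ascFactorial_succ]
    congr 2
    omega

theorem pow_mul_multichoose_le (E P l : ℕ) :
    (E + l) ^ P * Nat.multichoose E l ≤ (E + P) ^ P * Nat.multichoose (E + P) l := by
  induction P with
  | zero => simp
  | succ P ih =>
    calc (E + l) ^ (P + 1) * Nat.multichoose E l
        = (E + l) * ((E + l) ^ P * Nat.multichoose E l) := by ring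
      _ ≤ (E + P + l) * ((E + P) ^ P * Nat.multichoose (E + P) l) :=
          Nat.mul_le_mul (by omega) ih
      _ = (E + P) ^ P * ((E + P + l) * Nat.multichoose (E + P) l) := by ring
      _ = (E + P) ^ (P + 1) * Nat.multichoose (E + (P + 1)) l := by
          rw [add_mul_multichoose, ← mul_assoc, ← pow_succ, add_assoc]
      _ ≤ _ := Nat.mul_le_mul_right _ (Nat.pow_le_pow_left (by omega) _)

theorem rpow_le_one_add_pow {x q : ℝ} {Q : ℕ} (hx : 0 ≤ x) (hq : 0 ≤ q) (hQ : q ≤ Q) :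
    x ^ q ≤ 1 + x ^ Q := by
  rcases le_total x 1 with h | h
  · exact (Real.rpow_le_one hx h hq).trans (le_add_of_nonneg_right (pow_nonneg hx Q))
  · have : x ^ q ≤ x ^ (Q : ℝ) := Real.rpow_le_rpow_of_exponent_le h hQ
    rw [Real.rpow_natCast] at this
    linarith

theorem rpow_mul_multichoose_le {E Q : ℕ} (hE : 1 ≤ E) {q : ℝ} (hq : 0 ≤ q) (hQ : q ≤ Q) (l : ℕ) :
    ((E + l : ℕ) : ℝ) ^ q * (Nat.multichoose E l : ℝ) ≤
      2 * ((E + Q : ℕ) : ℝ) ^ q * (Nat.multichoose (E + Q) l : ℝ) := by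
  have hEQ : (0 : ℝ) < (E + Q : ℕ) := by exact_mod_cast Nat.lt_of_lt_of_le hE (Nat.le_add_right _ _)
  have hmono : (Nat.multichoose E l : ℝ) ≤ Nat.multichoose (E + Q) l := by
    exact_mod_cast multichoose_mono_left (Nat.le_add_right E Q) l
  set X : ℝ := ((E + l : ℕ) : ℝ) / (E + Q : ℕ) with hX
  have hX0 : 0 ≤ X := by positivity
  have hXpow : X ^ Q * (Nat.multichoose E l : ℝ) ≤ Nat.multichoose (E + Q) l := by
    rw [hX, div_pow, div_mul_eq_mul_div, div_le_iff₀ (pow_pos hEQ Q), mul_comm _ (_ ^ Q)]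
    exact_mod_cast pow_mul_multichoose_le E Q l
  have hXE : ((E + l : ℕ) : ℝ) = X * (E + Q : ℕ) := (div_mul_cancel₀ _ hEQ.ne').symm
  rw [hXE, Real.mul_rpow hX0 hEQ.le]
  calc X ^ q * ((E + Q : ℕ) : ℝ) ^ q * (Nat.multichoose E l : ℝ)
      ≤ (1 + X ^ Q) * ((E + Q : ℕ) : ℝ) ^ q * (Nat.multichoose E l : ℝ) := by
        gcongr
        exact rpow_le_one_add_pow hX0 hq hQ
    _ = ((E + Q : ℕ) : ℝ) ^ q *
          ((Nat.multichoose E l : ℝ) + X ^ Q * (Nat.multichoose E l : ℝ)) := by ring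
    _ ≤ ((E + Q : ℕ) : ℝ) ^ q *
          ((Nat.multichoose (E + Q) l : ℝ) + (Nat.multichoose (E + Q) l : ℝ)) := by gcongr
    _ = _ := by ring

theorem succ_factorial_mul_succ_factorial_le (a b : ℕ) : (a + 1)! * (b + 1)! ≤ (a + b + 1)! := by
  induction b with
  | zero => simp
  | succ b ih =>
    calc (a + 1)! * (b + 1 + 1)! = (b + 2) * ((a + 1)! * (b + 1)!) := by
          rw [Nat.factorial_succ (b + 1)]; ring
      _ ≤ (a + b + 2) * (a + b + 1)! := Nat.mul_le_mul (by omega) ih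
      _ = (a + (b + 1) + 1)! := (Nat.factorial_succ (a + b + 1)).symm

theorem factorial_mul_factorial_le_add (a b : ℕ) : a ! * b ! ≤ (a + b)! :=
  Nat.le_of_dvd (Nat.factorial_pos _) (Nat.factorial_mul_factorial_dvd_factorial_add a b)

theorem add_one_pow_le_exp_one_mul_pow {k q : ℕ} (h : q ≤ k) :
    ((k : ℝ) + 1) ^ q ≤ Real.exp 1 * (k : ℝ) ^ q := by
  rcases Nat.eq_zero_or_pos k with rfl | hk
  · simp [Nat.le_zero.1 h]
  have hk' : (0 : ℝ) < k := by exact_mod_cast hk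
  calc ((k : ℝ) + 1) ^ q = (1 / (k : ℝ) + 1) ^ q * (k : ℝ) ^ q := by
        rw [← mul_pow, add_mul, one_div_mul_cancel hk'.ne', one_mul, add_comm]
    _ ≤ Real.exp (1 / k) ^ q * (k : ℝ) ^ q := by
        gcongr
        exact Real.add_one_le_exp _
    _ ≤ Real.exp 1 * (k : ℝ) ^ q := by
        rw [← Real.exp_nat_mul]
        gcongr
        rw [mul_one_div, div_le_one hk']
        exact_mod_cast h

theorem pow_mul_factorial_sub_le {k q : ℕ} (h : q ≤ k) :
    (k : ℝ) ^ q * ((k - q)! : ℝ) ≤ Real.exp 1 ^ q * (k ! : ℝ) := by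
  induction q generalizing k with
  | zero => simp
  | succ q ih =>
    obtain ⟨k, rfl⟩ := Nat.exists_eq_add_of_le' (Nat.one_le_of_lt h)
    have hq : q ≤ k := Nat.succ_le_succ_iff.1 h
    rw [Nat.add_sub_add_right, pow_succ, Nat.factorial_succ, pow_succ]
    push_cast
    calc ((k : ℝ) + 1) ^ q * (k + 1) * ((k - q)! : ℝ)
        ≤ (Real.exp 1 * (k : ℝ) ^ q) * (k + 1) * ((k - q)! : ℝ) := by
          gcongr
          exact add_one_pow_le_exp_one_mul_pow hq
      _ = Real.exp 1 * (k + 1) * ((k : ℝ) ^ q * ((k - q)! : ℝ)) := by ring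
      _ ≤ Real.exp 1 * (k + 1) * (Real.exp 1 ^ q * (k ! : ℝ)) :=
          mul_le_mul_of_nonneg_left (ih hq) (by positivity)
      _ = _ := by ring

theorem sum_range_inv_sq_le (n : ℕ) : ∑ i ∈ Finset.range (n + 1), ((i : ℝ) ^ 2)⁻¹ ≤ 2 := by
  have h : ∑ i ∈ Finset.Ioo 0 (n + 1), ((i : ℝ) ^ 2)⁻¹ ≤ 2 / ((0 : ℕ) + 1) :=
    sum_Ioo_inv_sq_le 0 (n + 1)
  have hIoo : Finset.Ioo 0 (n + 1) = Finset.Ico (0 + 1) (n + 1) := by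
    ext i
    simp [Nat.succ_le_iff]
  rw [Finset.range_eq_Ico, Finset.sum_eq_sum_Ico_succ_bot (Nat.succ_pos n), ← hIoo]
  simpa using h

theorem sum_antidiagonal_inv_sq_le (k : ℕ) :
    ∑ x ∈ antidiagonal k, (((x.1 : ℝ) ^ 2)⁻¹ + ((x.2 : ℝ) ^ 2)⁻¹) ≤ 4 := by
  have hswap : ∑ x ∈ antidiagonal k, ((x.2 : ℝ) ^ 2)⁻¹ = ∑ x ∈ antidiagonal k, ((x.1 : ℝ) ^ 2)⁻¹ :=
    Finset.Nat.sum_antidiagonal_swap (f := fun x : ℕ × ℕ => ((x.1 : ℝ) ^ 2)⁻¹)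
  rw [Finset.sum_add_distrib, hswap, Finset.Nat.sum_antidiagonal_eq_sum_range_succ_mk]
  linarith [sum_range_inv_sq_le k]

/-! ### Growth of Taylor coefficients -/

theorem sum_pow_degree_le {ι : Type*} [Fintype ι] {x : ℝ} (hx0 : 0 ≤ x) (hx1 : x < 1)
    (S : Finset (ι →₀ ℕ)) :
    ∑ e ∈ S, x ^ e.degree ≤ ((1 - x)⁻¹) ^ Fintype.card ι := by
  classical
  set toFun : (ι →₀ ℕ) ↪ (ι → ℕ) := ⟨(⇑), DFunLike.coe_injective⟩
  set box : Finset (ι → ℕ) :=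
    Fintype.piFinset fun _ => Finset.range (S.sup Finsupp.degree + 1)
  have hbox : S.map toFun ⊆ box := fun f hf => by
    obtain ⟨e, he, rfl⟩ := Finset.mem_map.1 hf
    exact Fintype.mem_piFinset.2 fun i => Finset.mem_range.2 <|
      Nat.lt_succ_of_le ((Finsupp.le_degree i e).trans (Finset.le_sup he))
  calc ∑ e ∈ S, x ^ e.degree = ∑ e ∈ S, ∏ i, x ^ e i :=
        Finset.sum_congr rfl fun e _ => by
          rw [Finsupp.degree_eq_sum, Finset.prod_pow_eq_pow_sum]
    _ = ∑ f ∈ S.map toFun, ∏ i, x ^ f i := (Finset.sum_map S toFun fun f => ∏ i, x ^ f i).symm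
    _ ≤ ∑ f ∈ box, ∏ i, x ^ f i :=
        Finset.sum_le_sum_of_subset_of_nonneg hbox fun f _ _ =>
          Finset.prod_nonneg fun i _ => pow_nonneg hx0 _
    _ = ∏ _i : ι, ∑ j ∈ Finset.range (S.sup Finsupp.degree + 1), x ^ j :=
        (Finset.prod_univ_sum _ _).symm
    _ ≤ ∏ _i : ι, (1 - x)⁻¹ := by
        refine Finset.prod_le_prod (fun i _ => Finset.sum_nonneg fun j _ => pow_nonneg hx0 _)
          fun i _ => ?_
        rw [← tsum_geometric_of_lt_one hx0 hx1]
        exact (summable_geometric_of_lt_one hx0 hx1).sum_le_tsum _ fun j _ => pow_nonneg hx0 _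
    _ = ((1 - x)⁻¹) ^ Fintype.card ι := by simp

theorem summable_pow_degree {ι : Type*} [Finite ι] {x : ℝ} (hx0 : 0 ≤ x) (hx1 : x < 1) :
    Summable fun e : ι →₀ ℕ => x ^ e.degree :=
  have := Fintype.ofFinite ι
  summable_of_sum_le (fun _ => pow_nonneg hx0 _) (sum_pow_degree_le hx0 hx1)

theorem convergesNearZero_of_le {ι : Type} [Fintype ι] {f : MvPowerSeries ι ℂ} {H Y : ℝ}
    (hY : 0 < Y) (h : ∀ e : ι →₀ ℕ, ‖MvPowerSeries.coeff e f‖ ≤ H * Y ^ e.degree) :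
    ConvergesNearZero f := by
  have hH : 0 ≤ H := by simpa using (norm_nonneg _).trans (h 0)
  have hball : Metric.ball (0 : ι → ℂ) (2 * Y)⁻¹ ∈ 𝓝 (0 : ι → ℂ) :=
    Metric.ball_mem_nhds _ (by positivity)
  filter_upwards [hball] with z hz
  rw [mem_ball_zero_iff] at hz
  have hz' (e : ι →₀ ℕ) : ∏ i, ‖z i ^ e i‖ ≤ (2 * Y)⁻¹ ^ e.degree := by
    rw [Finsupp.degree_eq_sum, ← Finset.prod_pow_eq_pow_sum]
    refine Finset.prod_le_prod (fun i _ => norm_nonneg _) fun i _ => ?_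
    rw [norm_pow]
    exact pow_le_pow_left₀ (norm_nonneg _) ((norm_le_pi_norm z i).trans hz.le) _
  refine Summable.of_norm_bounded
    ((summable_pow_degree (ι := ι) (x := 1 / 2) (by norm_num) (by norm_num)).mul_left H) fun e => ?_
  calc ‖MvPowerSeries.coeff e f * ∏ i, z i ^ e i‖
      = ‖MvPowerSeries.coeff e f‖ * ∏ i, ‖z i ^ e i‖ := by rw [norm_mul, norm_prod]
    _ ≤ H * Y ^ e.degree * (2 * Y)⁻¹ ^ e.degree :=
        mul_le_mul (h e) (hz' e) (Finset.prod_nonneg fun i _ => norm_nonneg _) (by positivity)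
    _ = H * (1 / 2) ^ e.degree := by
        rw [mul_assoc, ← mul_pow]
        congr 2
        field_simp

theorem exists_norm_iteratedFDeriv_apply_le {E F : Type*} [NormedAddCommGroup E] [NormedSpace ℂ E]
    [NormedAddCommGroup F] [NormedSpace ℂ F] [CompleteSpace F] {f : E → F} {x : E}
    (hf : AnalyticAt ℂ f x) :
    ∃ H R : ℝ, 0 < H ∧ 0 < R ∧ ∀ (n : ℕ) (v : Fin n → E), (∀ i, ‖v i‖ ≤ 1) →
      ‖iteratedFDeriv ℂ n f x v‖ ≤ H * R ^ n * (n ! : ℝ) := by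
  obtain ⟨p, r, hp⟩ := hf
  obtain ⟨H, R, hH, hR, hpn⟩ := p.le_mul_pow_of_radius_pos (hp.r_pos.trans_le hp.r_le)
  refine ⟨H, R, hH, hR, fun n v hv => ?_⟩
  rw [hp.iteratedFDeriv_eq_sum_of_completeSpace]
  calc ‖∑ σ : Equiv.Perm (Fin n), p n fun i => v (σ i)‖
      ≤ ∑ _σ : Equiv.Perm (Fin n), H * R ^ n := by
        refine norm_sum_le_of_le _ fun σ _ => ((p n).le_opNorm _).trans ?_
        refine (mul_le_of_le_one_right (norm_nonneg _) ?_).trans (hpn n)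
        exact Finset.prod_le_one (fun i _ => norm_nonneg _) fun i _ => hv _
    _ = H * R ^ n * (n ! : ℝ) := by
        rw [Finset.sum_const, Finset.card_univ, Fintype.card_perm, Fintype.card_fin, nsmul_eq_mul,
          mul_comm]

theorem factorial_sum_le {ι : Type*} [Fintype ι] (e : ι → ℕ) :
    (∑ i, e i)! ≤ Fintype.card ι ^ (∑ i, e i) * ∏ i, (e i)! := by
  classical
  rw [← Nat.multinomial_spec, mul_comm]
  refine Nat.mul_le_mul_right _ ?_
  have h := Finset.sum_pow_eq_sum_piAntidiag (R := ℕ) Finset.univ (fun _ : ι => 1) (∑ i, e i)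
  simp only [Finset.sum_const, smul_eq_mul, mul_one, one_pow, Finset.prod_const_one,
    Finset.card_univ] at h
  rw [h]
  exact Finset.single_le_sum (f := fun k => Nat.multinomial Finset.univ k)
    (fun _ _ => Nat.zero_le _) (by simp)

section TaylorSeries

variable {ι : Type} [Fintype ι] [DecidableEq ι] {f : (ι → ℂ) → ℂ}

theorem exists_norm_coeff_taylorSeries_le (hf : AnalyticAt ℂ f 0) :
    ∃ H R : ℝ, 0 < H ∧ 0 < R ∧ ∀ e : ι →₀ ℕ,
      ‖MvPowerSeries.coeff e (taylorSeries f)‖ ≤ H * R ^ e.degree := by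
  obtain ⟨H, R, hH, hR, h⟩ := exists_norm_iteratedFDeriv_apply_le hf
  refine ⟨H, R * (Fintype.card ι + 1), hH, by positivity, fun e => ?_⟩
  have hlen : (Finsupp.toMultiset e).toList.length = e.degree := by
    rw [Multiset.length_toList, Finsupp.card_toMultiset, Finsupp.degree_apply]
    rfl
  have hpos : (0 : ℝ) < ((∏ i, (e i)! : ℕ) : ℝ) := by
    exact_mod_cast Finset.prod_pos fun i _ => Nat.factorial_pos _
  have hfac : (e.degree ! : ℝ) ≤
      ((Fintype.card ι : ℝ) + 1) ^ e.degree * ((∏ i, (e i)! : ℕ) : ℝ) := by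
    rw [Finsupp.degree_eq_sum]
    exact_mod_cast (factorial_sum_le e).trans
      (Nat.mul_le_mul_right _ (Nat.pow_le_pow_left (Nat.le_succ _) _))
  change ‖taylorSeries f e‖ ≤ _
  rw [taylorSeries, norm_div, Complex.norm_natCast, div_le_iff₀ hpos]
  calc _ ≤ H * R ^ (Finsupp.toMultiset e).toList.length *
        ((Finsupp.toMultiset e).toList.length ! : ℝ) := h _ _ fun i => by
          rw [Pi.norm_single, norm_one]
    _ = H * R ^ e.degree * (e.degree ! : ℝ) := by rw [hlen]
    _ ≤ H * R ^ e.degree *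
        (((Fintype.card ι : ℝ) + 1) ^ e.degree * ((∏ i, (e i)! : ℕ) : ℝ)) := by gcongr
    _ = H * (R * (Fintype.card ι + 1)) ^ e.degree * ((∏ i, (e i)! : ℕ) : ℝ) := by
        rw [mul_pow]
        ring

theorem exists_sum_norm_coeff_taylorSeries_le (hf : AnalyticAt ℂ f 0) :
    ∃ H ρ : ℝ, 0 < ρ ∧ ∀ S : Finset (ι →₀ ℕ),
      ∑ e ∈ S, ‖MvPowerSeries.coeff e (taylorSeries f)‖ * ρ ^ e.degree ≤ H := by
  obtain ⟨H, R, hH, hR, h⟩ := exists_norm_coeff_taylorSeries_le hf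
  refine ⟨H * ((1 - 1 / 2)⁻¹) ^ Fintype.card ι, (2 * R)⁻¹, by positivity, fun S => ?_⟩
  calc ∑ e ∈ S, ‖MvPowerSeries.coeff e (taylorSeries f)‖ * (2 * R)⁻¹ ^ e.degree
      ≤ ∑ e ∈ S, H * R ^ e.degree * (2 * R)⁻¹ ^ e.degree := by
        gcongr with e
        exact h e
    _ = H * ∑ e ∈ S, (1 / 2) ^ e.degree := by
        rw [Finset.mul_sum]
        refine Finset.sum_congr rfl fun e _ => ?_
        rw [mul_assoc, ← mul_pow]
        congr 2
        field_simp
    _ ≤ H * ((1 - 1 / 2)⁻¹) ^ Fintype.card ι := by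
        gcongr
        exact sum_pow_degree_le (by norm_num) (by norm_num) S

end TaylorSeries

/-- The Taylor coefficient `f⁽ⁿ⁾(0) / n!` of a function of one variable, so that `taylorX f` is
the series `∑ taylorCoeff f n x^n`. -/
noncomputable def taylorCoeff (f : ℂ → ℂ) (n : ℕ) : ℂ := iteratedDeriv n f 0 / (n ! : ℂ)

theorem taylorCoeff_zero (f : ℂ → ℂ) : taylorCoeff f 0 = f 0 := by simp [taylorCoeff]

theorem exists_norm_taylorCoeff_le {f : ℂ → ℂ} (hf : AnalyticAt ℂ f 0) :
    ∃ H R : ℝ, 0 < H ∧ 0 < R ∧ ∀ n : ℕ, ‖taylorCoeff f n‖ ≤ H * R ^ n := by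
  obtain ⟨H, R, hH, hR, h⟩ := exists_norm_iteratedFDeriv_apply_le hf
  refine ⟨H, R, hH, hR, fun n => ?_⟩
  have hpos : (0 : ℝ) < (n ! : ℝ) := by exact_mod_cast Nat.factorial_pos _
  rw [taylorCoeff, norm_div, Complex.norm_natCast, div_le_iff₀ hpos,
    iteratedDeriv_eq_iteratedFDeriv]
  exact h _ _ fun _ => by simp

theorem exists_sum_norm_taylorCoeff_le {ι : Type*} {f : ι → ℂ → ℂ} {s : Finset ι}
    (hf : ∀ i ∈ s, AnalyticAt ℂ (f i) 0) :
    ∃ H R : ℝ, 0 ≤ H ∧ 0 ≤ R ∧ ∀ n, ∑ i ∈ s, ‖taylorCoeff (f i) n‖ ≤ H * R ^ n := by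
  choose! H R hH hR h using fun i (hi : i ∈ s) => exists_norm_taylorCoeff_le (hf i hi)
  refine ⟨∑ i ∈ s, H i, ∑ i ∈ s, R i, Finset.sum_nonneg fun i hi => (hH i hi).le,
    Finset.sum_nonneg fun i hi => (hR i hi).le, fun n => ?_⟩
  rw [Finset.sum_mul]
  refine Finset.sum_le_sum fun i hi => (h i hi n).trans ?_
  have hRi : R i ≤ ∑ j ∈ s, R j := Finset.single_le_sum (fun j hj => (hR j hj).le) hi
  exact mul_le_mul_of_nonneg_left (pow_le_pow_left₀ (hR i hi).le hRi n) (hH i hi).le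

theorem analyticOrderAt_ne_top_and_analyticOrderNatAt_le {f : ℂ → ℂ} (hf : AnalyticAt ℂ f 0)
    {n : ℕ} (h : taylorCoeff f n ≠ 0) :
    analyticOrderAt f 0 ≠ ⊤ ∧ analyticOrderNatAt f 0 ≤ n := by
  have hlt : ¬ ((n + 1 : ℕ) : ℕ∞) ≤ analyticOrderAt f 0 := fun hle => by
    have hzero := (natCast_le_analyticOrderAt_iff_iteratedDeriv_eq_zero hf).1 hle n n.lt_succ_self
    exact h (by simp [taylorCoeff, hzero])
  have htop : analyticOrderAt f 0 ≠ ⊤ := fun htop => hlt (htop ▸ le_top)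
  refine ⟨htop, ?_⟩
  rw [← Nat.cast_analyticOrderNatAt htop, Nat.cast_le] at hlt
  omega

/-! ### Coefficients of series in two variables -/

/-- The exponent of `t^k x^l`. -/
noncomputable def idx (k l : ℕ) : Fin 2 →₀ ℕ := Finsupp.single 0 k + Finsupp.single 1 l

@[simp] theorem idx_apply_zero (k l : ℕ) : idx k l 0 = k := by simp [idx]

@[simp] theorem idx_apply_one (k l : ℕ) : idx k l 1 = l := by simp [idx]

theorem idx_eta (e : Fin 2 →₀ ℕ) : idx (e 0) (e 1) = e := by
  ext i
  fin_cases i <;> simp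

theorem idx_add (k l k' l' : ℕ) : idx k l + idx k' l' = idx (k + k') (l + l') := by
  ext i
  fin_cases i <;> simp

theorem idx_inj {k l k' l' : ℕ} : idx k l = idx k' l' ↔ k = k' ∧ l = l' := by
  refine ⟨fun h => ?_, fun ⟨hk, hl⟩ => hk ▸ hl ▸ rfl⟩
  exact ⟨by simpa using DFunLike.congr_fun h 0, by simpa using DFunLike.congr_fun h 1⟩

/-- The coefficient of `t^k x^l`. -/
noncomputable def cf (f : FormalTX) (k l : ℕ) : ℂ := MvPowerSeries.coeff (idx k l) f

theorem coeff_eq_cf (f : FormalTX) (e : Fin 2 →₀ ℕ) :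
    MvPowerSeries.coeff e f = cf f (e 0) (e 1) := by rw [cf, idx_eta]

theorem cf_ext {f g : FormalTX} (h : ∀ k l, cf f k l = cf g k l) : f = g := by
  ext e
  rw [coeff_eq_cf, coeff_eq_cf, h]

@[simp] theorem cf_add (f g : FormalTX) (k l : ℕ) : cf (f + g) k l = cf f k l + cf g k l := by
  simp [cf]

@[simp] theorem cf_sub (f g : FormalTX) (k l : ℕ) : cf (f - g) k l = cf f k l - cf g k l := by
  simp [cf]

@[simp] theorem cf_smul (a : ℂ) (f : FormalTX) (k l : ℕ) : cf (a • f) k l = a * cf f k l := by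
  simp [cf]

theorem cf_sum {κ : Type*} (s : Finset κ) (f : κ → FormalTX) (k l : ℕ) :
    cf (∑ i ∈ s, f i) k l = ∑ i ∈ s, cf (f i) k l := by
  simp [cf]

theorem cf_one (k l : ℕ) : cf 1 k l = if k = 0 ∧ l = 0 then 1 else 0 := by
  classical
  have hidx : idx k l = 0 ↔ k = 0 ∧ l = 0 := by
    rw [← idx_inj (k' := 0) (l' := 0)]
    simp [idx]
  simp only [cf, MvPowerSeries.coeff_one, hidx]

theorem cf_mul (f g : FormalTX) (k l : ℕ) :
    cf (f * g) k l = ∑ x ∈ antidiagonal k, ∑ y ∈ antidiagonal l, cf f x.1 y.1 * cf g x.2 y.2 := by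
  classical
  rw [cf, MvPowerSeries.coeff_mul, ← Finset.sum_product']
  refine Finset.sum_nbij' (fun p => ((p.1 0, p.2 0), (p.1 1, p.2 1)))
    (fun q => (idx q.1.1 q.2.1, idx q.1.2 q.2.2)) (fun p hp => ?_) (fun q hq => ?_)
    (fun p _ => by simp only [idx_eta]) (fun q _ => by simp) (fun p _ => by simp only [coeff_eq_cf])
  · rw [Finset.HasAntidiagonal.mem_antidiagonal] at hp
    simp only [Finset.mem_product, Finset.HasAntidiagonal.mem_antidiagonal]
    exact ⟨by simpa using DFunLike.congr_fun hp 0, by simpa using DFunLike.congr_fun hp 1⟩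
  · simp only [Finset.mem_product, Finset.HasAntidiagonal.mem_antidiagonal] at hq ⊢
    rw [idx_add, hq.1, hq.2]

theorem cf_X_zero_pow_mul (f : FormalTX) (i k l : ℕ) :
    cf (MvPowerSeries.X 0 ^ i * f) k l = if i ≤ k then cf f (k - i) l else 0 := by
  rw [cf, MvPowerSeries.X_pow_eq, MvPowerSeries.coeff_monomial_mul, one_mul, coeff_eq_cf]
  simp

theorem cf_X_one_pow_mul (f : FormalTX) (μ k l : ℕ) :
    cf (MvPowerSeries.X 1 ^ μ * f) k l = if μ ≤ l then cf f k (l - μ) else 0 := by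
  rw [cf, MvPowerSeries.X_pow_eq, MvPowerSeries.coeff_monomial_mul, one_mul, coeff_eq_cf]
  simp

theorem cf_X_zero_mul (f : FormalTX) (k l : ℕ) :
    cf (MvPowerSeries.X 0 * f) k l = if 1 ≤ k then cf f (k - 1) l else 0 := by
  simpa using cf_X_zero_pow_mul f 1 k l

theorem cf_X_one_mul (f : FormalTX) (k l : ℕ) :
    cf (MvPowerSeries.X 1 * f) k l = if 1 ≤ l then cf f k (l - 1) else 0 := by
  simpa using cf_X_one_pow_mul f 1 k l

theorem cf_dX (f : FormalTX) (k l : ℕ) : cf (dX f) k l = (l + 1) * cf f k (l + 1) := by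
  change MvPowerSeries.coeff (idx k l) (MvPowerSeries.pderiv ℂ (1 : Fin 2) f) = _
  rw [MvPowerSeries.coeff_pderiv, coeff_eq_cf]
  simp [mul_comm]

theorem cf_dX_pow (f : FormalTX) (α k l : ℕ) :
    cf ((dX ^ α) f) k l = ((l + α).descFactorial α : ℂ) * cf f k (l + α) := by
  induction α generalizing l with
  | zero => simp
  | succ α ih =>
    have hsub : l + (α + 1) - α = l + 1 := by omega
    rw [pow_succ', Module.End.mul_apply, cf_dX, ih, ← mul_assoc, add_assoc, add_comm 1 α,
      Nat.descFactorial_succ, hsub]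
    push_cast
    rfl

theorem cf_eulerT (f : FormalTX) (k l : ℕ) : cf (eulerT f) k l = k * cf f k l := by
  change cf (MvPowerSeries.X 0 * MvPowerSeries.pderiv ℂ (0 : Fin 2) f) k l = _
  rw [cf_X_zero_mul]
  rcases k with _ | k
  · simp
  · rw [if_pos (Nat.le_add_left 1 k), cf, MvPowerSeries.coeff_pderiv, coeff_eq_cf]
    simp [mul_comm]

theorem cf_eulerT_pow (f : FormalTX) (j k l : ℕ) :
    cf ((eulerT ^ j) f) k l = (k : ℂ) ^ j * cf f k l := by
  induction j with
  | zero => simp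
  | succ j ih => rw [pow_succ', Module.End.mul_apply, cf_eulerT, ih, pow_succ', mul_assoc]

theorem cf_eulerX (f : FormalTX) (k l : ℕ) : cf (eulerX f) k l = l * cf f k l := by
  change cf (MvPowerSeries.X 1 * dX f) k l = _
  rw [cf_X_one_mul]
  rcases l with _ | l
  · simp
  · rw [if_pos (Nat.le_add_left 1 l), cf_dX]
    simp

theorem cf_aeval_eulerX (p : Polynomial ℂ) (f : FormalTX) (k l : ℕ) :
    cf (Polynomial.aeval eulerX p f) k l = p.eval (l : ℂ) * cf f k l := by
  induction p using Polynomial.induction_on' with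
  | add p q hp hq => simp [hp, hq, add_mul]
  | monomial n a =>
    rw [Polynomial.aeval_monomial, Polynomial.eval_monomial, Module.End.mul_apply,
      Module.algebraMap_end_apply, cf_smul, mul_assoc]
    congr 1
    induction n with
    | zero => simp
    | succ n ih => rw [pow_succ', Module.End.mul_apply, cf_eulerX, ih, pow_succ', mul_assoc]

theorem cf_taylorX (c : ℂ → ℂ) (k l : ℕ) :
    cf (taylorX c) k l = if k = 0 then taylorCoeff c l else 0 := by
  change taylorX c (idx k l) = _
  simp [taylorX, taylorCoeff]

theorem cf_taylorX_mul (c : ℂ → ℂ) (f : FormalTX) (k l : ℕ) :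
    cf (taylorX c * f) k l = ∑ y ∈ antidiagonal l, taylorCoeff c y.1 * cf f k y.2 := by
  rw [cf_mul, Finset.sum_eq_single (0, k)]
  · simp [cf_taylorX]
  · rintro ⟨a, b⟩ hab hne
    rw [Finset.HasAntidiagonal.mem_antidiagonal] at hab
    have ha : a ≠ 0 := by
      rintro rfl
      exact hne (by simpa using hab)
    simp [cf_taylorX, ha]
  · exact fun h => absurd (by simp) h

theorem cf_taylorX_mul_X_zero (a : ℂ → ℂ) (k l : ℕ) :
    cf (taylorX a * MvPowerSeries.X 0) k l = if k = 1 then taylorCoeff a l else 0 := by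
  rw [mul_comm, cf_X_zero_mul, cf_taylorX]
  rcases k with _ | k <;> simp

theorem vanishesAtTZero_iff {u : FormalTX} : VanishesAtTZero u ↔ ∀ l, cf u 0 l = 0 := by
  simp [VanishesAtTZero, cf, idx]

/-- The contribution of the coefficients of `x^n`, `n ≥ 1`, of the `c_{j,α}` to the coefficient of
`t^k x^l` in `-C(x; t∂_t, x∂_x) u`, where `w n` is the coefficient of `t^k x^n` in `u`. -/
noncomputable def lowerPart (m : ℕ) (c : ℕ × ℕ → ℂ → ℂ) (k l : ℕ) (w : ℕ → ℂ) : ℂ :=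
  ∑ n ∈ Finset.range l, ∑ p ∈ I m, taylorCoeff (c p) (l - n) *
    ((k : ℂ) ^ p.1 * ((n.descFactorial p.2 : ℕ) : ℂ) * w n)

theorem cf_opC (m : ℕ) (c : ℕ × ℕ → ℂ → ℂ) (u : FormalTX) (k l : ℕ) :
    cf (opC m c u) k l = L m c k l * cf u k l - lowerPart m c k l (cf u k) := by
  have hterm : ∀ p ∈ I m, cf (taylorX (c p) *
      (eulerT ^ p.1) ((Polynomial.aeval eulerX (descPochhammer ℂ p.2)) u)) k l =
      c p 0 * (k : ℂ) ^ p.1 * (descPochhammer ℂ p.2).eval (l : ℂ) * cf u k l +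
      ∑ n ∈ Finset.range l, taylorCoeff (c p) (l - n) *
        ((k : ℂ) ^ p.1 * ((n.descFactorial p.2 : ℕ) : ℂ) * cf u k n) := by
    intro p _
    rw [cf_taylorX_mul, ← Finset.Nat.sum_antidiagonal_swap,
      Finset.Nat.sum_antidiagonal_eq_sum_range_succ_mk, Finset.sum_range_succ, add_comm]
    simp only [Prod.fst_swap, Prod.snd_swap, cf_eulerT_pow, cf_aeval_eulerX, Nat.sub_self,
      taylorCoeff_zero, descPochhammer_eval_eq_descFactorial]
    congr 1
    · ring
    · exact Finset.sum_congr rfl fun n _ => by ring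
  rw [opC, cf_sub, cf_sum, Finset.sum_congr rfl hterm, Finset.sum_add_distrib, cf_eulerT_pow,
    lowerPart, Finset.sum_comm, L, C, sub_mul, Finset.sum_mul]
  ring

/-! ### Substitution of the derivatives into the nonlinear part -/

/-- The series `(t ∂_t)^j ∂_x^α u`, for `p = (j, α)`. -/
noncomputable def jet (u : FormalTX) (p : ℕ × ℕ) : FormalTX := (eulerT ^ p.1) ((dX ^ p.2) u)

theorem cf_jet (u : FormalTX) (p : ℕ × ℕ) (k l : ℕ) :
    cf (jet u p) k l =
      (k : ℂ) ^ p.1 * (((l + p.2).descFactorial p.2 : ℕ) : ℂ) * cf u k (l + p.2) := by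
  rw [jet, cf_eulerT_pow, cf_dX_pow, mul_assoc]

theorem X_zero_pow_dvd_iff {q : ℕ} {f : FormalTX} :
    MvPowerSeries.X 0 ^ q ∣ f ↔ ∀ k l, k < q → cf f k l = 0 := by
  rw [MvPowerSeries.X_pow_dvd_iff]
  refine ⟨fun h k l hk => h _ (by simpa using hk), fun h e he => ?_⟩
  rw [coeff_eq_cf]
  exact h _ _ he

theorem X_zero_pow_dvd_jet_sub {u v : FormalTX} {K : ℕ}
    (h : ∀ k l, k < K → cf u k l = cf v k l) (p : ℕ × ℕ) :
    MvPowerSeries.X 0 ^ K ∣ jet u p - jet v p := by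
  rw [X_zero_pow_dvd_iff]
  intro k l hk
  rw [cf_sub, cf_jet, cf_jet, h _ _ hk, sub_self]

theorem X_zero_dvd_jet {u : FormalTX} (hu : VanishesAtTZero u) (p : ℕ × ℕ) :
    MvPowerSeries.X 0 ∣ jet u p := by
  rw [← pow_one (MvPowerSeries.X 0), X_zero_pow_dvd_iff]
  intro k l hk
  rw [cf_jet, Nat.lt_one_iff.1 hk, vanishesAtTZero_iff.1 hu, mul_zero]

/-- The product of the `(t ∂_t)^j ∂_x^α u` over a multiset of indices `(j, α)`. -/
noncomputable def jetProd (u : FormalTX) (s : Multiset (ℕ × ℕ)) : FormalTX := (s.map (jet u)).prod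

theorem jetProd_zero (u : FormalTX) : jetProd u 0 = 1 := by simp [jetProd]

theorem jetProd_cons (u : FormalTX) (p : ℕ × ℕ) (s : Multiset (ℕ × ℕ)) :
    jetProd u (p ::ₘ s) = jet u p * jetProd u s := by simp [jetProd]

theorem X_zero_pow_dvd_jetProd {u : FormalTX} (hu : VanishesAtTZero u) (s : Multiset (ℕ × ℕ)) :
    MvPowerSeries.X 0 ^ (Multiset.card s) ∣ jetProd u s := by
  induction s using Multiset.induction_on with
  | empty => simp
  | cons p s ih =>
    rw [jetProd_cons, Multiset.card_cons, pow_succ']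
    exact mul_dvd_mul (X_zero_dvd_jet hu p) ih

-- The difference is divisible by `t^(K + card s - 1)`; the extra factor `t` avoids the subtraction.
theorem X_zero_pow_dvd_jetProd_sub {u v : FormalTX} (hu : VanishesAtTZero u)
    (hv : VanishesAtTZero v) {K : ℕ} (h : ∀ k l, k < K → cf u k l = cf v k l)
    (s : Multiset (ℕ × ℕ)) :
    (MvPowerSeries.X 0 : FormalTX) ^ (K + Multiset.card s) ∣
      MvPowerSeries.X 0 * (jetProd u s - jetProd v s) := by
  induction s using Multiset.induction_on with
  | empty => simp [jetProd_zero]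
  | cons p s ih =>
    have htelescope : MvPowerSeries.X 0 * (jetProd u (p ::ₘ s) - jetProd v (p ::ₘ s)) =
        jet u p * (MvPowerSeries.X 0 * (jetProd u s - jetProd v s)) +
          MvPowerSeries.X 0 * ((jet u p - jet v p) * jetProd v s) := by
      rw [jetProd_cons, jetProd_cons]
      ring
    rw [htelescope, Multiset.card_cons, ← add_assoc, pow_succ']
    refine dvd_add (mul_dvd_mul (X_zero_dvd_jet hu p) ih) (mul_dvd_mul_left _ ?_)
    rw [pow_add]
    exact mul_dvd_mul (X_zero_pow_dvd_jet_sub h p) (X_zero_pow_dvd_jetProd hv s)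

section Compose

variable {M : Finset (ℕ × ℕ)}

/-- The multiset of the indices `(j, α)` occurring in `z^ν`, each with multiplicity
`ν_{j,α}`. -/
noncomputable def indices (ν : M →₀ ℕ) : Multiset (ℕ × ℕ) :=
  (Finsupp.toMultiset ν).map Subtype.val

theorem card_indices (ν : M →₀ ℕ) : Multiset.card (indices ν) = ν.degree := by
  rw [indices, Multiset.card_map, Finsupp.card_toMultiset, Finsupp.degree_apply]
  rfl

theorem exists_of_mem_indices {ν : M →₀ ℕ} {p : ℕ × ℕ} (hp : p ∈ indices ν) :
    ∃ q : M, q.1 = p ∧ 0 < ν q := by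
  obtain ⟨q, hq, rfl⟩ := Multiset.mem_map.1 hp
  rw [Finsupp.mem_toMultiset, Finsupp.mem_support_iff] at hq
  exact ⟨q, rfl, Nat.pos_of_ne_zero hq⟩

theorem exists_eq_expo (d : Vars M →₀ ℕ) :
    ∃ (i μ : ℕ) (ν : M →₀ ℕ), d = expo i μ ν := by
  refine ⟨d (Sum.inl 0), d (Sum.inl 1), d.comapDomain Sum.inr Sum.inr_injective.injOn, ?_⟩
  ext s
  rcases s with k | p
  · have hinl : Finsupp.mapDomain (Sum.inr : M → Vars M)
        (d.comapDomain Sum.inr Sum.inr_injective.injOn) (Sum.inl k) = 0 :=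
      Finsupp.mapDomain_of_notMem_range _ _ (by simp)
    fin_cases k <;> simp_all [expo]
  · simp [expo, Finsupp.mapDomain_apply Sum.inr_injective]

theorem degree_expo (i μ : ℕ) (ν : M →₀ ℕ) : (expo i μ ν).degree = i + μ + ν.degree := by
  rw [expo, map_add, map_add, Finsupp.degree_single, Finsupp.degree_single,
    Finsupp.degree_mapDomain]

/-- The family substituted in `compose`: `t` and `x` for themselves, `(t ∂_t)^j ∂_x^α u` for
`z_{j,α}`. -/
noncomputable def jetSubst (M : Finset (ℕ × ℕ)) (u : FormalTX) : Vars M → FormalTX :=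
  Sum.elim (fun k : Fin 2 => (MvPowerSeries.X k : FormalTX)) fun p : M => jet u p

theorem hasSubst_jetSubst {u : FormalTX} (hu : VanishesAtTZero u) :
    MvPowerSeries.HasSubst (jetSubst M u) := by
  refine MvPowerSeries.hasSubst_of_constantCoeff_zero fun s => ?_
  rcases s with k | p
  · simp [jetSubst]
  · rw [← MvPowerSeries.coeff_zero_eq_constantCoeff_apply, coeff_eq_cf]
    change cf (jet u p) 0 0 = 0
    rw [cf_jet, vanishesAtTZero_iff.1 hu, mul_zero]

/-- The monomial `t^i x^μ z^ν` of exponent `d`, with `(t ∂_t)^j ∂_x^α u` substituted for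
`z_{j,α}`. -/
noncomputable def jetMonomial (u : FormalTX) (d : Vars M →₀ ℕ) : FormalTX :=
  d.prod fun s e => jetSubst M u s ^ e

theorem jetMonomial_expo (u : FormalTX) (i μ : ℕ) (ν : M →₀ ℕ) :
    jetMonomial u (expo i μ ν) =
      MvPowerSeries.X 0 ^ i * (MvPowerSeries.X 1 ^ μ * jetProd u (indices ν)) := by
  have hzero (s : Vars M) : jetSubst M u s ^ 0 = 1 := pow_zero _
  have hadd (s : Vars M) (a b : ℕ) :
      jetSubst M u s ^ (a + b) = jetSubst M u s ^ a * jetSubst M u s ^ b := pow_add _ _ _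
  have hsingle (s : Vars M) (n : ℕ) :
      ((Finsupp.single s n).prod fun s e => jetSubst M u s ^ e) = jetSubst M u s ^ n :=
    Finsupp.prod_single_index (hzero s)
  rw [jetMonomial, expo, Finsupp.prod_add_index' hzero hadd, Finsupp.prod_add_index' hzero hadd,
    hsingle, hsingle, Finsupp.prod_mapDomain_index hzero hadd, mul_assoc]
  congr 2
  rw [jetProd, indices, Multiset.map_map, Finsupp.toMultiset_map, Finsupp.prod_toMultiset,
    Finsupp.prod_mapDomain_index (fun _ => pow_zero _) (fun _ _ _ => pow_add _ _ _)]
  rfl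

theorem cf_jetMonomial_eq_zero {u : FormalTX} (hu : VanishesAtTZero u) {k i : ℕ} {ν : M →₀ ℕ}
    (hk : k < i + ν.degree) (μ l : ℕ) : cf (jetMonomial u (expo i μ ν)) k l = 0 := by
  refine X_zero_pow_dvd_iff.1 ?_ k l hk
  rw [jetMonomial_expo, pow_add, ← card_indices]
  exact mul_dvd_mul_left _ ((X_zero_pow_dvd_jetProd hu _).mul_left _)

theorem cf_jetMonomial_congr {u v : FormalTX} (hu : VanishesAtTZero u) (hv : VanishesAtTZero v)
    {k : ℕ} (h : ∀ k' l, k' < k → cf u k' l = cf v k' l) {i : ℕ} {ν : M →₀ ℕ}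
    (hn : 2 ≤ i + ν.degree) (μ l : ℕ) :
    cf (jetMonomial u (expo i μ ν)) k l = cf (jetMonomial v (expo i μ ν)) k l := by
  have hdvd : (MvPowerSeries.X 0 : FormalTX) ^ (k + 2) ∣
      MvPowerSeries.X 0 * (jetMonomial u (expo i μ ν) - jetMonomial v (expo i μ ν)) := by
    have hprod := mul_dvd_mul (dvd_refl ((MvPowerSeries.X 0 : FormalTX) ^ i))
      (X_zero_pow_dvd_jetProd_sub hu hv h (indices ν))
    rw [← pow_add, card_indices] at hprod
    refine (pow_dvd_pow _ (by omega)).trans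
      ((hprod.mul_left (MvPowerSeries.X 1 ^ μ)).trans (dvd_of_eq ?_))
    rw [jetMonomial_expo, jetMonomial_expo]
    ring
  have hcf := X_zero_pow_dvd_iff.1 hdvd (k + 1) l (by omega)
  rw [cf_X_zero_mul, if_pos (Nat.le_add_left 1 k)] at hcf
  simpa [sub_eq_zero] using hcf

variable {G : (Vars M → ℂ) → ℂ}

theorem cf_compose {u : FormalTX} (hu : VanishesAtTZero u) (k l : ℕ) :
    cf (compose G u) k l =
      ∑ᶠ d : Vars M →₀ ℕ, MvPowerSeries.coeff d (taylorSeries G) * cf (jetMonomial u d) k l :=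
  MvPowerSeries.coeff_subst (hasSubst_jetSubst (M := M) hu) (taylorSeries G) (idx k l)

theorem norm_cf_compose_le {u : FormalTX} (hu : VanishesAtTZero u)
    {k l : ℕ} {B : (Vars M →₀ ℕ) → ℝ} {H : ℝ} (hB : ∀ d,
      ‖MvPowerSeries.coeff d (taylorSeries G) * cf (jetMonomial u d) k l‖ ≤ B d)
    (hH : ∀ S : Finset (Vars M →₀ ℕ), ∑ d ∈ S, B d ≤ H) :
    ‖cf (compose G u) k l‖ ≤ H := by
  have hfin : Function.HasFiniteSupport fun d : Vars M →₀ ℕ =>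
      MvPowerSeries.coeff d (taylorSeries G) * cf (jetMonomial u d) k l :=
    MvPowerSeries.coeff_subst_finite (hasSubst_jetSubst hu) (taylorSeries G) (idx k l)
  rw [cf_compose hu, finsum_eq_sum _ hfin]
  exact (norm_sum_le_of_le _ fun d _ => hB d).trans (hH _)

theorem cf_compose_congr (hG : OrderAtLeastTwo G) {u v : FormalTX}
    (hu : VanishesAtTZero u) (hv : VanishesAtTZero v) {k : ℕ}
    (h : ∀ k' l, k' < k → cf u k' l = cf v k' l) (l : ℕ) :
    cf (compose G u) k l = cf (compose G v) k l := by
  rw [cf_compose hu, cf_compose hv]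
  refine finsum_congr fun d => ?_
  obtain ⟨i, μ, ν, rfl⟩ := exists_eq_expo d
  rcases lt_or_ge (i + ν.degree) 2 with hn | hn
  · have hcoeff : MvPowerSeries.coeff (expo i μ ν) (taylorSeries G) = 0 := hG i ν hn μ
    rw [hcoeff, zero_mul, zero_mul]
  · rw [cf_jetMonomial_congr hu hv h hn]

theorem cf_compose_zero (hG : OrderAtLeastTwo G) {u : FormalTX}
    (hu : VanishesAtTZero u) (l : ℕ) : cf (compose G u) 0 l = 0 := by
  rw [cf_compose hu]
  refine (finsum_congr fun d => ?_).trans finsum_zero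
  obtain ⟨i, μ, ν, rfl⟩ := exists_eq_expo d
  rcases lt_or_ge (i + ν.degree) 2 with hn | hn
  · have hcoeff : MvPowerSeries.coeff (expo i μ ν) (taylorSeries G) = 0 := hG i ν hn μ
    rw [hcoeff, zero_mul]
  · rw [cf_jetMonomial_eq_zero hu (two_pos.trans_le hn), mul_zero]

end Compose

/-! ### Formal solutions -/

theorem existsUnique_eq_of_congr_lt {α E : Type*} [LT α] [WellFoundedLT α] [Nonempty E]
    (F : α → (α → E) → E) (hF : ∀ a w w', (∀ b < a, w b = w' b) → F a w = F a w') :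
    ∃! w : α → E, ∀ a, w a = F a w := by
  classical
  have wf : WellFounded ((· < ·) : α → α → Prop) := wellFounded_lt
  set W : α → E := wf.fix fun a rec =>
    F a fun b => if h : b < a then rec b h else Classical.arbitrary E
  have hW (a : α) : W a = F a W := by
    refine (wf.fix_eq _ a).trans (hF _ _ _ fun b hb => ?_)
    rw [dif_pos hb]
  refine ⟨W, hW, fun w hw => funext fun a => ?_⟩
  induction a using wf.induction with
  | _ a ih => rw [hW, hw, hF a w W ih]

/-- The series with coefficients `w k l`, without the terms of `t`-degree `0` or at least `K`. -/
noncomputable def truncT (K : ℕ) (w : ℕ → ℕ → ℂ) : FormalTX := fun e =>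
  if 1 ≤ e 0 ∧ e 0 < K then w (e 0) (e 1) else 0

theorem cf_truncT (K : ℕ) (w : ℕ → ℕ → ℂ) (k l : ℕ) :
    cf (truncT K w) k l = if 1 ≤ k ∧ k < K then w k l else 0 := by
  change truncT K w (idx k l) = _
  simp [truncT]

theorem vanishesAtTZero_truncT (K : ℕ) (w : ℕ → ℕ → ℂ) : VanishesAtTZero (truncT K w) :=
  vanishesAtTZero_iff.2 fun l => by simp [cf_truncT]

theorem truncT_congr {K : ℕ} {w w' : ℕ → ℕ → ℂ} (h : ∀ k < K, w k = w' k) :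
    truncT K w = truncT K w' :=
  cf_ext fun k l => by
    rw [cf_truncT, cf_truncT]
    split_ifs with hk
    · rw [h k hk.2]
    · rfl

section FormalSolution

variable {M : Finset (ℕ × ℕ)} {m : ℕ} {c : ℕ × ℕ → ℂ → ℂ} {a : ℂ → ℂ} {G : (Vars M → ℂ) → ℂ}

theorem isFormalSolution_iff (hG : OrderAtLeastTwo G) {u : FormalTX} :
    IsFormalSolution m c a G u ↔ (∀ l, cf u 0 l = 0) ∧ ∀ k l : ℕ, 1 ≤ k →
      L m c k l * cf u k l = lowerPart m c k l (cf u k) +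
        ((if k = 1 then taylorCoeff a l else 0) + cf (compose G (truncT k (cf u))) k l) := by
  rw [IsFormalSolution, vanishesAtTZero_iff]
  refine and_congr_right fun hu => ?_
  have hu' : VanishesAtTZero u := vanishesAtTZero_iff.2 hu
  have hcomp (k l) : cf (compose G (truncT k (cf u))) k l = cf (compose G u) k l := by
    refine cf_compose_congr hG (vanishesAtTZero_truncT _ _) hu' (fun k' l' hk' => ?_) l
    rw [cf_truncT]
    split_ifs with h
    · rfl
    · obtain rfl : k' = 0 := by omega
      exact (hu l').symm
  refine ⟨fun h k l _ => ?_, fun h => cf_ext fun k l => ?_⟩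
  · have hkl := congrArg (fun f => cf f k l) h
    simp only [cf_opC, cf_add, cf_taylorX_mul_X_zero] at hkl
    rw [hcomp, ← hkl]
    ring
  · rw [cf_opC, cf_add, cf_taylorX_mul_X_zero]
    rcases Nat.eq_zero_or_pos k with rfl | hk
    · rw [cf_compose_zero hG hu', hu]
      simp [lowerPart, hu]
    · rw [h k l hk, hcomp]
      ring

/-- The coefficient of `t^k x^l` that the equation dictates to a formal solution, given the
coefficients `w` preceding it in the lexicographic order. -/
noncomputable def solveCoeff (m : ℕ) (c : ℕ × ℕ → ℂ → ℂ) (a : ℂ → ℂ) (G : (Vars M → ℂ) → ℂ)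
    (w : ℕ → ℕ → ℂ) (k l : ℕ) : ℂ :=
  if k = 0 then 0 else
    (lowerPart m c k l (w k) +
      ((if k = 1 then taylorCoeff a l else 0) + cf (compose G (truncT k w)) k l)) / L m c k l

theorem solveCoeff_congr {w w' : ℕ → ℕ → ℂ} {k l : ℕ} (hk : ∀ k' < k, w k' = w' k')
    (hl : ∀ l' < l, w k l' = w' k l') :
    solveCoeff m c a G w k l = solveCoeff m c a G w' k l := by
  have hlower : lowerPart m c k l (w k) = lowerPart m c k l (w' k) :=
    Finset.sum_congr rfl fun n hn => by rw [hl n (Finset.mem_range.1 hn)]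
  rw [solveCoeff, solveCoeff, hlower, truncT_congr hk]

theorem isFormalSolution_iff_eq_solveCoeff (hG : OrderAtLeastTwo G) (hN : NonResonant m c)
    {u : FormalTX} :
    IsFormalSolution m c a G u ↔ ∀ k l, cf u k l = solveCoeff m c a G (cf u) k l := by
  simp only [isFormalSolution_iff hG, solveCoeff]
  refine ⟨fun ⟨h0, h⟩ k l => ?_, fun h => ⟨fun l => (h 0 l).trans (if_pos rfl), fun k l hk => ?_⟩⟩
  · rcases Nat.eq_zero_or_pos k with rfl | hk
    · rw [h0, if_pos rfl]
    · rw [if_neg hk.ne', eq_div_iff (hN k l hk), mul_comm, h k l hk]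
  · rw [← (eq_div_iff (hN k l hk)).1 ((h k l).trans (if_neg (Nat.ne_of_gt hk))), mul_comm]

theorem existsUnique_isFormalSolution (a : ℂ → ℂ) (hG : OrderAtLeastTwo G)
    (hN : NonResonant m c) : ∃! u : FormalTX, IsFormalSolution m c a G u := by
  simp only [isFormalSolution_iff_eq_solveCoeff hG hN]
  obtain ⟨w, hw, huniq⟩ := existsUnique_eq_of_congr_lt
    (fun (e : ℕ ×ₗ ℕ) (w : ℕ ×ₗ ℕ → ℂ) =>
      solveCoeff m c a G (fun k l => w (toLex (k, l))) (ofLex e).1 (ofLex e).2)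
    fun e w w' h => solveCoeff_congr
      (fun k hk => funext fun l => h _ (Prod.Lex.toLex_lt_toLex.2 (Or.inl hk)))
      fun l hl => h _ (Prod.Lex.toLex_lt_toLex.2 (Or.inr ⟨rfl, hl⟩))
  have hcf : cf (fun e => w (toLex (e 0, e 1))) = fun k l => w (toLex (k, l)) := by
    funext k l
    change w (toLex (idx k l 0, idx k l 1)) = _
    simp
  refine ⟨fun e => w (toLex (e 0, e 1)), fun k l => ?_, fun u hu => cf_ext fun k l => ?_⟩
  · rw [hcf]
    exact hw (toLex (k, l))
  · rw [hcf, ← huniq (fun e => cf u (ofLex e).1 (ofLex e).2) fun e => hu _ _]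
    rfl

end FormalSolution

/-! ### The lower bound for the characteristic polynomial -/

section LowerBound

open Filter

variable {m : ℕ} {c : ℕ × ℕ → ℂ → ℂ}

/-- The weight `k^j (l+1)^α` of the point `(j, α)`; the shift `l + 1` keeps it positive. -/
noncomputable def weight (p : ℕ × ℕ) (k l : ℕ) : ℝ := (k : ℝ) ^ p.1 * ((l : ℝ) + 1) ^ p.2

/-- The sum of the weights of the points of `Λ_0`, the natural size of `L(k, l)`. -/
noncomputable def weightSum (m : ℕ) (c : ℕ × ℕ → ℂ → ℂ) (k l : ℕ) : ℝ :=
  ∑ p ∈ Lam0 m c, weight p k l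

theorem weight_nonneg (p : ℕ × ℕ) (k l : ℕ) : 0 ≤ weight p k l := by
  unfold weight; positivity

theorem weight_pos (p : ℕ × ℕ) {k : ℕ} (hk : 1 ≤ k) (l : ℕ) : 0 < weight p k l := by
  unfold weight; positivity

theorem mem_Lam0_self : (m, 0) ∈ Lam0 m c := by
  classical
  exact Finset.mem_insert_self _ _

theorem weight_le_weightSum {p : ℕ × ℕ} (hp : p ∈ Lam0 m c) (k l : ℕ) :
    weight p k l ≤ weightSum m c k l :=
  Finset.single_le_sum (f := fun p => weight p k l) (fun _ _ => weight_nonneg _ _ _) hp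

theorem pow_le_weightSum (k l : ℕ) : (k : ℝ) ^ m ≤ weightSum m c k l := by
  simpa [weight] using weight_le_weightSum (mem_Lam0_self (m := m) (c := c)) k l

theorem weightSum_pos {k : ℕ} (hk : 1 ≤ k) (l : ℕ) : 0 < weightSum m c k l :=
  (weight_pos _ hk l).trans_le (weight_le_weightSum mem_Lam0_self k l)

theorem weightSum_mono (k : ℕ) : Monotone (weightSum m c k) := fun l l' h =>
  Finset.sum_le_sum fun p _ => by unfold weight; gcongr

theorem c0_ne_zero {p : ℕ × ℕ} (hp : p ∈ Lam0 m c) : c0 m c p ≠ 0 := by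
  classical
  rw [Lam0, Finset.mem_insert, Finset.mem_filter] at hp
  unfold c0
  split_ifs with h
  · simp
  · exact (hp.resolve_left h).2

theorem mem_I {p : ℕ × ℕ} : p ∈ I m ↔ p.1 + p.2 ≤ m ∧ p.1 < m := by
  simp only [I, Finset.mem_filter, Finset.mem_product, Finset.mem_range]
  omega

theorem fst_lt_of_mem_Lam0 {p : ℕ × ℕ} (hp : p ∈ Lam0 m c) (hne : p ≠ (m, 0)) : p.1 < m := by
  classical
  rw [Lam0, Finset.mem_insert, Finset.mem_filter] at hp
  exact (mem_I.1 (hp.resolve_left hne).1).2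

theorem L_eq (k l : ℕ) :
    L m c k l = -∑ p ∈ Lam0 m c, c0 m c p * ((k : ℂ) ^ p.1 * (l.descFactorial p.2 : ℂ)) := by
  classical
  have not_mem : (m, 0) ∉ (I m).filter fun p => c p 0 ≠ 0 := by simp [mem_I]
  have term_eq : ∀ p ∈ I m, c p 0 * (k : ℂ) ^ p.1 * (descPochhammer ℂ p.2).eval (l : ℂ) =
      if c p 0 ≠ 0 then c0 m c p * ((k : ℂ) ^ p.1 * (l.descFactorial p.2 : ℂ)) else 0 := by
    intro p hp
    have ne : p ≠ (m, 0) := by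
      rintro rfl
      simp [mem_I] at hp
    rw [descPochhammer_eval_eq_descFactorial, c0, if_neg ne]
    split_ifs with h
    · ring
    · rw [not_not.1 h]; ring
  rw [Lam0, Finset.sum_insert not_mem, L, C, Finset.sum_filter, Finset.sum_congr rfl term_eq]
  simp only [c0, if_pos, Nat.descFactorial_zero, Nat.cast_one]
  ring

theorem newton_subset_halfspace {r s M : ℝ} (hr : 0 ≤ r) (hs : 0 ≤ s)
    (h : ∀ p ∈ Lam0 m c, r * p.1 + s * p.2 ≤ M) :
    newton m c ⊆ {q : ℝ × ℝ | r * q.1 + s * q.2 ≤ M} := by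
  refine convexHull_min ?_ ?_
  · intro q hq
    simp only [Set.mem_iUnion] at hq
    obtain ⟨p, hp, h1, h2⟩ := hq
    refine le_trans ?_ (h p hp)
    gcongr
  · have isLinear : IsLinearMap ℝ fun q : ℝ × ℝ => r * q.1 + s * q.2 :=
      ⟨fun x y => by simp only [Prod.fst_add, Prod.snd_add]; ring,
        fun a x => by simp only [Prod.smul_fst, Prod.smul_snd, smul_eq_mul]; ring⟩
    exact convex_halfSpace_le isLinear M

theorem mem_newton {p : ℕ × ℕ} (hp : p ∈ Lam0 m c) {q : ℝ × ℝ} (h1 : q.1 ≤ p.1)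
    (h2 : q.2 ≤ p.2) : q ∈ newton m c :=
  subset_convexHull ℝ _ (Set.mem_biUnion hp ⟨h1, h2⟩)

theorem mem_sidePts {r : ℝ} (hr : 0 ≤ r) {p : ℕ × ℕ} :
    p ∈ sidePts m c r ↔ p ∈ Lam0 m c ∧ ∀ q ∈ Lam0 m c, r * q.1 + q.2 ≤ r * p.1 + p.2 := by
  classical
  rw [sidePts, Finset.mem_filter]
  refine and_congr_right fun hp => ⟨fun h q hq => ?_, fun h => ⟨?_, fun q' hq' => ?_⟩⟩
  · exact h.2 (pt q) (mem_newton hq le_rfl le_rfl)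
  · exact mem_newton hp le_rfl le_rfl
  · have := newton_subset_halfspace hr zero_le_one (M := r * p.1 + p.2)
      (fun q hq => by simpa using h q hq) hq'
    simpa [pt] using this

-- After taking logarithms this is a linear inequality on the vertices of the Newton polygon.
theorem rpow_mul_rpow_le_weightSum {k : ℕ} (hk : 1 ≤ k) (l : ℕ) {x y : ℝ}
    (h : (x, y) ∈ newton m c) : (k : ℝ) ^ x * ((l : ℝ) + 1) ^ y ≤ weightSum m c k l := by
  have one_le_k : (1 : ℝ) ≤ k := by exact_mod_cast hk
  have one_le_l : (1 : ℝ) ≤ (l : ℝ) + 1 := le_add_of_nonneg_left l.cast_nonneg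
  have log_le : Real.log k * x + Real.log ((l : ℝ) + 1) * y ≤ Real.log (weightSum m c k l) := by
    refine newton_subset_halfspace (Real.log_nonneg one_le_k) (Real.log_nonneg one_le_l)
      (fun p hp => ?_) h
    have := Real.log_le_log (weight_pos p hk l) (weight_le_weightSum hp k l)
    rw [weight, Real.log_mul (by positivity) (by positivity), Real.log_pow, Real.log_pow] at this
    linarith
  rw [← Real.log_le_log_iff (by positivity) (weightSum_pos hk l),
    Real.log_mul (by positivity) (by positivity), Real.log_rpow (by positivity),
    Real.log_rpow (by positivity)]
  linarith

variable {ι : Type*} {F : Filter ι} {κ ℓ : ι → ℕ}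

/-- The pairs `(κ, ℓ)`, with `κ ≥ 1`, violate along `F` every lower bound `δ φ(k, l) ≤ |L(k, l)|`
with `δ > 0`, where `φ` is the sum of the weights over `Λ_0`. -/
structure IsDegenerate (m : ℕ) (c : ℕ × ℕ → ℂ → ℂ) (F : Filter ι) (κ ℓ : ι → ℕ) : Prop where
  one_le : ∀ n, 1 ≤ κ n
  tendsto : Tendsto (fun n => L m c (κ n) (ℓ n) / (weightSum m c (κ n) (ℓ n) : ℂ)) F (𝓝 0)

theorem L_div_eq (k l : ℕ) (D : ℝ) :
    L m c k l / (D : ℂ) = -∑ p ∈ Lam0 m c, c0 m c p *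
      ((weight p k l / D * ((l.descFactorial p.2 : ℝ) / ((l : ℝ) + 1) ^ p.2) : ℝ) : ℂ) := by
  rw [L_eq, neg_div, Finset.sum_div]
  congr 1
  refine Finset.sum_congr rfl fun p _ => ?_
  have term_eq : weight p k l / D * ((l.descFactorial p.2 : ℝ) / ((l : ℝ) + 1) ^ p.2) =
      (k : ℝ) ^ p.1 * (l.descFactorial p.2 : ℝ) / D := by
    have : ((l : ℝ) + 1) ^ p.2 ≠ 0 := by positivity
    unfold weight
    field_simp
  rw [term_eq, mul_div_assoc]
  push_cast
  ring

theorem IsDegenerate.sum_limit_eq_zero [F.NeBot] (h : IsDegenerate m c F κ ℓ) {D : ι → ℝ}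
    {w θ : ℕ × ℕ → ℝ}
    (hw : ∀ p ∈ Lam0 m c, Tendsto (fun n => weight p (κ n) (ℓ n) / D n) F (𝓝 (w p)))
    (hθ : ∀ p ∈ Lam0 m c, Tendsto
      (fun n => ((ℓ n).descFactorial p.2 : ℝ) / ((ℓ n : ℝ) + 1) ^ p.2) F (𝓝 (θ p))) :
    ∑ p ∈ Lam0 m c, c0 m c p * ((w p * θ p : ℝ) : ℂ) = 0 := by
  have termwise : Tendsto (fun n => L m c (κ n) (ℓ n) / (D n : ℂ)) F
      (𝓝 (-∑ p ∈ Lam0 m c, c0 m c p * ((w p * θ p : ℝ) : ℂ))) := by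
    simp only [L_div_eq]
    exact (tendsto_finsetSum _ fun p hp => tendsto_const_nhds.mul
      ((Complex.continuous_ofReal.tendsto _).comp ((hw p hp).mul (hθ p hp)))).neg
  have degenerate : Tendsto (fun n => L m c (κ n) (ℓ n) / (D n : ℂ)) F (𝓝 0) := by
    have := h.tendsto.mul
      ((Complex.continuous_ofReal.tendsto _).comp (tendsto_finsetSum _ hw))
    rw [zero_mul] at this
    refine this.congr fun n => ?_
    rw [Function.comp_apply, ← Finset.sum_div, Complex.ofReal_div, ← mul_div_assoc]
    exact congrArg (· / (D n : ℂ))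
      (div_mul_cancel₀ _ (Complex.ofReal_ne_zero.2 (weightSum_pos (h.one_le n) _).ne'))
  simpa using tendsto_nhds_unique termwise degenerate

theorem tendsto_descFactorial_div_pow (α : ℕ) :
    Tendsto (fun l : ℕ => (l.descFactorial α : ℝ) / ((l : ℝ) + 1) ^ α) atTop (𝓝 1) := by
  induction α with
  | zero => simp
  | succ α ih =>
    have factor : Tendsto (fun l : ℕ => ((l - α : ℕ) : ℝ) / ((l : ℝ) + 1)) atTop (𝓝 1) := by
      have : Tendsto (fun l : ℕ => 1 - (α + 1 : ℝ) * (1 / ((l : ℝ) + 1))) atTop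
          (𝓝 (1 - (α + 1 : ℝ) * 0)) :=
        tendsto_const_nhds.sub (tendsto_const_nhds.mul tendsto_one_div_add_atTop_nhds_zero_nat)
      rw [mul_zero, sub_zero] at this
      refine this.congr' ?_
      filter_upwards [eventually_ge_atTop α] with l hl
      rw [Nat.cast_sub hl]
      field_simp
      ring
    have := factor.mul ih
    rw [one_mul] at this
    refine this.congr fun l => ?_
    rw [Nat.descFactorial_succ, pow_succ, Nat.cast_mul, div_mul_div_comm,
      mul_comm (((l : ℝ) + 1) ^ α)]

theorem tendsto_add_one_atTop (hℓ : Tendsto ℓ F atTop) :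
    Tendsto (fun n => (ℓ n : ℝ) + 1) F atTop :=
  tendsto_atTop_add_const_right _ _ (tendsto_natCast_atTop_atTop.comp hℓ)

theorem weight_div_rpow_eq (p : ℕ × ℕ) (k l : ℕ) (r ρ : ℝ) :
    weight p k l / ((l : ℝ) + 1) ^ ρ =
      ((k : ℝ) / ((l : ℝ) + 1) ^ r) ^ p.1 * ((l : ℝ) + 1) ^ (r * p.1 + p.2 - ρ) := by
  have hpos : (0 : ℝ) < (l : ℝ) + 1 := by positivity
  rw [Real.rpow_sub hpos, Real.rpow_add hpos, Real.rpow_mul hpos.le,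
    Real.rpow_natCast, Real.rpow_natCast, div_pow, weight]
  have : ((l : ℝ) + 1) ^ r ≠ 0 := (Real.rpow_pos_of_pos hpos _).ne'
  field_simp

theorem tendsto_weight_div_rpow (hℓ : Tendsto ℓ F atTop) {r y ρ : ℝ}
    (hy : Tendsto (fun n => (κ n : ℝ) / ((ℓ n : ℝ) + 1) ^ r) F (𝓝 y)) {p : ℕ × ℕ}
    (hp : r * p.1 + p.2 ≤ ρ) :
    Tendsto (fun n => weight p (κ n) (ℓ n) / ((ℓ n : ℝ) + 1) ^ ρ) F
      (𝓝 (if r * p.1 + p.2 = ρ then y ^ p.1 else 0)) := by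
  simp only [weight_div_rpow_eq p _ _ r]
  split_ifs with hs
  · simpa [hs] using hy.pow p.1
  · have hlt : 0 < ρ - (r * p.1 + p.2) := sub_pos.2 (lt_of_le_of_ne hp hs)
    have := (hy.pow p.1).mul ((tendsto_rpow_neg_atTop hlt).comp (tendsto_add_one_atTop hℓ))
    simpa [Function.comp_def] using this

open Classical in
-- The weights are rescaled by `(ℓ + 1) ^ ρ`, where `ρ` is the maximum of `r j + α` over `Λ_0`.
theorem IsDegenerate.sum_sidePts_eq_zero [F.NeBot] (h : IsDegenerate m c F κ ℓ)
    (hℓ : Tendsto ℓ F atTop) {r y : ℝ} (hr : 0 ≤ r)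
    (hy : Tendsto (fun n => (κ n : ℝ) / ((ℓ n : ℝ) + 1) ^ r) F (𝓝 y)) :
    ∑ p ∈ sidePts m c r, c0 m c p * (y : ℂ) ^ p.1 = 0 := by
  obtain ⟨p₀, hp₀, le_max⟩ := Finset.exists_max_image (Lam0 m c) (fun p => r * p.1 + p.2)
    ⟨_, mem_Lam0_self⟩
  set ρ : ℝ := r * p₀.1 + p₀.2
  have sidePts_eq : sidePts m c r = (Lam0 m c).filter fun p => r * p.1 + p.2 = ρ := by
    ext p
    rw [mem_sidePts hr, Finset.mem_filter]
    exact and_congr_right fun hp => ⟨fun hmax => le_antisymm (le_max p hp) (hmax _ hp₀),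
      fun hmax q hq => (le_max q hq).trans_eq hmax.symm⟩
  have := h.sum_limit_eq_zero (fun p hp => tendsto_weight_div_rpow hℓ hy (le_max p hp))
    (fun p _ => (tendsto_descFactorial_div_pow p.2).comp hℓ)
  rw [sidePts_eq, Finset.sum_filter]
  refine (Finset.sum_congr rfl fun p _ => ?_).trans this
  split_ifs <;> simp

theorem sum_sidePts_eq_charPoly (r : ℝ) (y : ℂ) :
    ∑ p ∈ sidePts m c r, c0 m c p * y ^ p.1 = y ^ leftEnd m c r * (charPoly m c r).eval y := by
  rw [charPoly, Polynomial.eval_finsetSum, Finset.mul_sum]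
  refine Finset.sum_congr rfl fun p hp => ?_
  have leftEnd_le : leftEnd m c r ≤ p.1 := Nat.sInf_le ⟨p, hp, rfl⟩
  simp only [Polynomial.eval_mul, Polynomial.eval_C, Polynomial.eval_pow, Polynomial.eval_X]
  rw [mul_left_comm, ← pow_add, Nat.add_sub_cancel' leftEnd_le]

theorem weight_div_weight_of_le {p q : ℕ × ℕ} (h : p ≤ q) {k : ℕ} (hk : 1 ≤ k) (l : ℕ) :
    weight q k l / weight p k l = (k : ℝ) ^ (q.1 - p.1) * ((l : ℝ) + 1) ^ (q.2 - p.2) := by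
  rw [div_eq_iff (weight_pos p hk _).ne', weight, weight, mul_mul_mul_comm, ← pow_add, ← pow_add,
    Nat.sub_add_cancel h.1, Nat.sub_add_cancel h.2]

theorem tendsto_weight_div_weight_atTop (hκ1 : ∀ n, 1 ≤ κ n) (hκ : Tendsto κ F atTop)
    (hℓ : Tendsto ℓ F atTop) {p q : ℕ × ℕ} (hpq : p < q) :
    Tendsto (fun n => weight q (κ n) (ℓ n) / weight p (κ n) (ℓ n)) F atTop := by
  have one_le_k : ∀ n, (1 : ℝ) ≤ κ n := fun n => by exact_mod_cast hκ1 n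
  have one_le_l : ∀ n, (1 : ℝ) ≤ (ℓ n : ℝ) + 1 := fun n => le_add_of_nonneg_left (ℓ n).cast_nonneg
  simp only [fun n => weight_div_weight_of_le hpq.le (hκ1 n) (ℓ n)]
  rcases Prod.lt_iff.1 hpq with ⟨h1, -⟩ | ⟨-, h2⟩
  · exact tendsto_atTop_mono (fun n => (le_self_pow₀ (one_le_k n) (by omega)).trans
      (le_mul_of_one_le_right (by positivity) (one_le_pow₀ (one_le_l n))))
      (tendsto_natCast_atTop_atTop.comp hκ)
  · exact tendsto_atTop_mono (fun n => (le_self_pow₀ (one_le_l n) (by omega)).trans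
      (le_mul_of_one_le_left (by positivity) (one_le_pow₀ (one_le_k n))))
      (tendsto_add_one_atTop hℓ)

theorem weight_div_weight_of_fst_lt_of_snd_lt {p q : ℕ × ℕ} (h1 : p.1 < q.1) (h2 : q.2 < p.2)
    {k : ℕ} (hk : 1 ≤ k) (l : ℕ) :
    weight q k l / weight p k l = ((k : ℝ) / ((l : ℝ) + 1) ^
      (((p.2 - q.2 : ℕ) : ℝ) / ((q.1 - p.1 : ℕ) : ℝ))) ^ (q.1 - p.1) := by
  have exponent_ne : ((q.1 - p.1 : ℕ) : ℝ) ≠ 0 := by exact_mod_cast (Nat.sub_pos_of_lt h1).ne'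
  have fst_eq : (k : ℝ) ^ q.1 = (k : ℝ) ^ (q.1 - p.1) * (k : ℝ) ^ p.1 := by
    rw [← pow_add, Nat.sub_add_cancel h1.le]
  have snd_eq : ((l : ℝ) + 1) ^ p.2 = ((l : ℝ) + 1) ^ (p.2 - q.2) * ((l : ℝ) + 1) ^ q.2 := by
    rw [← pow_add, Nat.sub_add_cancel h2.le]
  rw [div_pow, ← Real.rpow_mul_natCast (by positivity), div_mul_cancel₀ _ exponent_ne,
    Real.rpow_natCast, div_eq_div_iff (weight_pos p hk _).ne' (by positivity), weight, weight,
    fst_eq, snd_eq]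
  ring

theorem exists_tendsto_div_rpow (hκ1 : ∀ n, 1 ≤ κ n) {p q : ℕ × ℕ} (h1 : p.1 < q.1)
    (h2 : q.2 < p.2) {b : ℝ} (hb : 0 < b)
    (hlim : Tendsto (fun n => weight q (κ n) (ℓ n) / weight p (κ n) (ℓ n)) F (𝓝 b)) :
    ∃ r y : ℝ, 0 < r ∧ 0 < y ∧ Tendsto (fun n => (κ n : ℝ) / ((ℓ n : ℝ) + 1) ^ r) F (𝓝 y) := by
  have Δ_pos : (0 : ℝ) < ((q.1 - p.1 : ℕ) : ℝ) := by exact_mod_cast Nat.sub_pos_of_lt h1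
  refine ⟨((p.2 - q.2 : ℕ) : ℝ) / ((q.1 - p.1 : ℕ) : ℝ), b ^ (((q.1 - p.1 : ℕ) : ℝ)⁻¹),
    div_pos (by exact_mod_cast Nat.sub_pos_of_lt h2) Δ_pos, Real.rpow_pos_of_pos hb _,
    (hlim.rpow_const (Or.inr (by positivity))).congr fun n => ?_⟩
  rw [weight_div_weight_of_fst_lt_of_snd_lt h1 h2 (hκ1 n),
    Real.pow_rpow_inv_natCast (by positivity) (Nat.sub_pos_of_lt h1).ne']

theorem mem_sidePts_of_tendsto [F.NeBot] (hκ1 : ∀ n, 1 ≤ κ n) (hℓ : Tendsto ℓ F atTop) {r y : ℝ}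
    (hr : 0 ≤ r) (hy0 : 0 < y) (hy : Tendsto (fun n => (κ n : ℝ) / ((ℓ n : ℝ) + 1) ^ r) F (𝓝 y))
    {p : ℕ × ℕ} (hp : p ∈ Lam0 m c) {a : ℝ} (ha : 0 < a)
    (hlim : Tendsto (fun n => weight p (κ n) (ℓ n) / weightSum m c (κ n) (ℓ n)) F (𝓝 a)) :
    p ∈ sidePts m c r := by
  refine (mem_sidePts hr).2 ⟨hp, fun q hq => le_of_not_gt fun hlt => ha.not_ge ?_⟩
  have numerator := tendsto_weight_div_rpow hℓ hy hlt.le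
  have denominator := tendsto_weight_div_rpow hℓ hy (le_refl (r * q.1 + q.2))
  rw [if_neg hlt.ne] at numerator
  rw [if_pos rfl] at denominator
  have quotient := numerator.div denominator (pow_pos hy0 _).ne'
  rw [zero_div] at quotient
  refine le_of_tendsto_of_tendsto' hlim quotient fun n => ?_
  rw [Pi.div_apply, div_div_div_cancel_right₀ (Real.rpow_pos_of_pos (by positivity) _).ne']
  exact div_le_div_of_nonneg_left (weight_nonneg _ _ _) (weight_pos _ (hκ1 n) _)
    (weight_le_weightSum hq _ _)

theorem side_nontrivial {r : ℝ} {p q : ℕ × ℕ} (hp : p ∈ sidePts m c r) (hq : q ∈ sidePts m c r)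
    (hne : p ≠ q) : (side m c r).Nontrivial := by
  classical
  refine ⟨pt p, (Finset.mem_filter.1 hp).2, pt q, (Finset.mem_filter.1 hq).2, fun h => hne ?_⟩
  rw [pt, pt, Prod.mk.injEq, Nat.cast_inj, Nat.cast_inj] at h
  exact Prod.ext h.1 h.2

-- Two weights of the same order of magnitude force `κ ~ y ℓ ^ r`, where `-r` is the slope of the
-- line through the two points; then `y > 0` is a characteristic root on a side of this slope.
theorem IsDegenerate.eq_of_tendsto_weight_div [F.NeBot] (h : IsDegenerate m c F κ ℓ)
    (hκ : Tendsto κ F atTop) (hℓ : Tendsto ℓ F atTop) (hGP : GenPoincare m c) {p q : ℕ × ℕ}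
    (hp : p ∈ Lam0 m c) (hq : q ∈ Lam0 m c) {a b : ℝ} (ha : 0 < a) (hb : 0 < b)
    (hwp : Tendsto (fun n => weight p (κ n) (ℓ n) / weightSum m c (κ n) (ℓ n)) F (𝓝 a))
    (hwq : Tendsto (fun n => weight q (κ n) (ℓ n) / weightSum m c (κ n) (ℓ n)) F (𝓝 b)) :
    p = q := by
  wlog hle : p.1 ≤ q.1 generalizing p q a b
  · exact (this hq hp hb ha hwq hwp (le_of_not_ge hle)).symm
  by_contra hne
  have cancel (x y : ℕ × ℕ) (n : ι) := div_div_div_cancel_right₀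
    (weightSum_pos (m := m) (c := c) (h.one_le n) (ℓ n)).ne' (weight x (κ n) (ℓ n))
    (weight y (κ n) (ℓ n))
  have hqp := (hwq.div hwp ha.ne').congr (cancel q p)
  have hpq := (hwp.div hwq hb.ne').congr (cancel p q)
  have not_lt : ¬p < q := fun hlt => not_tendsto_nhds_of_tendsto_atTop
    (tendsto_weight_div_weight_atTop h.one_le hκ hℓ hlt) _ hqp
  have not_gt : ¬q < p := fun hlt => not_tendsto_nhds_of_tendsto_atTop
    (tendsto_weight_div_weight_atTop h.one_le hκ hℓ hlt) _ hpq
  have snd_lt : q.2 < p.2 := lt_of_not_ge fun h2 => not_lt (lt_of_le_of_ne ⟨hle, h2⟩ hne)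
  have fst_lt : p.1 < q.1 := lt_of_not_ge fun h1 =>
    not_gt (lt_of_le_of_ne ⟨h1, snd_lt.le⟩ (Ne.symm hne))
  obtain ⟨r, y, hr, hy0, hy⟩ := exists_tendsto_div_rpow h.one_le fst_lt snd_lt (div_pos hb ha) hqp
  have root := h.sum_sidePts_eq_zero hℓ hr.le hy
  rw [sum_sidePts_eq_charPoly] at root
  refine hGP.1 r hr (side_nontrivial (mem_sidePts_of_tendsto h.one_le hℓ hr.le hy0 hy hp ha hwp)
    (mem_sidePts_of_tendsto h.one_le hℓ hr.le hy0 hy hq hb hwq) hne) y ?_ y hy0.le rfl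
  exact (mul_eq_zero.1 root).resolve_left (pow_ne_zero _ (by exact_mod_cast hy0.ne'))

theorem eventually_eq_or_tendsto_atTop (F : Ultrafilter ι) (κ : ι → ℕ) :
    (∃ k, ∀ᶠ n in F, κ n = k) ∨ Tendsto κ F atTop := by
  by_contra! h
  obtain ⟨h1, h2⟩ := h
  refine h2 (tendsto_atTop.2 fun b => ?_)
  induction b with
  | zero => simp
  | succ b ih =>
    filter_upwards [ih, h1 b] with n hn1 hn2
    omega

theorem not_isDegenerate_of_eventually_eq [F.NeBot] (hN : NonResonant m c) {k l : ℕ}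
    (hκ : ∀ᶠ n in F, κ n = k) (hℓ : ∀ᶠ n in F, ℓ n = l) : ¬IsDegenerate m c F κ ℓ := by
  intro h
  obtain ⟨n, hn⟩ := hκ.exists
  have hk : 1 ≤ k := hn ▸ h.one_le n
  have limit : Tendsto (fun n => L m c (κ n) (ℓ n) / (weightSum m c (κ n) (ℓ n) : ℂ)) F
      (𝓝 (L m c k l / (weightSum m c k l : ℂ))) := by
    refine tendsto_const_nhds.congr' ?_
    filter_upwards [hκ, hℓ] with n hn1 hn2
    rw [hn1, hn2]
  exact div_ne_zero (hN k l hk) (Complex.ofReal_ne_zero.2 (weightSum_pos hk l).ne')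
    (tendsto_nhds_unique limit h.tendsto)

theorem tendsto_weight_div_pow {p : ℕ × ℕ} (hp : p.1 < m) (hκ1 : ∀ n, 1 ≤ κ n)
    (hκ : Tendsto κ F atTop) {l : ℕ} (hℓ : ∀ᶠ n in F, ℓ n = l) :
    Tendsto (fun n => weight p (κ n) (ℓ n) / (κ n : ℝ) ^ m) F (𝓝 0) := by
  have : Tendsto (fun n => ((l : ℝ) + 1) ^ p.2 * ((κ n : ℝ) ^ (m - p.1))⁻¹) F
      (𝓝 (((l : ℝ) + 1) ^ p.2 * 0)) :=
    tendsto_const_nhds.mul (tendsto_inv_atTop_zero.comp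
      ((tendsto_pow_atTop (by omega)).comp (tendsto_natCast_atTop_atTop.comp hκ)))
  rw [mul_zero] at this
  refine this.congr' ?_
  filter_upwards [hℓ] with n hn
  have pow_eq : (κ n : ℝ) ^ m = (κ n : ℝ) ^ (m - p.1) * (κ n : ℝ) ^ p.1 := by
    rw [← pow_add, Nat.sub_add_cancel hp.le]
  have : (0 : ℝ) < κ n := by exact_mod_cast hκ1 n
  rw [weight, hn, pow_eq]
  field_simp

theorem not_isDegenerate_of_tendsto_of_eventually_eq [F.NeBot] (hκ : Tendsto κ F atTop) {l : ℕ}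
    (hℓ : ∀ᶠ n in F, ℓ n = l) : ¬IsDegenerate m c F κ ℓ := by
  intro h
  have weight_limit : ∀ p ∈ Lam0 m c, Tendsto (fun n => weight p (κ n) (ℓ n) / (κ n : ℝ) ^ m) F
      (𝓝 (if p = (m, 0) then 1 else 0)) := by
    intro p hp
    split_ifs with hpm
    · subst hpm
      refine tendsto_const_nhds.congr fun n => ?_
      have : (κ n : ℝ) ≠ 0 := by exact_mod_cast Nat.one_le_iff_ne_zero.1 (h.one_le n)
      simp [weight, this]
    · exact tendsto_weight_div_pow (fst_lt_of_mem_Lam0 hp hpm) h.one_le hκ hℓ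
  have descFactorial_limit : ∀ p ∈ Lam0 m c, Tendsto
      (fun n => ((ℓ n).descFactorial p.2 : ℝ) / ((ℓ n : ℝ) + 1) ^ p.2) F
      (𝓝 ((l.descFactorial p.2 : ℝ) / ((l : ℝ) + 1) ^ p.2)) := by
    intro p _
    refine tendsto_const_nhds.congr' ?_
    filter_upwards [hℓ] with n hn
    rw [hn]
  have sum_eq := h.sum_limit_eq_zero weight_limit descFactorial_limit
  rw [Finset.sum_eq_single_of_mem (m, 0) mem_Lam0_self fun p _ hne => by simp [hne]] at sum_eq
  simp [c0] at sum_eq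

theorem not_isDegenerate_of_eventually_eq_of_tendsto [F.NeBot] (hGP : GenPoincare m c) {k : ℕ}
    (hκ : ∀ᶠ n in F, κ n = k) (hℓ : Tendsto ℓ F atTop) : ¬IsDegenerate m c F κ ℓ := by
  intro h
  obtain ⟨n, hn⟩ := hκ.exists
  have root := h.sum_sidePts_eq_zero hℓ le_rfl (y := k) (by
    refine tendsto_const_nhds.congr' ?_
    filter_upwards [hκ] with n hn
    rw [hn, Real.rpow_zero, div_one])
  refine hGP.2 k ?_ k (hn ▸ h.one_le n) rfl
  rw [Polynomial.IsRoot, charPolyLast, Polynomial.eval_finsetSum, ← root]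
  simp

theorem exists_tendsto_weight_div_weightSum (F : Ultrafilter ι) (hκ1 : ∀ n, 1 ≤ κ n)
    {p : ℕ × ℕ} (hp : p ∈ Lam0 m c) :
    ∃ w : ℝ, 0 ≤ w ∧
      Tendsto (fun n => weight p (κ n) (ℓ n) / weightSum m c (κ n) (ℓ n)) F (𝓝 w) := by
  obtain ⟨w, hw, hlim⟩ := (isCompact_Icc (a := (0 : ℝ)) (b := 1)).ultrafilter_le_nhds
    (F.map fun n => weight p (κ n) (ℓ n) / weightSum m c (κ n) (ℓ n)) (by
      refine le_principal_iff.2 (Ultrafilter.mem_map.2 (Filter.univ_mem' fun n => ?_))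
      exact ⟨div_nonneg (weight_nonneg _ _ _) (weightSum_pos (hκ1 n) _).le,
        div_le_one_of_le₀ (weight_le_weightSum hp _ _) (weightSum_pos (hκ1 n) _).le⟩)
  exact ⟨w, hw.1, hlim⟩

-- Exactly one normalized weight has a nonzero limit, so the corresponding coefficient of `L`
-- would have to vanish.
theorem not_isDegenerate_of_tendsto {F : Ultrafilter ι} (hGP : GenPoincare m c)
    (hκ : Tendsto κ F atTop) (hℓ : Tendsto ℓ F atTop) : ¬IsDegenerate m c F κ ℓ := by
  intro h
  choose! w w_nonneg hw using fun p (hp : p ∈ Lam0 m c) =>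
    exists_tendsto_weight_div_weightSum (ℓ := ℓ) F h.one_le hp
  have sum_w : ∑ p ∈ Lam0 m c, w p = 1 := by
    refine tendsto_nhds_unique (tendsto_finsetSum _ hw) (tendsto_const_nhds.congr fun n => ?_)
    rw [← Finset.sum_div]
    exact (div_self (weightSum_pos (h.one_le n) _).ne').symm
  obtain ⟨p, hp, hwp⟩ : ∃ p ∈ Lam0 m c, w p ≠ 0 :=
    Finset.exists_ne_zero_of_sum_ne_zero (sum_w ▸ one_ne_zero)
  have unique : ∀ q ∈ Lam0 m c, q ≠ p → w q = 0 := fun q hq hne => by_contra fun hwq =>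
    hne (h.eq_of_tendsto_weight_div hκ hℓ hGP hq hp ((w_nonneg q hq).lt_of_ne' hwq)
      ((w_nonneg p hp).lt_of_ne' hwp) (hw q hq) (hw p hp))
  have sum_eq := h.sum_limit_eq_zero hw
    (fun q _ => (tendsto_descFactorial_div_pow q.2).comp hℓ)
  rw [Finset.sum_eq_single_of_mem p hp fun q hq hne => by simp [unique q hq hne], mul_one,
    mul_eq_zero, Complex.ofReal_eq_zero] at sum_eq
  exact sum_eq.elim (c0_ne_zero hp) hwp

theorem not_isDegenerate (F : Ultrafilter ι) (hN : NonResonant m c) (hGP : GenPoincare m c)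
    (κ ℓ : ι → ℕ) : ¬IsDegenerate m c F κ ℓ := by
  rcases eventually_eq_or_tendsto_atTop F ℓ with ⟨l, hℓ⟩ | hℓ <;>
    rcases eventually_eq_or_tendsto_atTop F κ with ⟨k, hκ⟩ | hκ
  · exact not_isDegenerate_of_eventually_eq hN hκ hℓ
  · exact not_isDegenerate_of_tendsto_of_eventually_eq hκ hℓ
  · exact not_isDegenerate_of_eventually_eq_of_tendsto hGP hκ hℓ
  · exact not_isDegenerate_of_tendsto hGP hκ hℓ

theorem exists_weightSum_le_norm_L (hN : NonResonant m c) (hGP : GenPoincare m c) :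
    ∃ δ : ℝ, 0 < δ ∧ ∀ k l : ℕ, 1 ≤ k → δ * weightSum m c k l ≤ ‖L m c k l‖ := by
  by_contra! h
  choose κ ℓ hκ1 hlt using fun n : ℕ => h (1 / ((n : ℝ) + 1)) (by positivity)
  refine not_isDegenerate (hyperfilter ℕ) hN hGP κ ℓ ⟨hκ1, squeeze_zero_norm (fun n => ?_)
    (tendsto_one_div_add_atTop_nhds_zero_nat.mono_left Nat.hyperfilter_le_atTop)⟩
  have pos := weightSum_pos (m := m) (c := c) (hκ1 n) (ℓ n)
  rw [norm_div, Complex.norm_real, Real.norm_of_nonneg pos.le, div_le_iff₀ pos]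
  exact (hlt n).le

end LowerBound

/-! ### The irregularity at `x = 0` -/

section Irregularity

variable {m : ℕ} {c : ℕ × ℕ → ℂ → ℂ}

theorem bddAbove_sigma0_set : BddAbove (insert 1
    ((fun p => ((analyticOrderNatAt (c p) 0 : ℝ) + dist m c p) /
      (analyticOrderNatAt (c p) 0 : ℝ)) '' Lam1 m c)) :=
  ((((I m).finite_toSet.subset fun _ hp => hp.1).image _).insert 1).bddAbove

theorem one_le_sigma0 : 1 ≤ sigma0 m c :=
  le_csSup bddAbove_sigma0_set (Set.mem_insert _ _)

theorem dist_le_order_mul {p : ℕ × ℕ} (hp : p ∈ Lam1 m c) (hc : AnalyticAt ℂ (c p) 0) :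
    dist m c p ≤ analyticOrderNatAt (c p) 0 * (sigma0 m c - 1) := by
  have order_ne_zero : analyticOrderNatAt (c p) 0 ≠ 0 := fun h =>
    hc.analyticOrderAt_eq_zero.1 (by rw [← Nat.cast_analyticOrderNatAt hp.2.2, h, Nat.cast_zero])
      hp.2.1
  have order_pos : (0 : ℝ) < analyticOrderNatAt (c p) 0 := by
    exact_mod_cast Nat.pos_of_ne_zero order_ne_zero
  have : _ ≤ sigma0 m c := le_csSup bddAbove_sigma0_set
    (Set.mem_insert_of_mem _ (Set.mem_image_of_mem _ hp))
  rw [div_le_iff₀ order_pos] at this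
  linarith

theorem rpow_sub_dist_le_weightSum {p : ℕ × ℕ} (hp : p ∈ I m) {k : ℕ} (hk : 1 ≤ k) (l : ℕ) :
    (k : ℝ) ^ p.1 * ((l : ℝ) + 1) ^ ((p.2 : ℝ) - dist m c p) ≤ weightSum m c k l := by
  have l_pos : (0 : ℝ) < (l : ℝ) + 1 := by positivity
  have nonempty : {y : ℝ | ((p.1 : ℝ), (p.2 : ℝ) - y) ∈ newton m c}.Nonempty :=
    ⟨p.2, mem_newton mem_Lam0_self (by simpa using (mem_I.1 hp).2.le) (by simp)⟩
  have approx : ∀ ε : ℝ, 0 < ε →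
      (k : ℝ) ^ p.1 * ((l : ℝ) + 1) ^ ((p.2 : ℝ) - dist m c p - ε) ≤ weightSum m c k l := by
    intro ε hε
    obtain ⟨y, hy, hlt⟩ := exists_lt_of_csInf_lt nonempty (lt_add_of_pos_right (dist m c p) hε)
    refine le_trans ?_ (rpow_mul_rpow_le_weightSum hk l hy)
    rw [Real.rpow_natCast]
    refine mul_le_mul_of_nonneg_left ?_ (by positivity)
    exact Real.rpow_le_rpow_of_exponent_le (le_add_of_nonneg_left l.cast_nonneg) (by linarith)
  have continuous : Continuous fun ε : ℝ =>
      (k : ℝ) ^ p.1 * ((l : ℝ) + 1) ^ ((p.2 : ℝ) - dist m c p - ε) :=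
    continuous_const.mul
      (Continuous.rpow continuous_const (by fun_prop) fun _ => Or.inl l_pos.ne')
  have limit := (continuous.tendsto 0).mono_left (nhdsWithin_le_nhds (s := Set.Ioi 0))
  rw [sub_zero] at limit
  exact le_of_tendsto limit (by filter_upwards [self_mem_nhdsWithin] with ε hε using approx ε hε)

theorem pow_mul_descFactorial_le_weight (p : ℕ × ℕ) (k l : ℕ) :
    (k : ℝ) ^ p.1 * (l.descFactorial p.2 : ℝ) ≤ weight p k l := by
  refine mul_le_mul_of_nonneg_left ?_ (by positivity)
  calc (l.descFactorial p.2 : ℝ) ≤ (l : ℝ) ^ p.2 := by exact_mod_cast Nat.descFactorial_le_pow _ _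
    _ ≤ ((l : ℝ) + 1) ^ p.2 := by gcongr; linarith

-- A term `x^n` of a coefficient vanishing at `0` has `n ≥ p_{j,α}`, hence
-- `d_{j,α} ≤ n (σ₀ - 1)`: the power of `l` lost by leaving the Newton polygon is at most this.
theorem weight_le_weightSum_mul_rpow {p : ℕ × ℕ} (hp : p ∈ I m) (hc : AnalyticAt ℂ (c p) 0)
    {n : ℕ} (hn : taylorCoeff (c p) n ≠ 0) {k : ℕ} (hk : 1 ≤ k) (l : ℕ) :
    weight p k l ≤ weightSum m c k l * ((l : ℝ) + 1) ^ (n * (sigma0 m c - 1)) := by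
  classical
  have σ_nonneg : 0 ≤ sigma0 m c - 1 := sub_nonneg.2 one_le_sigma0
  have one_le_l : (1 : ℝ) ≤ (l : ℝ) + 1 := le_add_of_nonneg_left l.cast_nonneg
  by_cases h0 : c p 0 = 0
  · obtain ⟨order_ne_top, order_le⟩ :=
      analyticOrderAt_ne_top_and_analyticOrderNatAt_le hc hn
    have dist_le : dist m c p ≤ n * (sigma0 m c - 1) :=
      (dist_le_order_mul ⟨hp, h0, order_ne_top⟩ hc).trans (by gcongr)
    calc weight p k l
        = (k : ℝ) ^ p.1 * ((l : ℝ) + 1) ^ ((p.2 : ℝ) - dist m c p) *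
            ((l : ℝ) + 1) ^ dist m c p := by
          rw [mul_assoc, ← Real.rpow_add (by positivity), sub_add_cancel, Real.rpow_natCast, weight]
      _ ≤ _ := mul_le_mul (rpow_sub_dist_le_weightSum hp hk l)
          (Real.rpow_le_rpow_of_exponent_le one_le_l dist_le) (by positivity)
          (weightSum_pos hk l).le
  · have mem : p ∈ Lam0 m c := Finset.mem_insert_of_mem (Finset.mem_filter.2 ⟨hp, h0⟩)
    exact (weight_le_weightSum mem k l).trans
      (le_mul_of_one_le_right (weightSum_pos hk l).le (Real.one_le_rpow one_le_l (by positivity)))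

theorem rpow_mul_factorial_rpow_le {η : ℝ} (hη : 0 ≤ η) (l n : ℕ) :
    ((l : ℝ) + 1) ^ (n * η) * (l ! : ℝ) ^ η ≤ ((l + n)! : ℝ) ^ η := by
  rw [Real.rpow_mul (by positivity), Real.rpow_natCast,
    ← Real.mul_rpow (by positivity) (by positivity), mul_comm]
  exact Real.rpow_le_rpow (by positivity)
    (by exact_mod_cast Nat.factorial_mul_pow_le_factorial) hη

theorem pow_mul_descFactorial_le_weightSum {p : ℕ × ℕ} (hp : p ∈ I m)
    (hc : AnalyticAt ℂ (c p) 0) {n : ℕ} (hn : taylorCoeff (c p) n ≠ 0) {k : ℕ} (hk : 1 ≤ k)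
    (l : ℕ) :
    (k : ℝ) ^ p.1 * (l.descFactorial p.2 : ℝ) * (l ! : ℝ) ^ (sigma0 m c - 1) ≤
      weightSum m c k (l + n) * ((l + n)! : ℝ) ^ (sigma0 m c - 1) := by
  have : 0 < weightSum m c k l := weightSum_pos hk l
  calc (k : ℝ) ^ p.1 * (l.descFactorial p.2 : ℝ) * (l ! : ℝ) ^ (sigma0 m c - 1)
      ≤ (weightSum m c k l * ((l : ℝ) + 1) ^ (n * (sigma0 m c - 1))) *
          (l ! : ℝ) ^ (sigma0 m c - 1) := by
        refine mul_le_mul_of_nonneg_right ?_ (by positivity)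
        exact (pow_mul_descFactorial_le_weight p k l).trans
          (weight_le_weightSum_mul_rpow hp hc hn hk l)
    _ = weightSum m c k l *
          (((l : ℝ) + 1) ^ (n * (sigma0 m c - 1)) * (l ! : ℝ) ^ (sigma0 m c - 1)) := by ring
    _ ≤ weightSum m c k (l + n) * ((l + n)! : ℝ) ^ (sigma0 m c - 1) :=
        mul_le_mul (weightSum_mono k (Nat.le_add_right _ _))
          (rpow_mul_factorial_rpow_le (sub_nonneg.2 one_le_sigma0) l n) (by positivity)
          (weightSum_pos hk _).le

end Irregularity

/-! ### Growth of products and derivatives -/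

/-- The weight bounding the coefficient of `t^k x^l` in a series divisible by `t^q`: `N` powers of
`k` are gained and `e` powers are lost. The index `D * (4 * k - q)` of the binomial weight is
additive in `(k, q)`, so these weights are compatible with Cauchy products, and decreasing `q` by
one leaves room for a derivative of order at most `D`. -/
noncomputable def seriesWeight (D N : ℕ) (τ η : ℝ) (q : ℕ) (e : ℝ) (k l : ℕ) : ℝ :=
  (k : ℝ) ^ (e - N) * ((k - q + 1)! : ℝ) ^ τ * (l ! : ℝ) ^ η *
    (Nat.multichoose (D * (4 * k - q)) l : ℝ)

/-- `f` is divisible by `t^q` and its coefficients are bounded by `K` times the weights, uniformly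
under multiplication by `x^μ`, where `θ μ` is the loss of powers of `k` caused by `x^μ f`. -/
def SeriesBound (D N : ℕ) (τ η r β : ℝ) (θ : ℕ → ℝ) (K : ℝ) (q : ℕ) (f : FormalTX) : Prop :=
  (∀ k l, k < q → cf f k l = 0) ∧ ∀ k l μ, q ≤ k →
    ‖cf f k l‖ * r ^ l * β ^ k ≤ K * seriesWeight D N τ η q (θ μ) k (l + μ)

theorem seriesWeight_nonneg (D N : ℕ) (τ η : ℝ) (q : ℕ) (e : ℝ) (k l : ℕ) :
    0 ≤ seriesWeight D N τ η q e k l := by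
  unfold seriesWeight
  positivity

theorem factorial_rpow_mul_factorial_rpow_le {η : ℝ} (hη : 0 ≤ η) {a b c : ℕ}
    (h : a ! * b ! ≤ c !) : (a ! : ℝ) ^ η * (b ! : ℝ) ^ η ≤ (c ! : ℝ) ^ η := by
  rw [← Real.mul_rpow (by positivity) (by positivity)]
  exact Real.rpow_le_rpow (by positivity) (by exact_mod_cast h) hη

theorem sum_antidiagonal_mul_le {η A₁ A₂ : ℝ} (hη : 0 ≤ η) (hA₁ : 0 ≤ A₁) (hA₂ : 0 ≤ A₂)
    {E₁ E₂ μ : ℕ} {F₁ F₂ : ℕ → ℝ} (hF₂ : ∀ l, 0 ≤ F₂ l)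
    (h₁ : ∀ l, F₁ l ≤ A₁ * ((l + μ)! : ℝ) ^ η * (Nat.multichoose E₁ (l + μ) : ℝ))
    (h₂ : ∀ l, F₂ l ≤ A₂ * (l ! : ℝ) ^ η * (Nat.multichoose E₂ l : ℝ)) (l : ℕ) :
    ∑ y ∈ antidiagonal l, F₁ y.1 * F₂ y.2 ≤
      A₁ * A₂ * ((l + μ)! : ℝ) ^ η * (Nat.multichoose (E₁ + E₂) (l + μ) : ℝ) := by
  have term_le : ∀ y ∈ antidiagonal l, F₁ y.1 * F₂ y.2 ≤ A₁ * A₂ * ((l + μ)! : ℝ) ^ η *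
      ((Nat.multichoose E₁ (y.1 + μ) * Nat.multichoose E₂ y.2 : ℕ) : ℝ) := by
    intro y hy
    have hfac : ((y.1 + μ)! : ℝ) ^ η * (y.2 ! : ℝ) ^ η ≤ ((l + μ)! : ℝ) ^ η := by
      rw [← Finset.HasAntidiagonal.mem_antidiagonal.1 hy, add_right_comm]
      exact factorial_rpow_mul_factorial_rpow_le hη (factorial_mul_factorial_le_add _ _)
    calc F₁ y.1 * F₂ y.2
        ≤ (A₁ * ((y.1 + μ)! : ℝ) ^ η * (Nat.multichoose E₁ (y.1 + μ) : ℝ)) *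
          (A₂ * (y.2 ! : ℝ) ^ η * (Nat.multichoose E₂ y.2 : ℝ)) :=
          mul_le_mul (h₁ _) (h₂ _) (hF₂ _) (by positivity)
      _ = A₁ * A₂ * (((y.1 + μ)! : ℝ) ^ η * (y.2 ! : ℝ) ^ η) *
          ((Nat.multichoose E₁ (y.1 + μ) * Nat.multichoose E₂ y.2 : ℕ) : ℝ) := by
          push_cast; ring
      _ ≤ _ := by gcongr
  refine (Finset.sum_le_sum term_le).trans ?_
  rw [← Finset.mul_sum, ← Nat.cast_sum]
  gcongr
  exact sum_antidiagonal_multichoose_add_le E₁ E₂ l μ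

theorem rpow_mul_rpow_le {k₁ k₂ : ℕ} (h2 : 1 ≤ k₂) (hle : k₂ ≤ k₁) {N : ℕ} {a b : ℝ}
    (ha : 0 ≤ a) (haN : a ≤ N) (hb : b + 2 ≤ N) :
    (k₁ : ℝ) ^ (a - N) * (k₂ : ℝ) ^ (b - N) ≤
      2 ^ N * ((k₁ + k₂ : ℕ) : ℝ) ^ (a - N) * ((k₂ : ℝ) ^ 2)⁻¹ := by
  have hk₂ : (1 : ℝ) ≤ k₂ := by exact_mod_cast h2
  have hk : (k₂ : ℝ) ≤ k₁ := by exact_mod_cast hle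
  have larger : (k₁ : ℝ) ^ (a - N) ≤ 2 ^ N * ((k₁ + k₂ : ℕ) : ℝ) ^ (a - N) := by
    calc (k₁ : ℝ) ^ (a - N) ≤ (((k₁ + k₂ : ℕ) : ℝ) / 2) ^ (a - N) := by
          refine Real.rpow_le_rpow_of_nonpos ?_ ?_ (by linarith) <;> push_cast <;> linarith
      _ = (2 : ℝ) ^ (N - a) * ((k₁ + k₂ : ℕ) : ℝ) ^ (a - N) := by
          rw [Real.div_rpow (by positivity) (by norm_num), div_eq_mul_inv,
            ← Real.rpow_neg (by norm_num), neg_sub, mul_comm]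
      _ ≤ _ := by
          gcongr
          rw [← Real.rpow_natCast]
          exact Real.rpow_le_rpow_of_exponent_le (by norm_num) (by linarith)
  have smaller : (k₂ : ℝ) ^ (b - N) ≤ ((k₂ : ℝ) ^ 2)⁻¹ := by
    rw [← Real.rpow_natCast, ← Real.rpow_neg (by positivity)]
    refine Real.rpow_le_rpow_of_exponent_le hk₂ ?_
    push_cast
    linarith
  exact mul_le_mul larger smaller (by positivity) (by positivity)

section

variable {D N : ℕ} {τ η r β K₁ K₂ : ℝ} {θ : ℕ → ℝ} {q₁ q₂ : ℕ} {f g : FormalTX}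

-- The factor with the larger exponent of `t` absorbs the multiplication by `x ^ μ`.
theorem SeriesBound.sum_antidiagonal_le (hτ : 0 ≤ τ) (hη : 0 ≤ η) (hr : 0 ≤ r) (hβ : 0 ≤ β)
    (hθ : ∀ μ, 0 ≤ θ μ) (hθN : ∀ μ, θ μ + 2 ≤ N) (hK₁ : 0 ≤ K₁) (hK₂ : 0 ≤ K₂) (hq₂ : 1 ≤ q₂)
    (hf : SeriesBound D N τ η r β θ K₁ q₁ f) (hg : SeriesBound D N τ η r β θ K₂ q₂ g)
    {k₁ k₂ : ℕ} (h₁ : q₁ ≤ k₁) (h₂ : q₂ ≤ k₂) (hle : k₂ ≤ k₁) (l μ : ℕ) :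
    ∑ y ∈ antidiagonal l,
        (‖cf f k₁ y.1‖ * r ^ y.1 * β ^ k₁) * (‖cf g k₂ y.2‖ * r ^ y.2 * β ^ k₂) ≤
      K₁ * K₂ * 2 ^ N * seriesWeight D N τ η (q₁ + q₂) (θ μ) (k₁ + k₂) (l + μ) *
        ((k₂ : ℝ) ^ 2)⁻¹ := by
  have hpow := rpow_mul_rpow_le (hq₂.trans h₂) hle (hθ μ) (by linarith [hθN μ]) (hθN 0)
  have hfac : ((k₁ - q₁ + 1)! : ℝ) ^ τ * ((k₂ - q₂ + 1)! : ℝ) ^ τ ≤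
      ((k₁ + k₂ - (q₁ + q₂) + 1)! : ℝ) ^ τ := by
    rw [← tsub_add_tsub_comm h₁ h₂]
    exact factorial_rpow_mul_factorial_rpow_le hτ (succ_factorial_mul_succ_factorial_le _ _)
  have index_add : D * (4 * k₁ - q₁) + D * (4 * k₂ - q₂) = D * (4 * (k₁ + k₂) - (q₁ + q₂)) := by
    rw [← mul_add, tsub_add_tsub_comm (by omega) (by omega), ← mul_add]
  have hsum := sum_antidiagonal_mul_le hη
    (A₁ := K₁ * (k₁ : ℝ) ^ (θ μ - N) * ((k₁ - q₁ + 1)! : ℝ) ^ τ)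
    (A₂ := K₂ * (k₂ : ℝ) ^ (θ 0 - N) * ((k₂ - q₂ + 1)! : ℝ) ^ τ) (by positivity) (by positivity)
    (E₁ := D * (4 * k₁ - q₁)) (E₂ := D * (4 * k₂ - q₂)) (μ := μ)
    (F₁ := fun l => ‖cf f k₁ l‖ * r ^ l * β ^ k₁) (F₂ := fun l => ‖cf g k₂ l‖ * r ^ l * β ^ k₂)
    (fun l => by positivity)
    (fun l => (hf.2 k₁ l μ h₁).trans_eq (by rw [seriesWeight]; ring))
    (fun l => (hg.2 k₂ l 0 h₂).trans_eq (by rw [seriesWeight, add_zero]; ring)) l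
  refine hsum.trans ?_
  calc K₁ * (k₁ : ℝ) ^ (θ μ - N) * ((k₁ - q₁ + 1)! : ℝ) ^ τ *
        (K₂ * (k₂ : ℝ) ^ (θ 0 - N) * ((k₂ - q₂ + 1)! : ℝ) ^ τ) * ((l + μ)! : ℝ) ^ η *
        (Nat.multichoose (D * (4 * k₁ - q₁) + D * (4 * k₂ - q₂)) (l + μ) : ℝ)
      = K₁ * K₂ * ((k₁ : ℝ) ^ (θ μ - N) * (k₂ : ℝ) ^ (θ 0 - N)) *
        (((k₁ - q₁ + 1)! : ℝ) ^ τ * ((k₂ - q₂ + 1)! : ℝ) ^ τ) * ((l + μ)! : ℝ) ^ η *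
        (Nat.multichoose (D * (4 * (k₁ + k₂) - (q₁ + q₂))) (l + μ) : ℝ) := by
        rw [index_add]; ring
    _ ≤ K₁ * K₂ * (2 ^ N * ((k₁ + k₂ : ℕ) : ℝ) ^ (θ μ - N) * ((k₂ : ℝ) ^ 2)⁻¹) *
        ((k₁ + k₂ - (q₁ + q₂) + 1)! : ℝ) ^ τ * ((l + μ)! : ℝ) ^ η *
        (Nat.multichoose (D * (4 * (k₁ + k₂) - (q₁ + q₂))) (l + μ) : ℝ) := by gcongr
    _ = _ := by rw [seriesWeight]; ring

theorem SeriesBound.sum_antidiagonal_norm_mul_le (hτ : 0 ≤ τ) (hη : 0 ≤ η) (hr : 0 ≤ r)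
    (hβ : 0 ≤ β) (hθ : ∀ μ, 0 ≤ θ μ) (hθN : ∀ μ, θ μ + 2 ≤ N) (hK₁ : 0 ≤ K₁) (hK₂ : 0 ≤ K₂)
    (hq₁ : 1 ≤ q₁) (hq₂ : 1 ≤ q₂) (hf : SeriesBound D N τ η r β θ K₁ q₁ f)
    (hg : SeriesBound D N τ η r β θ K₂ q₂ g) (k₁ k₂ l μ : ℕ) :
    ∑ y ∈ antidiagonal l, ‖cf f k₁ y.1 * cf g k₂ y.2‖ * r ^ l * β ^ (k₁ + k₂) ≤
      K₁ * K₂ * 2 ^ N * seriesWeight D N τ η (q₁ + q₂) (θ μ) (k₁ + k₂) (l + μ) *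
        (((k₁ : ℝ) ^ 2)⁻¹ + ((k₂ : ℝ) ^ 2)⁻¹) := by
  have hW := seriesWeight_nonneg D N τ η (q₁ + q₂) (θ μ) (k₁ + k₂) (l + μ)
  by_cases hsmall : k₁ < q₁ ∨ k₂ < q₂
  · rw [Finset.sum_eq_zero fun y _ => by rcases hsmall with h | h <;> simp [hf.1, hg.1, h]]
    positivity
  push Not at hsmall
  obtain ⟨h₁, h₂⟩ := hsmall
  have split : ∑ y ∈ antidiagonal l, ‖cf f k₁ y.1 * cf g k₂ y.2‖ * r ^ l * β ^ (k₁ + k₂) =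
      ∑ y ∈ antidiagonal l,
        (‖cf f k₁ y.1‖ * r ^ y.1 * β ^ k₁) * (‖cf g k₂ y.2‖ * r ^ y.2 * β ^ k₂) := by
    refine Finset.sum_congr rfl fun y hy => ?_
    rw [← Finset.HasAntidiagonal.mem_antidiagonal.1 hy, norm_mul, pow_add, pow_add]
    ring
  rw [split, mul_add]
  rcases le_total k₂ k₁ with hle | hle
  · exact (hf.sum_antidiagonal_le hτ hη hr hβ hθ hθN hK₁ hK₂ hq₂ hg h₁ h₂ hle l μ).trans
      (le_add_of_nonneg_left (by positivity))
  · have hswap := hg.sum_antidiagonal_le hτ hη hr hβ hθ hθN hK₂ hK₁ hq₁ hf h₂ h₁ hle l μ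
    rw [← Finset.Nat.sum_antidiagonal_swap] at hswap
    simp only [Prod.fst_swap, Prod.snd_swap, mul_comm (‖cf g _ _‖ * _ * _)] at hswap
    rw [add_comm q₂, add_comm k₂, mul_comm K₂] at hswap
    exact hswap.trans (le_add_of_nonneg_right (by positivity))

theorem SeriesBound.mul (hτ : 0 ≤ τ) (hη : 0 ≤ η) (hr : 0 ≤ r) (hβ : 0 ≤ β)
    (hθ : ∀ μ, 0 ≤ θ μ) (hθN : ∀ μ, θ μ + 2 ≤ N) (hK₁ : 0 ≤ K₁) (hK₂ : 0 ≤ K₂)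
    (hq₁ : 1 ≤ q₁) (hq₂ : 1 ≤ q₂) (hf : SeriesBound D N τ η r β θ K₁ q₁ f)
    (hg : SeriesBound D N τ η r β θ K₂ q₂ g) :
    SeriesBound D N τ η r β θ (K₁ * K₂ * 2 ^ (N + 2)) (q₁ + q₂) (f * g) := by
  refine ⟨fun k l hk => ?_, fun k l μ _ => ?_⟩
  · rw [cf_mul]
    refine Finset.sum_eq_zero fun x hx => Finset.sum_eq_zero fun y _ => ?_
    rw [Finset.HasAntidiagonal.mem_antidiagonal] at hx
    rcases (by omega : x.1 < q₁ ∨ x.2 < q₂) with h | h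
    · rw [hf.1 _ _ h, zero_mul]
    · rw [hg.1 _ _ h, mul_zero]
  set W : ℝ := seriesWeight D N τ η (q₁ + q₂) (θ μ) k (l + μ) with hW
  have : 0 ≤ W := seriesWeight_nonneg ..
  calc ‖cf (f * g) k l‖ * r ^ l * β ^ k
      ≤ (∑ x ∈ antidiagonal k, ∑ y ∈ antidiagonal l, ‖cf f x.1 y.1 * cf g x.2 y.2‖) *
          r ^ l * β ^ k := by
        rw [cf_mul]
        gcongr
        exact norm_sum_le_of_le _ fun x _ => norm_sum_le _ _
    _ = ∑ x ∈ antidiagonal k, ∑ y ∈ antidiagonal l,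
          ‖cf f x.1 y.1 * cf g x.2 y.2‖ * r ^ l * β ^ k := by
        simp only [Finset.sum_mul]
    _ ≤ ∑ x ∈ antidiagonal k, K₁ * K₂ * 2 ^ N * W * (((x.1 : ℝ) ^ 2)⁻¹ + ((x.2 : ℝ) ^ 2)⁻¹) := by
        refine Finset.sum_le_sum fun x hx => ?_
        rw [hW, ← Finset.HasAntidiagonal.mem_antidiagonal.1 hx]
        exact hf.sum_antidiagonal_norm_mul_le hτ hη hr hβ hθ hθN hK₁ hK₂ hq₁ hq₂ hg _ _ l μ
    _ ≤ K₁ * K₂ * 2 ^ N * W * 4 := by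
        rw [← Finset.mul_sum]
        gcongr
        exact sum_antidiagonal_inv_sq_le k
    _ = K₁ * K₂ * 2 ^ (N + 2) * W := by ring

theorem seriesBound_jetProd (hτ : 0 ≤ τ) (hη : 0 ≤ η) (hr : 0 ≤ r) (hβ : 0 ≤ β)
    (hθ : ∀ μ, 0 ≤ θ μ) (hθN : ∀ μ, θ μ + 2 ≤ N) {Q : ℝ} (hQ : 0 ≤ Q) {u : FormalTX}
    {s : Multiset (ℕ × ℕ)} (hs : s ≠ 0)
    (h : ∀ p ∈ s, SeriesBound D N τ η r β θ ((2 ^ (N + 2))⁻¹ * Q) 1 (jet u p)) :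
    SeriesBound D N τ η r β θ ((2 ^ (N + 2))⁻¹ * Q ^ Multiset.card s) (Multiset.card s)
      (jetProd u s) := by
  induction s using Multiset.induction_on with
  | empty => exact absurd rfl hs
  | cons p s ih =>
    have head := h p (Multiset.mem_cons_self _ _)
    by_cases hs0 : s = 0
    · subst hs0
      simpa [jetProd] using head
    have tail := ih hs0 fun p' hp' => h p' (Multiset.mem_cons_of_mem hp')
    have product := SeriesBound.mul hτ hη hr hβ hθ hθN (by positivity) (by positivity) le_rfl
      (Multiset.card_pos.2 hs0) head tail
    rw [jetProd_cons, Multiset.card_cons, add_comm (Multiset.card s)]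
    convert product using 1
    rw [pow_add Q, pow_one]
    field_simp

end

theorem descFactorial_add_mul (l γ μ : ℕ) :
    (l + μ + γ).descFactorial (γ + μ) = (l + μ + γ).descFactorial γ * (l + μ).descFactorial μ := by
  rw [mul_comm, ← Nat.descFactorial_mul_descFactorial (Nat.le_add_right γ μ)]
  congr 2 <;> omega

theorem factorial_add_rpow_le {η : ℝ} (hη : 0 ≤ η) (l γ : ℕ) :
    ((l + γ)! : ℝ) ^ η ≤ (l ! : ℝ) ^ η * (((l + γ : ℕ) : ℝ) ^ γ) ^ η := by
  rw [← Real.mul_rpow (by positivity) (by positivity)]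
  refine Real.rpow_le_rpow (by positivity) ?_ hη
  have hfac := Nat.factorial_mul_descFactorial (Nat.le_add_left γ l)
  rw [Nat.add_sub_cancel] at hfac
  rw [← hfac]
  exact_mod_cast Nat.mul_le_mul_left _ (Nat.descFactorial_le_pow _ _)

theorem descFactorial_mul_factorial_rpow_le {η : ℝ} (hη : 0 ≤ η) {E : ℕ} (hE : 1 ≤ E)
    (γ μ l : ℕ) :
    ((l + μ + γ).descFactorial (γ + μ) : ℝ) * ((l + μ + γ)! : ℝ) ^ η ≤
      ((l + μ + γ).descFactorial γ : ℝ) * ((l + μ)! : ℝ) ^ η *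
        ((E + γ + (l + μ) : ℕ) : ℝ) ^ (γ * η + μ : ℝ) := by
  set n := l + μ with hn
  have hbase : (0 : ℝ) < ((E + γ + n : ℕ) : ℝ) := by exact_mod_cast (by omega)
  have hle : ((n + γ : ℕ) : ℝ) ≤ ((E + γ + n : ℕ) : ℝ) := by exact_mod_cast (by omega)
  have hdesc : (n.descFactorial μ : ℝ) ≤ ((E + γ + n : ℕ) : ℝ) ^ μ := by
    exact_mod_cast (Nat.descFactorial_le_pow _ _).trans (Nat.pow_le_pow_left (by omega) _)
  have hfac : ((n + γ)! : ℝ) ^ η ≤ (n ! : ℝ) ^ η * (((E + γ + n : ℕ) : ℝ) ^ γ) ^ η :=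
    (factorial_add_rpow_le hη n γ).trans (by gcongr)
  rw [Real.rpow_add hbase, Real.rpow_mul hbase.le, Real.rpow_natCast, Real.rpow_natCast]
  calc ((n + γ).descFactorial (γ + μ) : ℝ) * ((n + γ)! : ℝ) ^ η
      = ((n + γ).descFactorial γ : ℝ) * (n.descFactorial μ : ℝ) * ((n + γ)! : ℝ) ^ η := by
        rw [hn, descFactorial_add_mul, Nat.cast_mul]
    _ ≤ ((n + γ).descFactorial γ : ℝ) * ((E + γ + n : ℕ) : ℝ) ^ μ *
        ((n ! : ℝ) ^ η * (((E + γ + n : ℕ) : ℝ) ^ γ) ^ η) := by gcongr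
    _ = _ := by ring

theorem descFactorial_mul_multichoose_le {E γ : ℕ} {B : ℝ} (hB : (E : ℝ) ≤ B) (l : ℕ) :
    ((l + γ).descFactorial γ : ℝ) * (Nat.multichoose E (l + γ) : ℝ) ≤
      (γ ! : ℝ) * B ^ γ * (Nat.multichoose (E + γ) l : ℝ) := by
  have hasc : (E.ascFactorial γ : ℝ) ≤ (γ ! : ℝ) * (E : ℝ) ^ γ := by
    exact_mod_cast Nat.ascFactorial_le_factorial_mul_pow E γ
  have heq : ((l + γ).descFactorial γ : ℝ) * (Nat.multichoose E (l + γ) : ℝ) =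
      (E.ascFactorial γ : ℝ) * (Nat.multichoose (E + γ) l : ℝ) := by
    exact_mod_cast descFactorial_mul_multichoose E l γ
  rw [heq]
  gcongr
  exact hasc.trans (by gcongr)

/-- The constant factor lost by the weights under derivatives of order at most `D`. -/
noncomputable def derivLoss (D : ℕ) : ℝ := D ! * 2 * (4 * D) ^ D

theorem derivLoss_nonneg (D : ℕ) : 0 ≤ derivLoss D := by
  unfold derivLoss
  positivity

theorem pow_mul_rpow_le_pow_mul_rpow {b x q P : ℝ} {γ D : ℕ} (hb : 1 ≤ b) (hx : 0 < x)
    (hP : γ + q = P) (hPD : P ≤ D) : (b * x) ^ γ * (b * x) ^ q ≤ b ^ D * x ^ P := by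
  have hb0 : 0 < b := one_pos.trans_le hb
  rw [← Real.rpow_natCast, ← Real.rpow_add (mul_pos hb0 hx), hP, Real.mul_rpow hb0.le hx.le]
  gcongr
  rw [← Real.rpow_natCast]
  exact Real.rpow_le_rpow_of_exponent_le hb hPD

theorem descFactorial_mul_factorial_rpow_mul_multichoose_le {D E γ μ : ℕ} {η B : ℝ} (hη : 0 ≤ η)
    (hE : 1 ≤ E) (hB : ((E + D : ℕ) : ℝ) ≤ B) (hD : γ * (1 + η) + μ ≤ D) (l : ℕ) :
    ((l + μ + γ).descFactorial (γ + μ) : ℝ) * ((l + μ + γ)! : ℝ) ^ η *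
        (Nat.multichoose E (l + μ + γ) : ℝ) ≤
      (D ! : ℝ) * 2 * (B ^ γ * B ^ (γ * η + μ : ℝ)) * ((l + μ)! : ℝ) ^ η *
        (Nat.multichoose (E + D) (l + μ) : ℝ) := by
  set q : ℝ := γ * η + μ
  have hq0 : 0 ≤ q := by positivity
  have hEB : (E : ℝ) ≤ B := le_trans (by exact_mod_cast Nat.le_add_right E D) hB
  have hB0 : 0 ≤ B := E.cast_nonneg.trans hEB
  have hγD : γ ≤ D := by
    have : (γ : ℝ) ≤ D := by linarith
    exact_mod_cast this
  have hqD : q ≤ ((D - γ : ℕ) : ℝ) := by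
    rw [Nat.cast_sub hγD]
    linarith
  have hmulti : ((E + γ + (l + μ) : ℕ) : ℝ) ^ q * (Nat.multichoose (E + γ) (l + μ) : ℝ) ≤
      2 * B ^ q * (Nat.multichoose (E + D) (l + μ) : ℝ) := by
    have h := rpow_mul_multichoose_le (E := E + γ) (by omega) hq0 hqD (l + μ)
    rw [add_assoc E γ (D - γ), Nat.add_sub_cancel' hγD] at h
    exact h.trans (by gcongr)
  calc ((l + μ + γ).descFactorial (γ + μ) : ℝ) * ((l + μ + γ)! : ℝ) ^ η *
        (Nat.multichoose E (l + μ + γ) : ℝ)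
      ≤ ((l + μ + γ).descFactorial γ : ℝ) * ((l + μ)! : ℝ) ^ η *
        ((E + γ + (l + μ) : ℕ) : ℝ) ^ q * (Nat.multichoose E (l + μ + γ) : ℝ) :=
        mul_le_mul_of_nonneg_right (descFactorial_mul_factorial_rpow_le hη hE γ μ l)
          (by positivity)
    _ = ((l + μ)! : ℝ) ^ η * ((E + γ + (l + μ) : ℕ) : ℝ) ^ q *
        (((l + μ + γ).descFactorial γ : ℝ) * (Nat.multichoose E (l + μ + γ) : ℝ)) := by ring
    _ ≤ ((l + μ)! : ℝ) ^ η * ((E + γ + (l + μ) : ℕ) : ℝ) ^ q *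
        ((γ ! : ℝ) * B ^ γ * (Nat.multichoose (E + γ) (l + μ) : ℝ)) :=
        mul_le_mul_of_nonneg_left (descFactorial_mul_multichoose_le hEB _) (by positivity)
    _ = ((l + μ)! : ℝ) ^ η * (γ ! : ℝ) * B ^ γ *
        (((E + γ + (l + μ) : ℕ) : ℝ) ^ q * (Nat.multichoose (E + γ) (l + μ) : ℝ)) := by ring
    _ ≤ ((l + μ)! : ℝ) ^ η * (D ! : ℝ) * B ^ γ *
        (2 * B ^ q * (Nat.multichoose (E + D) (l + μ) : ℝ)) := by gcongr
    _ = _ := by ring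

theorem descFactorial_weight_le {D : ℕ} {η : ℝ} (hη : 0 ≤ η) {γ μ l k : ℕ} (hk : 1 ≤ k)
    (hD : γ * (1 + η) + μ ≤ D) (hD1 : 1 ≤ D) :
    ((l + μ + γ).descFactorial (γ + μ) : ℝ) * ((l + μ + γ)! : ℝ) ^ η *
        (Nat.multichoose (D * (4 * k - 2)) (l + μ + γ) : ℝ) ≤
      derivLoss D * (k : ℝ) ^ (γ * (1 + η) + μ) * ((l + μ)! : ℝ) ^ η *
        (Nat.multichoose (D * (4 * k - 1)) (l + μ) : ℝ) := by
  set B : ℝ := 4 * D * k with hB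
  have hE1 : 1 ≤ D * (4 * k - 2) := Nat.mul_pos hD1 (by omega)
  have hED : D * (4 * k - 2) + D = D * (4 * k - 1) := by
    rw [← Nat.mul_succ]
    congr 1
    omega
  have hEDB : ((D * (4 * k - 2) + D : ℕ) : ℝ) ≤ B := by
    have : D * (4 * k - 1) ≤ 4 * D * k :=
      (Nat.mul_le_mul_left D (Nat.sub_le (4 * k) 1)).trans_eq (by ring)
    rw [hED, hB]
    exact_mod_cast this
  have hpow : B ^ γ * B ^ (γ * η + μ : ℝ) ≤
      (4 * D : ℝ) ^ D * (k : ℝ) ^ (γ * (1 + η) + μ) := by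
    have : (1 : ℝ) ≤ D := by exact_mod_cast hD1
    exact pow_mul_rpow_le_pow_mul_rpow (by linarith) (by exact_mod_cast hk) (by ring) hD
  refine (descFactorial_mul_factorial_rpow_mul_multichoose_le hη hE1 hEDB hD l).trans ?_
  rw [hED, derivLoss, mul_assoc (_ * 2) (_ ^ D)]
  gcongr

theorem descFactorial_weight_shift_le {D : ℕ} {η : ℝ} (hη : 0 ≤ η) {α l k : ℕ} (μ : ℕ) (hk : 1 ≤ k)
    (hD : α * (1 + η) ≤ D) (hD1 : 1 ≤ D) :
    ((l + α).descFactorial α : ℝ) * ((l + α)! : ℝ) ^ η *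
        (Nat.multichoose (D * (4 * k - 2)) (l + α) : ℝ) ≤
      derivLoss D * (k : ℝ) ^ max (α : ℝ) (μ + (1 + η) * ((α : ℝ) - μ)) *
        ((l + μ)! : ℝ) ^ η * (Nat.multichoose (D * (4 * k - 1)) (l + μ) : ℝ) := by
  have hk1 : (1 : ℝ) ≤ k := by exact_mod_cast hk
  have : 0 ≤ derivLoss D := derivLoss_nonneg D
  rcases le_total μ α with h | h
  · obtain ⟨γ, rfl⟩ := Nat.exists_eq_add_of_le h
    have hμη : (0 : ℝ) ≤ μ * η := by positivity
    push_cast at hD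
    rw [show l + (μ + γ) = l + μ + γ by ring, add_comm μ γ]
    refine (descFactorial_weight_le hη hk (by linarith) hD1).trans ?_
    gcongr
    refine le_trans (le_of_eq ?_) (le_max_right _ _)
    push_cast
    ring
  · have hαη : (0 : ℝ) ≤ α * η := by positivity
    have hshift := descFactorial_weight_le hη (l := l) (γ := 0) (μ := α) hk (D := D)
      (by push_cast; linarith) hD1
    simp only [add_zero, zero_add, Nat.cast_zero, zero_mul] at hshift
    have hE : 1 ≤ D * (4 * k - 1) := Nat.mul_pos hD1 (by omega)
    refine hshift.trans ?_
    gcongr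
    · exact le_max_left _ _
    · exact multichoose_mono_right hE (by omega)

/-- The majorant for the coefficients of the solution. The factor `k^(-N)` makes it stable under
convolution in `k`, and the binomial factor makes it stable under convolution in `l`. -/
noncomputable def major (D N : ℕ) (τ η : ℝ) (k l : ℕ) : ℝ :=
  ((k : ℝ) ^ N)⁻¹ * (k ! : ℝ) ^ τ * (l ! : ℝ) ^ η * (Nat.multichoose (D * (4 * k - 2)) l : ℝ)

theorem descFactorial_mul_major_le {D N : ℕ} {τ η : ℝ} {θ : ℕ → ℝ} (hη : 0 ≤ η) (hD1 : 1 ≤ D)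
    {p : ℕ × ℕ} (hD : p.2 * (1 + η) ≤ D)
    (hθ : ∀ μ : ℕ, (p.1 : ℝ) + max (p.2 : ℝ) (μ + (1 + η) * ((p.2 : ℝ) - μ)) ≤ θ μ)
    {k : ℕ} (hk : 1 ≤ k) (l μ : ℕ) :
    (k : ℝ) ^ p.1 * ((l + p.2).descFactorial p.2 : ℝ) * major D N τ η k (l + p.2) ≤
      derivLoss D * seriesWeight D N τ η 1 (θ μ) k (l + μ) := by
  have hk1 : (1 : ℝ) ≤ k := by exact_mod_cast hk
  have hk0 : (0 : ℝ) < k := by linarith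
  have : 0 ≤ derivLoss D := derivLoss_nonneg D
  set e : ℝ := max (p.2 : ℝ) (μ + (1 + η) * ((p.2 : ℝ) - μ))
  set b : ℝ := (Nat.multichoose (D * (4 * k - 1)) (l + μ) : ℝ)
  have hpow : (k : ℝ) ^ p.1 * ((k : ℝ) ^ N)⁻¹ * (k : ℝ) ^ e ≤ (k : ℝ) ^ (θ μ - N) := by
    rw [← Real.rpow_natCast, ← Real.rpow_natCast, ← Real.rpow_neg hk0.le, ← Real.rpow_add hk0,
      ← Real.rpow_add hk0]
    exact Real.rpow_le_rpow_of_exponent_le hk1 (by linarith [hθ μ])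
  calc (k : ℝ) ^ p.1 * ((l + p.2).descFactorial p.2 : ℝ) * major D N τ η k (l + p.2)
      = (k : ℝ) ^ p.1 * ((k : ℝ) ^ N)⁻¹ * (k ! : ℝ) ^ τ *
        (((l + p.2).descFactorial p.2 : ℝ) * ((l + p.2)! : ℝ) ^ η *
        (Nat.multichoose (D * (4 * k - 2)) (l + p.2) : ℝ)) := by rw [major]; ring
    _ ≤ (k : ℝ) ^ p.1 * ((k : ℝ) ^ N)⁻¹ * (k ! : ℝ) ^ τ *
        (derivLoss D * (k : ℝ) ^ e * ((l + μ)! : ℝ) ^ η * b) :=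
        mul_le_mul_of_nonneg_left (descFactorial_weight_shift_le hη μ hk hD hD1) (by positivity)
    _ = derivLoss D * (((k : ℝ) ^ p.1 * ((k : ℝ) ^ N)⁻¹ * (k : ℝ) ^ e) * (k ! : ℝ) ^ τ *
        ((l + μ)! : ℝ) ^ η * b) := by ring
    _ ≤ derivLoss D * ((k : ℝ) ^ (θ μ - N) * (k ! : ℝ) ^ τ * ((l + μ)! : ℝ) ^ η * b) := by gcongr
    _ = _ := by rw [seriesWeight, Nat.sub_add_cancel hk]

theorem seriesBound_jet {D N : ℕ} {τ η r β A : ℝ} {θ : ℕ → ℝ} (hη : 0 ≤ η) (hr : 0 < r)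
    (hr1 : r ≤ 1) (hβ : 0 ≤ β) (hA : 0 ≤ A) (hD1 : 1 ≤ D) {u : FormalTX} (hu0 : ∀ l, cf u 0 l = 0)
    (hu : ∀ k l, 1 ≤ k → ‖cf u k l‖ * r ^ l * β ^ k ≤ A * major D N τ η k l) {p : ℕ × ℕ}
    (hD : p.2 * (1 + η) ≤ D)
    (hθ : ∀ μ : ℕ, (p.1 : ℝ) + max (p.2 : ℝ) (μ + (1 + η) * ((p.2 : ℝ) - μ)) ≤ θ μ) :
    SeriesBound D N τ η r β θ (A * (derivLoss D * (r ^ D)⁻¹)) 1 (jet u p) := by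
  refine ⟨fun k l hk => ?_, fun k l μ hk => ?_⟩
  · obtain rfl : k = 0 := by omega
    rw [cf_jet, hu0, mul_zero]
  have hpD : p.2 ≤ D := by
    have : (p.2 : ℝ) ≤ p.2 * (1 + η) := le_mul_of_one_le_right (by positivity) (by linarith)
    exact_mod_cast this.trans hD
  have hrpow : r ^ l ≤ (r ^ D)⁻¹ * r ^ (l + p.2) := by
    rw [inv_mul_eq_div, le_div_iff₀ (pow_pos hr D), pow_add]
    exact mul_le_mul_of_nonneg_left (pow_le_pow_of_le_one hr.le hr1 hpD) (by positivity)
  rw [cf_jet, norm_mul, norm_mul, norm_pow, Complex.norm_natCast, Complex.norm_natCast]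
  calc (k : ℝ) ^ p.1 * ((l + p.2).descFactorial p.2 : ℝ) * ‖cf u k (l + p.2)‖ * r ^ l * β ^ k
      ≤ (k : ℝ) ^ p.1 * ((l + p.2).descFactorial p.2 : ℝ) * ‖cf u k (l + p.2)‖ *
        ((r ^ D)⁻¹ * r ^ (l + p.2)) * β ^ k := by gcongr
    _ = (k : ℝ) ^ p.1 * ((l + p.2).descFactorial p.2 : ℝ) * (r ^ D)⁻¹ *
        (‖cf u k (l + p.2)‖ * r ^ (l + p.2) * β ^ k) := by ring
    _ ≤ (k : ℝ) ^ p.1 * ((l + p.2).descFactorial p.2 : ℝ) * (r ^ D)⁻¹ *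
        (A * major D N τ η k (l + p.2)) :=
        mul_le_mul_of_nonneg_left (hu k (l + p.2) hk) (by positivity)
    _ = A * (r ^ D)⁻¹ * ((k : ℝ) ^ p.1 * ((l + p.2).descFactorial p.2 : ℝ) *
        major D N τ η k (l + p.2)) := by ring
    _ ≤ A * (r ^ D)⁻¹ * (derivLoss D * seriesWeight D N τ η 1 (θ μ) k (l + μ)) :=
        mul_le_mul_of_nonneg_left (descFactorial_mul_major_le hη hD1 hD hθ hk l μ) (by positivity)
    _ = _ := by ring

/-! ### Growth of the monomials in the jet -/

section

variable {M : Finset (ℕ × ℕ)}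

theorem le_mNu {σ : ℝ} {ν : M →₀ ℕ} {q : M} (hq : 0 < ν q) (μ : ℕ) :
    (q.1.1 : ℝ) + max (q.1.2 : ℝ) (μ + σ * ((q.1.2 : ℝ) - μ)) ≤ mNu σ ν μ :=
  le_csSup (Set.toFinite _).bddAbove ⟨q, hq, rfl⟩

theorem mNu_le {σ B : ℝ} (hσ : 1 ≤ σ) {ν : M →₀ ℕ} (hν : ν ≠ 0) (μ : ℕ)
    (hB : ∀ p ∈ M, (p.1 : ℝ) + σ * p.2 ≤ B) : mNu σ ν μ ≤ B := by
  obtain ⟨q, hq⟩ := DFunLike.ne_iff.1 hν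
  refine csSup_le ⟨_, q, Nat.pos_of_ne_zero hq, rfl⟩ ?_
  rintro _ ⟨p, _, rfl⟩
  have : (0 : ℝ) ≤ p.1.2 := by positivity
  have : (0 : ℝ) ≤ μ := by positivity
  have : max (p.1.2 : ℝ) (μ + σ * ((p.1.2 : ℝ) - μ)) ≤ σ * p.1.2 :=
    max_le (by nlinarith) (by nlinarith)
  linarith [hB p p.2]

theorem mNu_nonneg {σ : ℝ} {ν : M →₀ ℕ} (hν : ν ≠ 0) (μ : ℕ) : 0 ≤ mNu σ ν μ := by
  obtain ⟨q, hq⟩ := DFunLike.ne_iff.1 hν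
  refine le_trans ?_ (le_mNu (Nat.pos_of_ne_zero hq) μ)
  exact add_nonneg (by positivity) (le_max_of_le_left (by positivity))

theorem pow_le_factorial_mul_exp (k N : ℕ) : (k : ℝ) ^ N ≤ N ! * Real.exp k := by
  have := Real.pow_div_factorial_le_exp (x := k) (by positivity) N
  rwa [div_le_iff₀ (by positivity), mul_comm] at this

theorem major_nonneg (D N : ℕ) (τ η : ℝ) (k l : ℕ) : 0 ≤ major D N τ η k l := by
  unfold major
  positivity

theorem inv_pow_le_major {D N : ℕ} {τ η : ℝ} (hτ : 0 ≤ τ) (hη : 0 ≤ η) (hD : 1 ≤ D) {k : ℕ}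
    (hk : 1 ≤ k) (l : ℕ) : ((k : ℝ) ^ N)⁻¹ ≤ major D N τ η k l := by
  have hk! : (1 : ℝ) ≤ (k ! : ℝ) ^ τ :=
    Real.one_le_rpow (by exact_mod_cast Nat.factorial_pos k) hτ
  have hl! : (1 : ℝ) ≤ (l ! : ℝ) ^ η :=
    Real.one_le_rpow (by exact_mod_cast Nat.factorial_pos l) hη
  have hmulti : (1 : ℝ) ≤ (Nat.multichoose (D * (4 * k - 2)) l : ℝ) := by
    exact_mod_cast one_le_multichoose (Nat.mul_pos hD (by omega)) l
  unfold major
  calc ((k : ℝ) ^ N)⁻¹ = ((k : ℝ) ^ N)⁻¹ * 1 * 1 * 1 := by ring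
    _ ≤ _ := by gcongr

theorem rpow_mul_factorial_sub_rpow_le {k n m : ℕ} {τ e : ℝ} (hτ : 0 ≤ τ) (hn : 1 ≤ n)
    (hnk : n ≤ k) (he : e - m ≤ τ * ((n : ℝ) - 1)) :
    (k : ℝ) ^ e * ((k - (n - 1))! : ℝ) ^ τ ≤ (k : ℝ) ^ m * (k ! : ℝ) ^ τ * Real.exp τ ^ n := by
  have hk1 : (1 : ℝ) ≤ k := by exact_mod_cast hn.trans hnk
  have hk0 : (0 : ℝ) < k := by linarith
  have hpow : (k : ℝ) ^ e ≤ (k : ℝ) ^ m * ((k : ℝ) ^ (n - 1)) ^ τ := by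
    rw [← Real.rpow_natCast, ← Real.rpow_natCast (k : ℝ) (n - 1), ← Real.rpow_mul hk0.le,
      ← Real.rpow_add hk0, Nat.cast_sub hn]
    refine Real.rpow_le_rpow_of_exponent_le hk1 ?_
    push_cast
    linarith
  have hexp : Real.exp 1 ^ (n - 1) ≤ Real.exp 1 ^ n :=
    pow_le_pow_right₀ (Real.one_le_exp zero_le_one) (Nat.sub_le n 1)
  have hfac : ((k : ℝ) ^ (n - 1)) ^ τ * ((k - (n - 1))! : ℝ) ^ τ ≤
      Real.exp τ ^ n * (k ! : ℝ) ^ τ := by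
    calc ((k : ℝ) ^ (n - 1)) ^ τ * ((k - (n - 1))! : ℝ) ^ τ
        = ((k : ℝ) ^ (n - 1) * ((k - (n - 1))! : ℝ)) ^ τ :=
          (Real.mul_rpow (by positivity) (by positivity)).symm
      _ ≤ (Real.exp 1 ^ n * (k ! : ℝ)) ^ τ := by
          refine Real.rpow_le_rpow (by positivity) ?_ hτ
          exact (pow_mul_factorial_sub_le (by omega)).trans (by gcongr)
      _ = Real.exp τ ^ n * (k ! : ℝ) ^ τ := by
          rw [Real.mul_rpow (by positivity) (by positivity), ← Real.exp_nat_mul, ← Real.exp_mul,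
            ← Real.exp_nat_mul, mul_one]
  calc (k : ℝ) ^ e * ((k - (n - 1))! : ℝ) ^ τ
      ≤ ((k : ℝ) ^ m * ((k : ℝ) ^ (n - 1)) ^ τ) * ((k - (n - 1))! : ℝ) ^ τ := by gcongr
    _ = (k : ℝ) ^ m * (((k : ℝ) ^ (n - 1)) ^ τ * ((k - (n - 1))! : ℝ) ^ τ) := by ring
    _ ≤ (k : ℝ) ^ m * (Real.exp τ ^ n * (k ! : ℝ) ^ τ) := by gcongr
    _ = _ := by ring

theorem rpow_sub_le_rpow_add_sub {k i N : ℕ} (hk : 1 ≤ k) {e : ℝ} (he0 : 0 ≤ e) (heN : e ≤ N) :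
    (k : ℝ) ^ (e - N) ≤ N ! * Real.exp (1 + i) * ((k + i : ℕ) : ℝ) ^ (e - N) := by
  have hk1 : (1 : ℝ) ≤ k := by exact_mod_cast hk
  have : (0 : ℝ) ≤ i := by positivity
  have hpos : (0 : ℝ) < ((k + i : ℕ) : ℝ) / (1 + i : ℝ) := by push_cast; positivity
  have hle : ((k + i : ℕ) : ℝ) / (1 + i : ℝ) ≤ k := by
    rw [div_le_iff₀ (by positivity)]
    push_cast
    nlinarith
  have hexp : (1 + i : ℝ) ^ (N - e) ≤ N ! * Real.exp (1 + i) := by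
    have h := pow_le_factorial_mul_exp (1 + i) N
    push_cast at h
    refine le_trans ?_ h
    rw [← Real.rpow_natCast]
    exact Real.rpow_le_rpow_of_exponent_le (by linarith) (by linarith)
  calc (k : ℝ) ^ (e - N) ≤ (((k + i : ℕ) : ℝ) / (1 + i : ℝ)) ^ (e - N) :=
        Real.rpow_le_rpow_of_nonpos hpos hle (by linarith)
    _ = (1 + i : ℝ) ^ (N - e) * ((k + i : ℕ) : ℝ) ^ (e - N) := by
        rw [Real.div_rpow (by positivity) (by positivity), div_eq_mul_inv,
          ← Real.rpow_neg (by positivity), neg_sub, mul_comm]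
    _ ≤ _ := by gcongr

-- The hypothesis on `e - m` is the slope condition defining `s₀ = 1 + τ`: the derivatives in a
-- monomial of degree `q` in the jet lose `e` powers of `k`, of which the `i + q - 1` steps from
-- `(k - q + 1)!` to `(k + i)!` recover all but `m`.
theorem seriesWeight_le_pow_mul_major {D N m q i k : ℕ} {τ η e : ℝ} (hτ : 0 ≤ τ) (hq : 1 ≤ q)
    (hqk : q ≤ k) (hn : 2 ≤ i + q) (he0 : 0 ≤ e) (heN : e ≤ N)
    (he : e - m ≤ τ * ((i : ℝ) + q - 1)) (l : ℕ) :
    seriesWeight D N τ η q e k l ≤ N ! * Real.exp (1 + i) * Real.exp τ ^ (i + q) *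
      (((k + i : ℕ) : ℝ) ^ m * major D N τ η (k + i) l) := by
  have hpos : (0 : ℝ) < ((k + i : ℕ) : ℝ) := by exact_mod_cast (by omega)
  have hpow := rpow_sub_le_rpow_add_sub (i := i) (hq.trans hqk) he0 heN
  have hfac : ((k + i : ℕ) : ℝ) ^ (e - N) * ((k - q + 1)! : ℝ) ^ τ ≤
      (((k + i : ℕ) : ℝ) ^ N)⁻¹ *
        (((k + i : ℕ) : ℝ) ^ m * ((k + i)! : ℝ) ^ τ * Real.exp τ ^ (i + q)) := by
    have h := rpow_mul_factorial_sub_rpow_le (k := k + i) (n := i + q) (m := m) hτ (by omega)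
      (by omega) (by push_cast; exact he)
    rw [show k + i - (i + q - 1) = k - q + 1 by omega] at h
    rw [Real.rpow_sub hpos, Real.rpow_natCast, div_eq_inv_mul, mul_assoc]
    gcongr
  have hmulti : (Nat.multichoose (D * (4 * k - q)) l : ℝ) ≤
      (Nat.multichoose (D * (4 * (k + i) - 2)) l : ℝ) := by
    exact_mod_cast multichoose_mono_left (Nat.mul_le_mul_left _ (by omega)) _
  calc seriesWeight D N τ η q e k l
      ≤ N ! * Real.exp (1 + i) * ((k + i : ℕ) : ℝ) ^ (e - N) * ((k - q + 1)! : ℝ) ^ τ *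
        (l ! : ℝ) ^ η * (Nat.multichoose (D * (4 * (k + i) - 2)) l : ℝ) := by
        rw [seriesWeight]
        gcongr
    _ = N ! * Real.exp (1 + i) * (((k + i : ℕ) : ℝ) ^ (e - N) * ((k - q + 1)! : ℝ) ^ τ) *
        (l ! : ℝ) ^ η * (Nat.multichoose (D * (4 * (k + i) - 2)) l : ℝ) := by ring
    _ ≤ N ! * Real.exp (1 + i) * ((((k + i : ℕ) : ℝ) ^ N)⁻¹ *
        (((k + i : ℕ) : ℝ) ^ m * ((k + i)! : ℝ) ^ τ * Real.exp τ ^ (i + q))) *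
        (l ! : ℝ) ^ η * (Nat.multichoose (D * (4 * (k + i) - 2)) l : ℝ) := by gcongr
    _ = _ := by rw [major]; ring

/-- The factor that each jet component contributes to the bound of a monomial. -/
noncomputable def jetFactor (D N : ℕ) (r : ℝ) : ℝ := 2 ^ (N + 2) * (derivLoss D * (r ^ D)⁻¹)

/-- The growth constant of the monomials: a monomial of degree `n` in `t` and the jet is bounded
with the constant `(growth D N τ r * ε) ^ n`. -/
noncomputable def growth (D N : ℕ) (τ r : ℝ) : ℝ :=
  jetFactor D N r * (N ! * Real.exp 2 * Real.exp τ)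

theorem one_le_jetFactor (N : ℕ) {D : ℕ} {r : ℝ} (hD : 1 ≤ D) (hr : 0 < r) (hr1 : r ≤ 1) :
    1 ≤ jetFactor D N r := by
  have hD1 : (1 : ℝ) ≤ D := by exact_mod_cast hD
  have hfac : (1 : ℝ) ≤ D ! := by exact_mod_cast Nat.factorial_pos D
  have hloss : 1 ≤ derivLoss D :=
    one_le_mul_of_one_le_of_one_le (by linarith) (one_le_pow₀ (by linarith))
  exact one_le_mul_of_one_le_of_one_le (one_le_pow₀ one_le_two)
    (one_le_mul_of_one_le_of_one_le hloss
      ((one_le_inv₀ (pow_pos hr _)).2 (pow_le_one₀ hr.le hr1)))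

theorem growth_pos (N : ℕ) {D : ℕ} (τ : ℝ) {r : ℝ} (hD : 1 ≤ D) (hr : 0 < r) (hr1 : r ≤ 1) :
    0 < growth D N τ r := by
  have := one_le_jetFactor N hD hr hr1
  unfold growth
  positivity

theorem le_growth_mul_pow {D N i q j : ℕ} {τ r ε x : ℝ} (hτ : 0 ≤ τ) (hr : 0 < r) (hr1 : r ≤ 1)
    (hε : 0 < ε) (hε1 : ε ≤ 1) (hD : 1 ≤ D) (hiq : 1 ≤ i + q) (hx : x ≤ 2 * ((i + q : ℕ) : ℝ))
    (hj : j ≤ i + q) :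
    (ε * jetFactor D N r) ^ q * (N ! * Real.exp x) * Real.exp τ ^ j * (ε ^ 2) ^ i ≤
      (growth D N τ r * ε) ^ (i + q) := by
  have hε_pow : ε ^ q * (ε ^ 2) ^ i ≤ ε ^ (i + q) := by
    rw [← pow_mul, ← pow_add]
    exact pow_le_pow_of_le_one hε.le hε1 (by omega)
  have hjet := one_le_jetFactor N hD hr hr1
  have hjet_pow : jetFactor D N r ^ q ≤ jetFactor D N r ^ (i + q) :=
    pow_le_pow_right₀ hjet (Nat.le_add_left q i)
  have hfac : (N ! : ℝ) ≤ (N ! : ℝ) ^ (i + q) :=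
    le_self_pow₀ (by exact_mod_cast Nat.factorial_pos N) (by omega)
  have hexp : Real.exp x ≤ Real.exp 2 ^ (i + q) := by
    rw [← Real.exp_nat_mul]
    exact Real.exp_le_exp.2 (by linarith)
  have hexp_τ : Real.exp τ ^ j ≤ Real.exp τ ^ (i + q) := pow_le_pow_right₀ (Real.one_le_exp hτ) hj
  calc (ε * jetFactor D N r) ^ q * (N ! * Real.exp x) * Real.exp τ ^ j * (ε ^ 2) ^ i
      = (ε ^ q * (ε ^ 2) ^ i) * jetFactor D N r ^ q * (N ! * Real.exp x) * Real.exp τ ^ j := by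
        ring
    _ ≤ ε ^ (i + q) * jetFactor D N r ^ (i + q) * ((N ! : ℝ) ^ (i + q) * Real.exp 2 ^ (i + q)) *
        Real.exp τ ^ (i + q) := by gcongr
    _ = _ := by rw [growth]; ring

theorem pow_le_growth_mul_major {m D N i : ℕ} {τ η r ε : ℝ} (hτ : 0 ≤ τ) (hη : 0 ≤ η) (hr : 0 < r)
    (hr1 : r ≤ 1) (hε : 0 < ε) (hε1 : ε ≤ 1) (hD : 1 ≤ D) (hi : 1 ≤ i) (μ : ℕ) :
    (ε ^ 2) ^ i ≤ (growth D N τ r * ε) ^ i * ((i : ℝ) ^ m * major D N τ η i μ) := by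
  have hi1 : (1 : ℝ) ≤ i := by exact_mod_cast hi
  have := growth_pos N τ hD hr hr1
  have hpow : (ε ^ 2) ^ i * (i : ℝ) ^ N ≤ (growth D N τ r * ε) ^ i := by
    have h := le_growth_mul_pow (N := N) (i := i) (q := 0) (j := 0) (x := i) hτ hr hr1 hε hε1 hD hi
      (by push_cast; linarith) (Nat.zero_le _)
    simp only [pow_zero, one_mul, mul_one, add_zero] at h
    rw [mul_comm]
    exact le_trans (by gcongr; exact pow_le_factorial_mul_exp i N) h
  calc (ε ^ 2) ^ i ≤ (growth D N τ r * ε) ^ i * (1 * ((i : ℝ) ^ N)⁻¹) := by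
        rw [one_mul, ← div_eq_mul_inv]
        exact (le_div_iff₀ (by positivity)).2 hpow
    _ ≤ _ := by
        gcongr
        · exact one_le_pow₀ hi1
        · exact inv_pow_le_major hτ hη hD hi μ

theorem seriesBound_jetProd_indices {D N : ℕ} {τ η r β ε : ℝ} (hτ : 0 ≤ τ) (hη : 0 ≤ η)
    (hr : 0 < r) (hr1 : r ≤ 1) (hβ : 0 ≤ β) (hε : 0 ≤ ε) (hD1 : 1 ≤ D)
    (hD : ∀ p ∈ M, (p.2 : ℝ) * (1 + η) ≤ D) {ν : M →₀ ℕ} (hν : ν ≠ 0)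
    (hN : ∀ μ, mNu (1 + η) ν μ + 2 ≤ N) {u : FormalTX} (hu0 : ∀ l, cf u 0 l = 0)
    (hu : ∀ k l, 1 ≤ k → ‖cf u k l‖ * r ^ l * β ^ k ≤ ε * major D N τ η k l) :
    SeriesBound D N τ η r β (mNu (1 + η) ν) ((2 ^ (N + 2))⁻¹ * (ε * jetFactor D N r) ^ ν.degree)
      ν.degree (jetProd u (indices ν)) := by
  have hindices : indices ν ≠ 0 := by
    rw [← Multiset.card_pos, card_indices]
    exact Nat.pos_of_ne_zero fun h => hν ((Finsupp.degree_eq_zero_iff ν).1 h)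
  have hjet : 0 ≤ jetFactor D N r := zero_le_one.trans (one_le_jetFactor N hD1 hr hr1)
  have hfactor : (2 ^ (N + 2))⁻¹ * (ε * jetFactor D N r) = ε * (derivLoss D * (r ^ D)⁻¹) := by
    rw [jetFactor, mul_left_comm, inv_mul_cancel_left₀ (by positivity)]
  rw [← card_indices]
  refine seriesBound_jetProd hτ hη hr.le hβ (mNu_nonneg hν) hN (by positivity) hindices ?_
  intro p hp
  obtain ⟨p, rfl, hνp⟩ := exists_of_mem_indices hp
  rw [hfactor]
  exact seriesBound_jet hη hr hr1 hβ hε hD1 hu0 hu (hD p p.2) (le_mNu hνp)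

theorem norm_cf_jetProd_indices_le {m D N i : ℕ} {τ η r ε : ℝ} (hτ : 0 ≤ τ) (hη : 0 ≤ η)
    (hr : 0 < r) (hr1 : r ≤ 1) (hε : 0 < ε) (hε1 : ε ≤ 1) (hD1 : 1 ≤ D)
    (hD : ∀ p ∈ M, (p.2 : ℝ) * (1 + η) ≤ D) (hN : ∀ p ∈ M, (p.1 : ℝ) + (1 + η) * p.2 + 2 ≤ N)
    {u : FormalTX} (hu0 : ∀ l, cf u 0 l = 0)
    (hu : ∀ k l, 1 ≤ k → ‖cf u k l‖ * r ^ l * (ε ^ 2) ^ k ≤ ε * major D N τ η k l)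
    {μ : ℕ} {ν : M →₀ ℕ} (hν : ν ≠ 0) (hn : 2 ≤ i + ν.degree)
    (hτν : mNu (1 + η) ν μ - m ≤ τ * ((i : ℝ) + ν.degree - 1)) (k l : ℕ) :
    ‖cf (jetProd u (indices ν)) k l‖ * r ^ l * (ε ^ 2) ^ k * (ε ^ 2) ^ i ≤
      (growth D N τ r * ε) ^ (i + ν.degree) *
        (((k + i : ℕ) : ℝ) ^ m * major D N τ η (k + i) (l + μ)) := by
  have := growth_pos N τ hD1 hr hr1
  have := major_nonneg D N τ η (k + i) (l + μ)
  have hdeg : 1 ≤ ν.degree :=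
    Nat.one_le_iff_ne_zero.2 fun h => hν ((Finsupp.degree_eq_zero_iff ν).1 h)
  have hmN : ∀ μ, mNu (1 + η) ν μ + 2 ≤ N := fun μ => by
    have hσ : 1 ≤ 1 + η := by linarith
    linarith [mNu_le (B := N - 2) hσ hν μ fun p hp => by linarith [hN p hp]]
  have hbound := seriesBound_jetProd_indices hτ hη hr hr1 (by positivity) hε.le hD1 hD hν hmN hu0 hu
  rcases lt_or_ge k ν.degree with hk | hk
  · rw [hbound.1 k l hk, norm_zero, zero_mul, zero_mul, zero_mul]
    positivity
  have hjet : 0 ≤ jetFactor D N r := zero_le_one.trans (one_le_jetFactor N hD1 hr hr1)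
  have hexchange := seriesWeight_le_pow_mul_major (D := D) (N := N) (η := η) hτ hdeg hk hn
    (mNu_nonneg hν μ) (by linarith [hmN μ]) hτν (l + μ)
  have := seriesWeight_nonneg D N τ η ν.degree (mNu (1 + η) ν μ) k (l + μ)
  have hhalf : (2 ^ (N + 2) : ℝ)⁻¹ ≤ 1 := inv_le_one_of_one_le₀ (one_le_pow₀ one_le_two)
  have hconst := le_growth_mul_pow (N := N) (i := i) (x := 1 + i) hτ hr hr1 hε hε1 hD1
    (one_le_two.trans hn) (by exact_mod_cast (by omega : 1 + i ≤ 2 * (i + ν.degree))) le_rfl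
  calc ‖cf (jetProd u (indices ν)) k l‖ * r ^ l * (ε ^ 2) ^ k * (ε ^ 2) ^ i
      ≤ (2 ^ (N + 2))⁻¹ * (ε * jetFactor D N r) ^ ν.degree *
        seriesWeight D N τ η ν.degree (mNu (1 + η) ν μ) k (l + μ) * (ε ^ 2) ^ i :=
        mul_le_mul_of_nonneg_right (hbound.2 k l μ hk) (by positivity)
    _ ≤ 1 * (ε * jetFactor D N r) ^ ν.degree *
        (N ! * Real.exp (1 + i) * Real.exp τ ^ (i + ν.degree) *
          (((k + i : ℕ) : ℝ) ^ m * major D N τ η (k + i) (l + μ))) * (ε ^ 2) ^ i := by gcongr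
    _ = (ε * jetFactor D N r) ^ ν.degree * (N ! * Real.exp (1 + i)) *
        Real.exp τ ^ (i + ν.degree) * (ε ^ 2) ^ i *
        (((k + i : ℕ) : ℝ) ^ m * major D N τ η (k + i) (l + μ)) := by ring
    _ ≤ _ := by gcongr

theorem norm_cf_jetMonomial_le {m D N : ℕ} {τ η r ε : ℝ} (hτ : 0 ≤ τ) (hη : 0 ≤ η) (hr : 0 < r)
    (hr1 : r ≤ 1) (hε : 0 < ε) (hε1 : ε ≤ 1) (hD1 : 1 ≤ D)
    (hD : ∀ p ∈ M, (p.2 : ℝ) * (1 + η) ≤ D) (hN : ∀ p ∈ M, (p.1 : ℝ) + (1 + η) * p.2 + 2 ≤ N)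
    {u : FormalTX} (hu0 : ∀ l, cf u 0 l = 0)
    (hu : ∀ k l, 1 ≤ k → ‖cf u k l‖ * r ^ l * (ε ^ 2) ^ k ≤ ε * major D N τ η k l)
    {i μ : ℕ} {ν : M →₀ ℕ} (hn : 2 ≤ i + ν.degree)
    (hτν : 1 ≤ ν.degree → mNu (1 + η) ν μ - m ≤ τ * ((i : ℝ) + ν.degree - 1)) (k l : ℕ) :
    ‖cf (jetMonomial u (expo i μ ν)) k l‖ * r ^ l * (ε ^ 2) ^ k ≤
      (growth D N τ r * ε) ^ (i + ν.degree) * r ^ μ * ((k : ℝ) ^ m * major D N τ η k l) := by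
  have hgrowth := growth_pos N τ hD1 hr hr1
  have := major_nonneg D N τ η k l
  rw [jetMonomial_expo, cf_X_zero_pow_mul, cf_X_one_pow_mul]
  split_ifs with hik hμl
  · obtain ⟨k, rfl⟩ := Nat.exists_eq_add_of_le' hik
    obtain ⟨l, rfl⟩ := Nat.exists_eq_add_of_le' hμl
    rw [Nat.add_sub_cancel, Nat.add_sub_cancel, pow_add r, pow_add (ε ^ 2)]
    suffices ‖cf (jetProd u (indices ν)) k l‖ * r ^ l * (ε ^ 2) ^ k * (ε ^ 2) ^ i ≤
        (growth D N τ r * ε) ^ (i + ν.degree) *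
          (((k + i : ℕ) : ℝ) ^ m * major D N τ η (k + i) (l + μ)) by
      have := mul_le_mul_of_nonneg_left this (pow_nonneg hr.le μ)
      linarith
    rcases eq_or_ne ν 0 with rfl | hν
    · rw [map_zero, add_zero] at hn ⊢
      rw [show indices (0 : M →₀ ℕ) = 0 by simp [indices], jetProd_zero, cf_one]
      split_ifs with h
      · obtain ⟨rfl, rfl⟩ := h
        simpa using pow_le_growth_mul_major hτ hη hr hr1 hε hε1 hD1 (one_le_two.trans hn) μ
      · rw [norm_zero, zero_mul, zero_mul, zero_mul]
        positivity
    · exact norm_cf_jetProd_indices_le hτ hη hr hr1 hε hε1 hD1 hD hN hu0 hu hν hn (hτν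
        (Nat.one_le_iff_ne_zero.2 fun h => hν ((Finsupp.degree_eq_zero_iff ν).1 h))) k l
  all_goals
    rw [norm_zero, zero_mul, zero_mul]
    positivity

end

/-! ### The majorant estimate for the solution -/

section

variable {M : Finset (ℕ × ℕ)} {m : ℕ} {c : ℕ × ℕ → ℂ → ℂ} {a : ℂ → ℂ} {G : (Vars M → ℂ) → ℂ}
  {u : FormalTX}

theorem norm_coeff_mul_cf_jetMonomial_le {D N : ℕ} {τ η r ε ρ : ℝ} (hτ : 0 ≤ τ) (hη : 0 ≤ η)
    (hr : 0 < r) (hr1 : r ≤ 1) (hε : 0 < ε) (hε1 : ε ≤ 1) (hD1 : 1 ≤ D)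
    (hD : ∀ p ∈ M, (p.2 : ℝ) * (1 + η) ≤ D) (hN : ∀ p ∈ M, (p.1 : ℝ) + (1 + η) * p.2 + 2 ≤ N)
    (hG : OrderAtLeastTwo G) (hrρ : r ≤ ρ) (hερ : growth D N τ r * ε ≤ ρ)
    (hslope : ∀ (i μ : ℕ) (ν : M →₀ ℕ), gCoeff G i ν μ ≠ 0 → 2 ≤ i + ν.degree → 1 ≤ ν.degree →
      mNu (1 + η) ν μ - m ≤ τ * ((i : ℝ) + ν.degree - 1))
    (hu0 : ∀ l, cf u 0 l = 0)
    (hu : ∀ k l, 1 ≤ k → ‖cf u k l‖ * r ^ l * (ε ^ 2) ^ k ≤ ε * major D N τ η k l)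
    (k l : ℕ) (d : Vars M →₀ ℕ) :
    ‖MvPowerSeries.coeff d (taylorSeries G) * cf (jetMonomial u d) k l‖ * (r ^ l * (ε ^ 2) ^ k) ≤
      ‖MvPowerSeries.coeff d (taylorSeries G)‖ * ρ ^ d.degree *
        ((growth D N τ r * ε / ρ) ^ 2 * ((k : ℝ) ^ m * major D N τ η k l)) := by
  obtain ⟨i, μ, ν, rfl⟩ := exists_eq_expo d
  rcases eq_or_ne (MvPowerSeries.coeff (expo i μ ν) (taylorSeries G)) 0 with h0 | h0
  · simp [h0]
  have hn : 2 ≤ i + ν.degree := by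
    by_contra hlt
    exact h0 (hG i ν (by omega) μ)
  have hgrowth := growth_pos N τ hD1 hr hr1
  have hρ : 0 < ρ := hr.trans_le hrρ
  set V : ℝ := (k : ℝ) ^ m * major D N τ η k l
  have hV : 0 ≤ V := mul_nonneg (by positivity) (major_nonneg ..)
  have hquad : (growth D N τ r * ε) ^ (i + ν.degree) ≤
      (growth D N τ r * ε / ρ) ^ 2 * ρ ^ (i + ν.degree) := by
    obtain ⟨n, hn⟩ := Nat.exists_eq_add_of_le hn
    rw [hn, pow_add, pow_add, ← mul_assoc, ← mul_pow, div_mul_cancel₀ _ hρ.ne']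
    gcongr
  rw [norm_mul, mul_assoc, mul_assoc, ← mul_assoc ‖cf _ k l‖, degree_expo]
  refine mul_le_mul_of_nonneg_left ?_ (norm_nonneg _)
  calc ‖cf (jetMonomial u (expo i μ ν)) k l‖ * r ^ l * (ε ^ 2) ^ k
      ≤ (growth D N τ r * ε) ^ (i + ν.degree) * r ^ μ * V :=
        norm_cf_jetMonomial_le hτ hη hr hr1 hε hε1 hD1 hD hN hu0 hu hn (hslope i μ ν h0 hn) k l
    _ ≤ (growth D N τ r * ε / ρ) ^ 2 * ρ ^ (i + ν.degree) * ρ ^ μ * V := by gcongr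
    _ = _ := by ring

theorem norm_cf_compose_le_major {D N : ℕ} {τ η r ε ρ H : ℝ} (hτ : 0 ≤ τ) (hη : 0 ≤ η)
    (hr : 0 < r) (hr1 : r ≤ 1) (hε : 0 < ε) (hε1 : ε ≤ 1) (hD1 : 1 ≤ D)
    (hD : ∀ p ∈ M, (p.2 : ℝ) * (1 + η) ≤ D) (hN : ∀ p ∈ M, (p.1 : ℝ) + (1 + η) * p.2 + 2 ≤ N)
    (hG : OrderAtLeastTwo G)
    (hH : ∀ S : Finset (Vars M →₀ ℕ),
      ∑ d ∈ S, ‖MvPowerSeries.coeff d (taylorSeries G)‖ * ρ ^ d.degree ≤ H)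
    (hrρ : r ≤ ρ) (hερ : growth D N τ r * ε ≤ ρ)
    (hslope : ∀ (i μ : ℕ) (ν : M →₀ ℕ), gCoeff G i ν μ ≠ 0 → 2 ≤ i + ν.degree → 1 ≤ ν.degree →
      mNu (1 + η) ν μ - m ≤ τ * ((i : ℝ) + ν.degree - 1))
    (hu0 : ∀ l, cf u 0 l = 0)
    (hu : ∀ k l, 1 ≤ k → ‖cf u k l‖ * r ^ l * (ε ^ 2) ^ k ≤ ε * major D N τ η k l) (k l : ℕ) :
    ‖cf (compose G u) k l‖ * r ^ l * (ε ^ 2) ^ k ≤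
      H * ((growth D N τ r * ε / ρ) ^ 2 * ((k : ℝ) ^ m * major D N τ η k l)) := by
  set w : ℝ := r ^ l * (ε ^ 2) ^ k with hw
  have hw0 : 0 < w := by positivity
  have hmajor := major_nonneg D N τ η k l
  rw [mul_assoc, ← hw, ← le_div_iff₀ hw0]
  refine norm_cf_compose_le (vanishesAtTZero_iff.2 hu0) (fun d => (le_div_iff₀ hw0).2
    (norm_coeff_mul_cf_jetMonomial_le hτ hη hr hr1 hε hε1 hD1 hD hN hG hrρ hερ hslope hu0 hu k l d))
    fun S => ?_
  rw [← Finset.sum_div, ← Finset.sum_mul]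
  gcongr
  exact hH S

theorem sum_range_pow_sub_le {x : ℝ} (hx0 : 0 ≤ x) (hx : x ≤ 1 / 2) (l : ℕ) :
    ∑ n ∈ Finset.range l, x ^ (l - n) ≤ 2 * x := by
  induction l with
  | zero => simpa using hx0
  | succ l ih =>
    have hshift :
        ∑ n ∈ Finset.range l, x ^ (l + 1 - n) = x * ∑ n ∈ Finset.range l, x ^ (l - n) := by
      rw [Finset.mul_sum]
      refine Finset.sum_congr rfl fun n hn => ?_
      rw [← pow_succ', Nat.sub_add_comm (Finset.mem_range.1 hn).le]
    rw [Finset.sum_range_succ, hshift, Nat.add_sub_cancel_left, pow_one]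
    nlinarith

theorem norm_lowerPart_term_le {p : ℕ × ℕ} (hp : p ∈ I m) (hc : AnalyticAt ℂ (c p) 0)
    {r κ B : ℝ} (hr : 0 ≤ r) (hB : 0 ≤ B) {E k l n : ℕ} (hE : 1 ≤ E) (hk : 1 ≤ k) (hn : n ≤ l)
    {z : ℂ} (hz : ‖z‖ * r ^ n * κ ≤ B * (n ! : ℝ) ^ (sigma0 m c - 1) * Nat.multichoose E n) :
    ‖taylorCoeff (c p) (l - n) * ((k : ℂ) ^ p.1 * ((n.descFactorial p.2 : ℕ) : ℂ) * z)‖ *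
        (r ^ l * κ) ≤
      ‖taylorCoeff (c p) (l - n)‖ * (r ^ (l - n) *
        (weightSum m c k l * (B * (l ! : ℝ) ^ (sigma0 m c - 1) * Nat.multichoose E l))) := by
  rcases eq_or_ne (taylorCoeff (c p) (l - n)) 0 with h0 | h0
  · simp [h0]
  have hweight := pow_mul_descFactorial_le_weightSum hp hc h0 hk n
  rw [Nat.add_sub_cancel' hn] at hweight
  have : 0 < weightSum m c k l := weightSum_pos hk l
  have hmulti : (Nat.multichoose E n : ℝ) ≤ Nat.multichoose E l := by
    exact_mod_cast multichoose_mono_right hE hn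
  rw [norm_mul, norm_mul, norm_mul, norm_pow, Complex.norm_natCast, Complex.norm_natCast,
    mul_assoc]
  refine mul_le_mul_of_nonneg_left ?_ (norm_nonneg _)
  calc (k : ℝ) ^ p.1 * (n.descFactorial p.2 : ℝ) * ‖z‖ * (r ^ l * κ)
      = r ^ (l - n) * ((k : ℝ) ^ p.1 * (n.descFactorial p.2 : ℝ)) * (‖z‖ * r ^ n * κ) := by
        rw [← pow_sub_mul_pow r hn]
        ring
    _ ≤ r ^ (l - n) * ((k : ℝ) ^ p.1 * (n.descFactorial p.2 : ℝ)) *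
        (B * (n ! : ℝ) ^ (sigma0 m c - 1) * Nat.multichoose E n) := by gcongr
    _ = r ^ (l - n) * (((k : ℝ) ^ p.1 * (n.descFactorial p.2 : ℝ) *
        (n ! : ℝ) ^ (sigma0 m c - 1)) * (B * Nat.multichoose E n)) := by ring
    _ ≤ r ^ (l - n) * ((weightSum m c k l * (l ! : ℝ) ^ (sigma0 m c - 1)) *
        (B * Nat.multichoose E l)) := by gcongr
    _ = _ := by ring

theorem norm_lowerPart_le (hc : ∀ p ∈ I m, AnalyticAt ℂ (c p) 0) {H R r κ B : ℝ} (hH0 : 0 ≤ H)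
    (hR : 0 ≤ R) (hH : ∀ n, ∑ p ∈ I m, ‖taylorCoeff (c p) n‖ ≤ H * R ^ n) (hr : 0 ≤ r)
    (hRr : R * r ≤ 1 / 2) (hκ : 0 ≤ κ) (hB : 0 ≤ B) {E k l : ℕ} (hE : 1 ≤ E) (hk : 1 ≤ k)
    {w : ℕ → ℂ}
    (hw : ∀ n < l, ‖w n‖ * r ^ n * κ ≤ B * (n ! : ℝ) ^ (sigma0 m c - 1) * Nat.multichoose E n) :
    ‖lowerPart m c k l w‖ * r ^ l * κ ≤ H * (2 * (R * r)) *
      (weightSum m c k l * (B * (l ! : ℝ) ^ (sigma0 m c - 1) * Nat.multichoose E l)) := by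
  set X : ℝ := weightSum m c k l * (B * (l ! : ℝ) ^ (sigma0 m c - 1) * Nat.multichoose E l)
  have hX : 0 ≤ X := mul_nonneg (weightSum_pos hk l).le (by positivity)
  calc ‖lowerPart m c k l w‖ * r ^ l * κ
      ≤ (∑ n ∈ Finset.range l, ∑ p ∈ I m,
          ‖taylorCoeff (c p) (l - n) * ((k : ℂ) ^ p.1 * ((n.descFactorial p.2 : ℕ) : ℂ) * w n)‖) *
          (r ^ l * κ) := by
        rw [mul_assoc]
        gcongr
        exact norm_sum_le_of_le _ fun n _ => norm_sum_le _ _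
    _ = ∑ n ∈ Finset.range l, ∑ p ∈ I m,
          ‖taylorCoeff (c p) (l - n) * ((k : ℂ) ^ p.1 * ((n.descFactorial p.2 : ℕ) : ℂ) * w n)‖ *
          (r ^ l * κ) := by simp only [Finset.sum_mul]
    _ ≤ ∑ n ∈ Finset.range l, ∑ p ∈ I m, ‖taylorCoeff (c p) (l - n)‖ * (r ^ (l - n) * X) := by
        refine Finset.sum_le_sum fun n hn => Finset.sum_le_sum fun p hp => ?_
        have hnl := Finset.mem_range.1 hn
        exact norm_lowerPart_term_le hp (hc p hp) hr hB hE hk hnl.le (hw n hnl)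
    _ ≤ ∑ n ∈ Finset.range l, H * X * (R * r) ^ (l - n) := by
        refine Finset.sum_le_sum fun n _ => ?_
        rw [← Finset.sum_mul]
        refine (mul_le_mul_of_nonneg_right (hH _) (by positivity)).trans_eq ?_
        rw [mul_pow]
        ring
    _ = H * X * ∑ n ∈ Finset.range l, (R * r) ^ (l - n) := by rw [Finset.mul_sum]
    _ ≤ H * X * (2 * (R * r)) := by
        gcongr
        exact sum_range_pow_sub_le (by positivity) hRr l
    _ = _ := by ring

theorem exists_nat_forall_le {ι : Type*} (s : Finset ι) (f : ι → ℝ) :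
    ∃ n : ℕ, 1 ≤ n ∧ ∀ i ∈ s, f i ≤ n := by
  obtain ⟨n, hn⟩ := exists_nat_ge (∑ i ∈ s, |f i|)
  refine ⟨n + 1, Nat.le_add_left 1 n, fun i hi => ?_⟩
  have hle := Finset.single_le_sum (fun j _ => abs_nonneg (f j)) hi
  push_cast
  linarith [le_abs_self (f i)]

theorem bddAbove_insert_slopes {σ : ℝ} (hσ : 1 ≤ σ) (G : (Vars M → ℂ) → ℂ) :
    BddAbove (insert 0 (slopes m σ G)) := by
  obtain ⟨B, -, hB⟩ := exists_nat_forall_le M fun p => (p.1 : ℝ) + σ * p.2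
  refine ⟨B, ?_⟩
  rintro y (rfl | ⟨μ, q, ⟨hdeg, hν, -⟩, rfl⟩)
  · positivity
  have hν0 : q.2 ≠ 0 := by
    intro h
    rw [h, map_zero] at hν
    omega
  have hmB := mNu_le hσ hν0 μ hB
  have hden : (2 : ℝ) ≤ (q.1 : ℝ) + q.2.degree := by exact_mod_cast hdeg
  rw [div_le_iff₀ (by linarith)]
  have : (0 : ℝ) ≤ m := by positivity
  have : (0 : ℝ) ≤ B := by positivity
  nlinarith

theorem one_le_s0 (m : ℕ) (c : ℕ × ℕ → ℂ → ℂ) (G : (Vars M → ℂ) → ℂ) : 1 ≤ s0 m c G :=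
  le_add_of_nonneg_right (le_csSup (bddAbove_insert_slopes one_le_sigma0 G) (Set.mem_insert _ _))

theorem mNu_sub_le {i μ : ℕ} {ν : M →₀ ℕ} (hg : gCoeff G i ν μ ≠ 0) (hn : 2 ≤ i + ν.degree)
    (hν : 1 ≤ ν.degree) :
    mNu (sigma0 m c) ν μ - m ≤ (s0 m c G - 1) * ((i : ℝ) + ν.degree - 1) := by
  have hden : (2 : ℝ) ≤ (i : ℝ) + ν.degree := by exact_mod_cast hn
  have hmem : (mNu (sigma0 m c) ν μ - m) / ((i : ℝ) + ν.degree - 1) ∈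
      slopes m (sigma0 m c) G := ⟨μ, (i, ν), ⟨hn, hν, hg⟩, rfl⟩
  have hle := le_csSup (bddAbove_insert_slopes one_le_sigma0 G) (Set.mem_insert_of_mem 0 hmem)
  rwa [div_le_iff₀ (by linarith), ← add_sub_cancel_left 1 (sSup _)] at hle

theorem norm_taylorCoeff_source_le {A R r ε δ τ η : ℝ} {D N k : ℕ} (hA : 0 ≤ A) (hR : 0 ≤ R)
    (ha : ∀ n, ‖taylorCoeff a n‖ ≤ A * R ^ n) (hr : 0 ≤ r) (hRr : R * r ≤ 1) (hε : 0 ≤ ε)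
    (hAε : A * ε ≤ δ) (hτ : 0 ≤ τ) (hη : 0 ≤ η) (hD : 1 ≤ D) (hk : 1 ≤ k) (l : ℕ) :
    ‖if k = 1 then taylorCoeff a l else 0‖ * (r ^ l * (ε ^ 2) ^ k) ≤
      δ * (weightSum m c k l * (ε * major D N τ η k l)) := by
  have hδ : 0 ≤ δ := le_trans (by positivity) hAε
  have hweight : 1 ≤ weightSum m c k l :=
    (one_le_pow₀ (by exact_mod_cast hk)).trans (pow_le_weightSum k l)
  have hmajor := major_nonneg D N τ η k l
  split_ifs with hk1
  · subst hk1
    have hmajor1 := inv_pow_le_major (N := N) hτ hη hD le_rfl l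
    rw [Nat.cast_one, one_pow, inv_one] at hmajor1
    calc ‖taylorCoeff a l‖ * (r ^ l * (ε ^ 2) ^ 1) ≤ A * R ^ l * (r ^ l * (ε ^ 2) ^ 1) := by
          gcongr
          exact ha l
      _ = (A * ε) * (R * r) ^ l * (1 * (ε * 1)) := by rw [mul_pow]; ring
      _ ≤ δ * 1 * (weightSum m c 1 l * (ε * major D N τ η 1 l)) := by
          gcongr
          exact pow_le_one₀ (by positivity) hRr
      _ = _ := by rw [mul_one]
  · rw [norm_zero, zero_mul]
    positivity

theorem norm_mul_le_of_mul_eq_add {L z x₁ x₂ x₃ : ℂ} {δ W B w : ℝ} (hδ : 0 < δ) (hW : 0 < W)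
    (hw : 0 ≤ w) (hL : δ * W ≤ ‖L‖) (h : L * z = x₁ + (x₂ + x₃))
    (h₁ : ‖x₁‖ * w ≤ δ / 2 * (W * B)) (h₂ : ‖x₂‖ * w ≤ δ / 4 * (W * B))
    (h₃ : ‖x₃‖ * w ≤ δ / 4 * (W * B)) : ‖z‖ * w ≤ B := by
  refine le_of_mul_le_mul_left ?_ (mul_pos hδ hW)
  calc δ * W * (‖z‖ * w) ≤ ‖L‖ * (‖z‖ * w) := by gcongr
    _ = ‖x₁ + (x₂ + x₃)‖ * w := by rw [← h, norm_mul, mul_assoc]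
    _ ≤ (‖x₁‖ + (‖x₂‖ + ‖x₃‖)) * w := by
        gcongr
        exact (norm_add_le _ _).trans (add_le_add_right (norm_add_le _ _) _)
    _ ≤ _ := by linarith

theorem norm_cf_le_major {D N : ℕ} {r ε ρ δ H A B R S : ℝ}
    (hc : ∀ p ∈ I m, AnalyticAt ℂ (c p) 0) (hG : OrderAtLeastTwo G)
    (hu : IsFormalSolution m c a G u) (hδ : 0 < δ)
    (hL : ∀ k l, 1 ≤ k → δ * weightSum m c k l ≤ ‖L m c k l‖)
    (hA : 0 ≤ A) (hR : 0 ≤ R) (hlin : ∀ n, ∑ p ∈ I m, ‖taylorCoeff (c p) n‖ ≤ A * R ^ n)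
    (hB : 0 ≤ B) (hS : 0 ≤ S) (ha : ∀ n, ‖taylorCoeff a n‖ ≤ B * S ^ n)
    (hH : ∀ T : Finset (Vars M →₀ ℕ),
      ∑ d ∈ T, ‖MvPowerSeries.coeff d (taylorSeries G)‖ * ρ ^ d.degree ≤ H)
    (hD1 : 1 ≤ D) (hD : ∀ p ∈ M, (p.2 : ℝ) * (1 + (sigma0 m c - 1)) ≤ D)
    (hN : ∀ p ∈ M, (p.1 : ℝ) + (1 + (sigma0 m c - 1)) * p.2 + 2 ≤ N)
    (hr : 0 < r) (hr1 : r ≤ 1) (hrρ : r ≤ ρ) (hRr : R * r ≤ 1 / 2) (hAr : A * (2 * (R * r)) ≤ δ / 2)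
    (hSr : S * r ≤ 1) (hε : 0 < ε) (hε1 : ε ≤ 1) (hερ : growth D N (s0 m c G - 1) r * ε ≤ ρ)
    (hHε : H * growth D N (s0 m c G - 1) r ^ 2 / ρ ^ 2 * ε ≤ δ / 4) (hBε : B * ε ≤ δ / 4) (k l : ℕ)
    (hk : 1 ≤ k) :
    ‖cf u k l‖ * r ^ l * (ε ^ 2) ^ k ≤ ε * major D N (s0 m c G - 1) (sigma0 m c - 1) k l := by
  have hη : 0 ≤ sigma0 m c - 1 := sub_nonneg.2 one_le_sigma0
  have hτ : 0 ≤ s0 m c G - 1 := sub_nonneg.2 (one_le_s0 m c G)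
  have : 0 ≤ H := by simpa using hH ∅
  have hrec := ((isFormalSolution_iff hG).1 hu).2
  induction k using Nat.strong_induction_on generalizing l with | _ k ihk =>
  induction l using Nat.strong_induction_on with | _ l ihl =>
  have hmajor := major_nonneg D N (s0 m c G - 1) (sigma0 m c - 1) k l
  have linear := norm_lowerPart_le hc hA hR hlin hr.le hRr (κ := (ε ^ 2) ^ k)
    (B := ε * (((k : ℝ) ^ N)⁻¹ * (k ! : ℝ) ^ (s0 m c G - 1))) (by positivity) (by positivity)
    (Nat.mul_pos hD1 (by omega : 0 < 4 * k - 2)) hk (l := l) (w := cf u k)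
    (fun n hn => (ihl n hn).trans_eq (by rw [major]; ring))
  have nonlinear := norm_cf_compose_le_major (m := m) hτ hη hr hr1 hε hε1 hD1 hD hN hG hH hrρ hερ
    (fun i μ ν => by rw [add_sub_cancel]; exact mNu_sub_le)
    (u := truncT k (cf u)) (fun l => by simp [cf_truncT]) (fun k' l' hk' => by
      rw [cf_truncT]
      split_ifs with hlt
      · exact ihk k' hlt.2 l' hk'
      · simpa using mul_nonneg hε.le (major_nonneg D N _ _ k' l')) k l
  rw [mul_assoc] at linear nonlinear ⊢
  refine norm_mul_le_of_mul_eq_add hδ (weightSum_pos hk l) (by positivity) (hL k l hk)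
    (hrec k l hk) (linear.trans ?_)
    (norm_taylorCoeff_source_le hB hS ha hr.le hSr hε.le hBε hτ hη hD1 hk l) (nonlinear.trans ?_)
  · have := weightSum_pos (m := m) (c := c) hk l
    rw [major]
    refine (mul_le_mul_of_nonneg_right hAr (by positivity)).trans_eq ?_
    ring
  · calc _ = H * growth D N (s0 m c G - 1) r ^ 2 / ρ ^ 2 * ε *
          ((k : ℝ) ^ m * (ε * major D N (s0 m c G - 1) (sigma0 m c - 1) k l)) := by
          rw [div_pow]
          ring
      _ ≤ _ := by
          gcongr
          exact pow_le_weightSum k l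

theorem eventually_mul_le (a : ℝ) {b : ℝ} (hb : 0 < b) :
    ∀ᶠ x in 𝓝[>] (0 : ℝ), a * x ≤ b := by
  have : Filter.Tendsto (fun x : ℝ => a * x) (𝓝[>] 0) (𝓝 (a * 0)) :=
    (tendsto_const_nhds.mul Filter.tendsto_id).mono_left nhdsWithin_le_nhds
  rw [mul_zero] at this
  exact this.eventually_le_const hb

theorem exists_major_bound (hc : ∀ p ∈ I m, AnalyticAt ℂ (c p) 0) (ha : AnalyticAt ℂ a 0)
    (hG : AnalyticAt ℂ G 0) (hG₂ : OrderAtLeastTwo G) (hN : NonResonant m c)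
    (hGP : GenPoincare m c) (hu : IsFormalSolution m c a G u) :
    ∃ (D N : ℕ) (r ε : ℝ), 0 < r ∧ 0 < ε ∧ ∀ k l, 1 ≤ k →
      ‖cf u k l‖ * r ^ l * (ε ^ 2) ^ k ≤ ε * major D N (s0 m c G - 1) (sigma0 m c - 1) k l := by
  obtain ⟨δ, hδ, hL⟩ := exists_weightSum_le_norm_L hN hGP
  obtain ⟨A, R, hA, hR, hlin⟩ := exists_sum_norm_taylorCoeff_le hc
  obtain ⟨B, S, hB, hS, hsource⟩ := exists_norm_taylorCoeff_le ha
  obtain ⟨H, ρ, hρ, hH⟩ := exists_sum_norm_coeff_taylorSeries_le hG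
  obtain ⟨D, hD1, hD⟩ := exists_nat_forall_le M fun p => (p.2 : ℝ) * (1 + (sigma0 m c - 1))
  obtain ⟨N, -, hN⟩ := exists_nat_forall_le M fun p =>
    (p.1 : ℝ) + (1 + (sigma0 m c - 1)) * p.2 + 2
  obtain ⟨r, hr, hr1, hrρ, hRr, hAr, hSr⟩ :=
    ((eventually_mem_nhdsWithin (a := (0 : ℝ)) (s := Set.Ioi 0)).and <|
      (eventually_mul_le 1 one_pos).and <| (eventually_mul_le 1 hρ).and <|
      (eventually_mul_le R one_half_pos).and <|
      (eventually_mul_le (A * (2 * R)) (half_pos hδ)).and <| eventually_mul_le S one_pos).exists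
  have hδ4 : 0 < δ / 4 := by positivity
  obtain ⟨ε, hε, hε1, hερ, hHε, hBε⟩ :=
    ((eventually_mem_nhdsWithin (a := (0 : ℝ)) (s := Set.Ioi 0)).and <|
      (eventually_mul_le 1 one_pos).and <|
      (eventually_mul_le (growth D N (s0 m c G - 1) r) hρ).and <|
      (eventually_mul_le (H * growth D N (s0 m c G - 1) r ^ 2 / ρ ^ 2) hδ4).and <|
      eventually_mul_le B hδ4).exists
  rw [one_mul] at hr1 hrρ hε1
  exact ⟨D, N, r, ε, hr, hε, norm_cf_le_major hc hG₂ hu hδ hL hA hR hlin hB.le hS.le hsource hH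
    hD1 hD hN hr hr1 hrρ hRr (by linarith) hSr hε hε1 hερ hHε hBε⟩

/-! ### Membership in the Gevrey class -/

theorem mem_Gevrey_of_le {s σ A Y : ℝ} (hs : 1 ≤ s) (hσ : 1 ≤ σ) (hY : 0 < Y)
    (h : ∀ k l, ‖cf u k l‖ ≤ A * Y ^ (k + l) * ((k ! : ℝ) ^ (s - 1) * (l ! : ℝ) ^ (σ - 1))) :
    u ∈ Gevrey s σ := by
  refine ⟨hs, hσ, convergesNearZero_of_le (H := A) hY fun e => ?_⟩
  set g : ℝ := ((e 0)! : ℝ) ^ (s - 1) * ((e 1)! : ℝ) ^ (σ - 1)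
  have hg : 0 < g := by positivity
  change ‖MvPowerSeries.coeff e u / ((g : ℝ) : ℂ)‖ ≤ _
  rw [coeff_eq_cf, norm_div, Complex.norm_real, Real.norm_of_nonneg hg.le, div_le_iff₀ hg,
    Finsupp.degree_eq_sum, Fin.sum_univ_two]
  exact h (e 0) (e 1)

theorem major_le_pow_mul {D N k l : ℕ} {τ η τ' η' : ℝ} (hτ : τ ≤ τ') (hη : η ≤ η') (hk : 1 ≤ k) :
    major D N τ η k l ≤ (2 ^ (4 * D)) ^ k * 2 ^ l * ((k ! : ℝ) ^ τ' * (l ! : ℝ) ^ η') := by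
  have hk! : (1 : ℝ) ≤ k ! := by exact_mod_cast Nat.factorial_pos k
  have hl! : (1 : ℝ) ≤ l ! := by exact_mod_cast Nat.factorial_pos l
  have hinv : ((k : ℝ) ^ N)⁻¹ ≤ 1 := inv_le_one_of_one_le₀ (one_le_pow₀ (by exact_mod_cast hk))
  have hmulti : (Nat.multichoose (D * (4 * k - 2)) l : ℝ) ≤ (2 ^ (4 * D)) ^ k * 2 ^ l := by
    rw [← pow_mul, ← pow_add]
    have hexp : D * (4 * k - 2) + l ≤ 4 * D * k + l := by
      have : D * (4 * k - 2) ≤ D * (4 * k) := Nat.mul_le_mul_left D (Nat.sub_le _ _)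
      linarith
    exact_mod_cast (multichoose_le_two_pow _ _).trans (Nat.pow_le_pow_right two_pos hexp)
  calc major D N τ η k l
      ≤ 1 * (k ! : ℝ) ^ τ' * (l ! : ℝ) ^ η' * ((2 ^ (4 * D)) ^ k * 2 ^ l) := by
        rw [major]
        gcongr
    _ = _ := by ring

theorem mem_Gevrey_of_major_bound {D N : ℕ} {s σ τ η r ε : ℝ} (hτ : 0 ≤ τ) (hη : 0 ≤ η)
    (hs : 1 + τ ≤ s) (hσ : 1 + η ≤ σ) (hr : 0 < r) (hε : 0 < ε) (hu0 : ∀ l, cf u 0 l = 0)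
    (hu : ∀ k l, 1 ≤ k → ‖cf u k l‖ * r ^ l * (ε ^ 2) ^ k ≤ ε * major D N τ η k l) :
    u ∈ Gevrey s σ := by
  set Y : ℝ := max (2 ^ (4 * D) / ε ^ 2) (2 / r)
  have hY : 0 < Y := lt_max_of_lt_right (by positivity)
  have hYε : 2 ^ (4 * D) ≤ Y * ε ^ 2 := (div_le_iff₀ (by positivity)).1 (le_max_left _ _)
  have hYr : 2 ≤ Y * r := (div_le_iff₀ hr).1 (le_max_right _ _)
  refine mem_Gevrey_of_le (A := ε) (by linarith) (by linarith) hY fun k l => ?_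
  rcases Nat.eq_zero_or_pos k with rfl | hk
  · rw [hu0, norm_zero]
    positivity
  refine le_of_mul_le_mul_right ?_ (by positivity : 0 < r ^ l * (ε ^ 2) ^ k)
  calc ‖cf u k l‖ * (r ^ l * (ε ^ 2) ^ k)
      ≤ ε * major D N τ η k l := by
        rw [← mul_assoc]
        exact hu k l hk
    _ ≤ ε * ((2 ^ (4 * D)) ^ k * 2 ^ l * ((k ! : ℝ) ^ (s - 1) * (l ! : ℝ) ^ (σ - 1))) := by
        gcongr
        exact major_le_pow_mul (by linarith) (by linarith) hk
    _ ≤ ε * ((Y * ε ^ 2) ^ k * (Y * r) ^ l * ((k ! : ℝ) ^ (s - 1) * (l ! : ℝ) ^ (σ - 1))) := by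
        gcongr
    _ = _ := by rw [pow_add, mul_pow, mul_pow]; ring

end

end TotChar

theorem theorem6p1 (m : ℕ) (hm : 1 ≤ m)
    (c : ℕ × ℕ → ℂ → ℂ) (hc : ∀ p ∈ TotChar.I m, AnalyticAt ℂ (c p) 0)
    (a : ℂ → ℂ) (ha : AnalyticAt ℂ a 0)
    (M : Finset (ℕ × ℕ)) (G : (TotChar.Vars M → ℂ) → ℂ) (hG : AnalyticAt ℂ G 0)
    (hG₂ : TotChar.OrderAtLeastTwo G)
    (hN : TotChar.NonResonant m c) (hGP : TotChar.GenPoincare m c) :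
    (∃! u : TotChar.FormalTX, TotChar.IsFormalSolution m c a G u) ∧
      ∀ u : TotChar.FormalTX, TotChar.IsFormalSolution m c a G u →
        ∀ s σ : ℝ, TotChar.s0 m c G ≤ s → TotChar.sigma0 m c ≤ σ → u ∈ TotChar.Gevrey s σ := by
  refine ⟨TotChar.existsUnique_isFormalSolution a hG₂ hN, fun u hu s σ hs hσ => ?_⟩
  obtain ⟨D, N, r, ε, hr, hε, h⟩ := TotChar.exists_major_bound hc ha hG hG₂ hN hGP hu
  exact TotChar.mem_Gevrey_of_major_bound (sub_nonneg.2 (TotChar.one_le_s0 m c G))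
    (sub_nonneg.2 TotChar.one_le_sigma0) (by linarith) (by linarith) hr hε
    ((TotChar.isFormalSolution_iff hG₂).1 hu).1 h
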